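/- Let $K$ be an algebraically closed field and $n\ge 2$. Let $\mathcal U_{\mathbf Z}$ be the subring of the universal enveloping algebra of $\mathfrak{sl}_n(\mathbf C)$ generated by all $E_{s,t}^m/m!$ with $s\ne t$, $m\ge 0$, where $E_{s,t}$ are the matrix units, and let $\mathcal U=\mathcal U_{\mathbf Z}\otimes_{\mathbf Z}K$ be the hyperalgebra of $SL_n$. Put $E_{s,t}^{(m)}=(E_{s,t}^m/m!)\otimes 1$ for $m\ge 0$ and $E_{s,t}^{(m)}=0$ for $m<0$; for $l=1,\dots,n-1$ put $H_l=E_{l,l}-E_{l+1,l+1}$ and $H_{l,m}=\binom{H_l}{m}\otimes 1$. Let $\mathcal U^-$ be the subalgebra of $\mathcal U$ generated by all $E_{t,s}^{(m)}$ with $s<t$, let $\mathcal U^0$ be the subalgebra generated by all $H_{l,m}$, and let $\mathcal U^{-,0}=\mathcal U^-\mathcal U^0$. Let $\mathrm{UT}(n)$ be the additive group of integer $n\times n$ matrices with zero entries on and below the diagonal. For $N\in \mathrm{UT}(n)$ put $F^{(N)}=\prod_{1\le a<b\le n}E_{b,a}^{(N_{a,b})}$, where $E_{b,a}^{(N_{a,b})}$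 precedes $E_{d,c}^{(N_{c,d})}$ if and only if $b<d$, or $b=d$ and $a<c$. For $l=1,\dots,n-1$ let $\eta_{\alpha_l}$ be the linear operator on $\mathcal U^{-,0}$ such that $E_{l,l+1}P-\eta_{\alpha_l}(P)$ lies, for every $P\in\mathcal U^{-,0}$, in the left ideal of $\mathcal U$ generated by all $E_{s,t}^{(k)}$ with $s<t$ and $k>0$. For $i=1,\dots,n-1$ let $\theta_{\omega_i}$ be the linear operator on $\mathcal U^{-,0}$ that takes $F^{(N)}\prod_{l}H_{l,k_l}$ to $F^{(N)}\prod_{l}\left(\binom{H_l+\delta_{l,i}}{k_l}\otimes 1\right)$ for all $N\in\mathrm{UT}(n)$ and $k_1,\dots,k_{n-1}\ge 0$, where $\delta_{l,i}$ is the Kronecker delta. (Both operators exist and are unique.) Put $[\![i_1,\dots,i_k]\!]_i=[\eta_{\alpha_{i_1}},[\eta_{\alpha_{i_2}},\dots,[\eta_{\alpha_{i_k}},\theta_{\omega_i}]\dots]]$, where $[x,y]=xy-yx$; for $k=0$ this is $\theta_{\omega_i}$. For $1\le a\le i\le b<n$, a sequence satisfies $\mathcal O(a,i,b)$ if it is obtained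 by inserting the sequences $a,a+1,\dots,i-1$ and $b,b-1,\dots,i+1$ into one another, preserving the order in either of them. A flow with distinct sources $a_1,\dots,a_q$ and distinct sinks $b_1,\dots,b_q$ is a directed graph on $\{1,\dots,n\}$, all of whose edges $(s,t)$ satisfy $s<t$, such that exactly one edge begins and no edge ends at each source, exactly one edge ends and no edge begins at each sink, and at every other vertex either no edge begins or ends, or exactly one edge begins and exactly one edge ends; in the latter case the vertex is a transit point. For $a_1<\dots<a_q\le i<b_q<\dots<b_1$, let $\mathcal F_i(a_1,\dots,a_q;b_1,\dots,b_q)$ be the set of such flows having no transit point greater than $i$, and put $\mathrm{sgn}_i(\Gamma)=\mathrm{sgn}(\sigma)\,(-1)^{\sum_{j=1}^q(b_j-i)+(\text{number of transit points of }\Gamma)}$, where $\sigma$ is the permutation such that $a_j$ and $b_{\sigma(j)}$ lie in the same connected component of $\Gamma$ for every $j$. Identify $\Gamma$ with the matrix of $\mathrm{UT}(n)$ whose $(s,t)$-entry is the number of edges from $s$ to $t$. Lemma. Let $1\le i\le n-1$, $q\ge 0$ and $1\le a_1<a_2<\dots<a_q\le i<b_q<\dots<b_2<b_1\le n$ be integers,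 and for $j=1,\dots,q$ let $i^{(j)}_1,\dots,i^{(j)}_{k_j}$ be a sequence satisfying $\mathcal O(a_j,i,b_j-1)$. Let $\mathcal H_N\in\mathcal U^0$, $N\in\mathrm{UT}(n)$, be nonzero for only finitely many $N$. Then $$[\![i^{(q)}_1,\dots,i^{(q)}_{k_q},i,\,i^{(q-1)}_1,\dots,i^{(q-1)}_{k_{q-1}},i,\,\dots,\,i^{(1)}_1,\dots,i^{(1)}_{k_1},i]\!]_i\Big(\sum_{N\in\mathrm{UT}(n)}F^{(N)}\mathcal H_N\Big)=\sum_{N\in\mathrm{UT}(n)}F^{(N)}\sum_{\Gamma\in\mathcal F_i(a_1,\dots,a_q;b_1,\dots,b_q)}\mathrm{sgn}_i(\Gamma)\,\theta_{\omega_i}(\mathcal H_{N+\Gamma}).$$ In particular, the operator $[\![i^{(q)}_1,\dots,i^{(q)}_{k_q},i,\dots,i^{(1)}_1,\dots,i^{(1)}_{k_1},i]\!]_i$ on $\mathcal U^{-,0}$ depends only on $a_1,\dots,a_q$, $b_1,\dots,b_q$ and $i$. -/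

import Mathlib

noncomputable section

namespace Hyperalgebra

open scoped TensorProduct

/-! ### Divided powers and binomial coefficients in an algebra over `ℂ` -/

section DividedPowers

open Polynomial

variable {A : Type*} [Ring A] [Algebra ℂ A]

/-- The divided power `x ^ m / m!`. -/
def divPow (x : A) (m : ℕ) : A := ((m.factorial : ℂ)⁻¹) • x ^ m

/-- The binomial coefficient `x (x - 1) ⋯ (x - m + 1) / m!`. -/
def binom (x : A) (m : ℕ) : A := ((m.factorial : ℂ)⁻¹) • aeval x (descPochhammer ℂ m)

/-! The helper facts of this section lead to `binom_mem`: a subring that contains the divided powers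
of the elements `e` and `f` of an `sl₂`-triple contains the binomial coefficients of `h + r`, `r ∈ ℤ`. -/

/-- Divided powers with integer exponents, zero for negative exponents. -/
def divPowInt (x : A) (m : ℤ) : A := if m < 0 then 0 else divPow x m.toNat

theorem divPowInt_natCast (x : A) (m : ℕ) : divPowInt x m = divPow x m := by
  simp [divPowInt]

theorem divPowInt_neg (x : A) {m : ℤ} (h : m < 0) : divPowInt x m = 0 := by
  simp [divPowInt, h]

theorem mul_divPow (x : A) (m : ℕ) : x * divPow x m = ((m : ℂ) + 1) • divPow x (m + 1) := by
  have h : (m.factorial : ℂ) ≠ 0 := by exact_mod_cast m.factorial_ne_zero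
  have h' : (m : ℂ) + 1 ≠ 0 := by exact_mod_cast m.succ_ne_zero
  rw [divPow, divPow, mul_smul_comm, ← pow_succ', smul_smul, Nat.factorial_succ]
  congr 1
  push_cast
  field_simp

theorem mul_divPowInt (x : A) (m : ℤ) :
    x * divPowInt x m = ((m : ℂ) + 1) • divPowInt x (m + 1) := by
  rcases lt_trichotomy m (-1) with h | rfl | h
  · rw [divPowInt_neg _ (by omega), divPowInt_neg _ (by omega)]; simp
  · rw [divPowInt_neg _ (by omega)]; simp
  · lift m to ℕ using by omega
    have := mul_divPow x m
    rw [← divPowInt_natCast, ← divPowInt_natCast] at this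
    exact_mod_cast this

/-- The polynomial `binom (X + z) k`. -/
def binomPoly (k : ℕ) (z : ℂ) : ℂ[X] :=
  C ((k.factorial : ℂ)⁻¹) * (descPochhammer ℂ k).comp (X + C z)

theorem aeval_binomPoly (h : A) (k : ℕ) (z : ℤ) :
    aeval h (binomPoly k z) = binom (h + (z : A)) k := by
  simp [binomPoly, binom, aeval_comp, Algebra.smul_def]

theorem binomPoly_step (c : ℂ) (k : ℕ) (z : ℂ) :
    C (c - k) * binomPoly (k + 1) (z - 1) + (X + C (z + c - k)) * binomPoly k (z - 1)
      = C (c + 1) * binomPoly (k + 1) z := by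
  have h : (k.factorial : ℂ) ≠ 0 := by exact_mod_cast k.factorial_ne_zero
  have h' : (k : ℂ) + 1 ≠ 0 := by exact_mod_cast k.succ_ne_zero
  have e1 : binomPoly (k + 1) (z - 1)
      = C (((k : ℂ) + 1)⁻¹) * ((X + C (z - 1 - k)) * binomPoly k (z - 1)) := by
    rw [binomPoly, binomPoly, descPochhammer_succ_right, Nat.factorial_succ]
    simp
    ring
  have e2 : binomPoly (k + 1) z
      = C (((k : ℂ) + 1)⁻¹) * ((X + C z) * binomPoly k (z - 1)) := by
    rw [binomPoly, binomPoly, descPochhammer_succ_left, Nat.factorial_succ]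
    simp [comp_assoc]
    ring_nf
  have e3 : binomPoly k (z - 1) = C (((k : ℂ) + 1)⁻¹) * (C ((k : ℂ) + 1) * binomPoly k (z - 1)) := by
    rw [← mul_assoc, ← C_mul, inv_mul_cancel₀ h', C_1, one_mul]
  rw [e1, e2]
  nth_rewrite 2 [e3]
  simp only [C_add, C_sub, C_1]
  ring

theorem binomPoly_comp (k : ℕ) (z : ℂ) : (binomPoly k z).comp (X - C 2) = binomPoly k (z - 2) := by
  simp only [binomPoly, mul_comp, C_comp, comp_assoc, add_comp, X_comp, C_sub]
  congr 2
  ring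

section sl2
variable {e f h : A}
theorem mul_aeval (hhe : e * h = (h - 2) * e)
    (p : ℂ[X]) : e * aeval h p = aeval h (p.comp (X - C 2)) * e := by
  induction p using Polynomial.induction_on' with
  | add p q hp hq => simp [mul_add, add_mul, hp, hq]
  | monomial n a =>
    simp only [aeval_monomial, monomial_comp, map_mul, aeval_C, map_pow, map_sub, aeval_X]
    rw [← mul_assoc, ← Algebra.commutes, mul_assoc, mul_assoc]
    congr 1
    simp only [map_ofNat]
    induction n with
    | zero => simp
    | succ n ih => rw [pow_succ, ← mul_assoc, ih, mul_assoc, hhe, pow_succ, mul_assoc]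
theorem mul_divPow_f (hef : e * f = f * e + h) (hhf : h * f = f * (h - 2))
    (m : ℕ) : e * divPow f (m + 1) = divPow f (m + 1) * e
    + divPow f m * (h - (m : A)) := by
  have key : ∀ m : ℕ, e * f ^ (m + 1) = f ^ (m + 1) * e + ((m : ℂ) + 1) • (f ^ m * (h - (m : A))) := by
    intro m
    induction m with
    | zero => simp [hef]
    | succ m ih =>
      have hc : ∀ k : ℕ, (k : A) = (k : ℂ) • (1 : A) := fun k => by simp [Algebra.smul_def]
      rw [pow_succ, ← mul_assoc, ih, add_mul, mul_assoc, hef, smul_mul_assoc, mul_assoc (f ^ m),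
        sub_mul, hhf]
      have h2 : (2 : A) = (2 : ℂ) • (1 : A) := by exact_mod_cast hc 2
      simp only [hc, h2, pow_succ, mul_sub, mul_add, mul_smul_comm, smul_mul_assoc, mul_one,
        one_mul, mul_assoc, Nat.cast_add, Nat.cast_one]
      module
  have h1 : (m.factorial : ℂ) ≠ 0 := by exact_mod_cast m.factorial_ne_zero
  have h' : (m : ℂ) + 1 ≠ 0 := by exact_mod_cast m.succ_ne_zero
  simp only [divPow, mul_smul_comm, smul_mul_assoc, key, smul_add, smul_smul]
  congr 2
  rw [Nat.factorial_succ]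
  push_cast
  field_simp

theorem mul_divPowInt_f (hef : e * f = f * e + h) (hhf : h * f = f * (h - 2))
    (m : ℤ) : e * divPowInt f m = divPowInt f m * e
    + divPowInt f (m - 1) * aeval h (X + C ((1 - m : ℤ) : ℂ)) := by
  rcases lt_trichotomy m 0 with hm | rfl | hm
  · simp [divPowInt_neg f hm, divPowInt_neg f (show m - 1 < 0 by omega)]
  · simp [divPowInt, divPow]
  · obtain ⟨k, rfl⟩ : ∃ k : ℕ, m = (k + 1 : ℕ) := ⟨(m - 1).toNat, by omega⟩
    have := mul_divPow_f hef hhf k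
    rw [divPowInt_natCast, show ((k + 1 : ℕ) : ℤ) - 1 = k by push_cast; ring, divPowInt_natCast, this]
    congr 2
    simp
    abel

theorem divPow_comm (hef : e * f = f * e + h) (hhe : e * h = (h - 2) * e) (hhf : h * f = f * (h - 2))
    (d : ℤ) (c : ℕ) : ∀ K > c, divPowInt e c * divPowInt f d =
    ∑ k ∈ Finset.range K, divPowInt f (d - k) *
      aeval h (binomPoly k ((-c - d + 2 * k : ℤ) : ℂ)) * divPowInt e (c - k) := by
  induction c with
  | zero =>
    intro K hK
    rw [Finset.sum_eq_single 0]
    · simp [binomPoly, divPowInt, divPow]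
    · intro b _ hb
      rw [divPowInt_neg e (by omega)]; simp
    · intro h0; simp at h0; omega
  | succ c ih =>
    intro K hK
    obtain ⟨K, rfl⟩ : ∃ K', K = K' + 1 := ⟨K - 1, by omega⟩
    have hne : (c : ℂ) + 1 ≠ 0 := by exact_mod_cast c.succ_ne_zero
    have h1 : ((c : ℂ) + 1) • (divPowInt e (c + 1 : ℕ) * divPowInt f d) =
        e * (divPowInt e c * divPowInt f d) := by
      rw [← mul_assoc, mul_divPowInt, smul_mul_assoc]; push_cast; rfl
    have h2 : ∀ k : ℕ, e * (divPowInt f (d - k) *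
        aeval h (binomPoly k ((-c - d + 2 * k : ℤ) : ℂ)) * divPowInt e (c - k)) =
        divPowInt f (d - k) * aeval h (C ((c : ℂ) - k + 1) *
          binomPoly k ((-c - d + 2 * k - 2 : ℤ) : ℂ)) * divPowInt e (c + 1 - k)
        + divPowInt f (d - (k + 1 : ℕ)) * aeval h ((X + C ((1 - (d - k) : ℤ) : ℂ)) *
          binomPoly k ((-c - d + 2 * k : ℤ) : ℂ)) * divPowInt e (c + 1 - (k + 1 : ℕ)) := by
      intro k
      rw [← mul_assoc, ← mul_assoc, mul_divPowInt_f hef hhf, add_mul, add_mul, mul_assoc _ e,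
        mul_aeval hhe, binomPoly_comp, ← mul_assoc, mul_assoc _ e, mul_divPowInt]
      congr 1
      · rw [map_mul, aeval_C, ← Algebra.smul_def, mul_smul_comm, mul_smul_comm, smul_mul_assoc]
        congr 2
        · push_cast; ring
        · congr 3
          push_cast; ring
        · congr 1; ring
      · rw [map_mul, ← mul_assoc, show d - ((k + 1 : ℕ) : ℤ) = d - k - 1 by push_cast; ring,
          show (c : ℤ) + 1 - ((k + 1 : ℕ) : ℤ) = c - k by push_cast; ring]
    have h3 : (((c : ℂ) + 1) • (divPowInt e (c + 1 : ℕ) * divPowInt f d)) =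
        ((c : ℂ) + 1) • ∑ k ∈ Finset.range (K + 1), divPowInt f (d - k) *
          aeval h (binomPoly k ((-(c + 1 : ℕ) - d + 2 * k : ℤ) : ℂ)) *
            divPowInt e ((c + 1 : ℕ) - k) := by
      rw [h1, ih (K + 1) (by omega), Finset.mul_sum, Finset.sum_congr rfl fun k _ => h2 k,
        Finset.sum_add_distrib, Finset.sum_range_succ', Finset.sum_range_succ (n := K),
        Finset.smul_sum, Finset.sum_range_succ' (n := K)]
      have hz : divPowInt e ((c : ℤ) + 1 - (K + 1 : ℕ)) = 0 := divPowInt_neg e (by omega)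
      rw [hz, mul_zero, add_zero, add_right_comm, ← Finset.sum_add_distrib]
      congr 1
      · refine Finset.sum_congr rfl fun k _ => ?_
        rw [← add_mul, ← mul_add, ← map_add]
        have hp := binomPoly_step (c : ℂ) k ((-(c + 1 : ℕ) - d + 2 * (k + 1 : ℕ) : ℤ) : ℂ)
        rw [← smul_mul_assoc, ← mul_smul_comm, ← map_smul, smul_eq_C_mul, ← hp]
        have z1 : ((-c - d + 2 * (k + 1 : ℕ) - 2 : ℤ) : ℂ) =
            ((-(c + 1 : ℕ) - d + 2 * (k + 1 : ℕ) : ℤ) : ℂ) - 1 := by push_cast; ring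
        have z2 : ((-c - d + 2 * k : ℤ) : ℂ) =
            ((-(c + 1 : ℕ) - d + 2 * (k + 1 : ℕ) : ℤ) : ℂ) - 1 := by push_cast; ring
        have z3 : ((1 - (d - k) : ℤ) : ℂ) =
            ((-(c + 1 : ℕ) - d + 2 * (k + 1 : ℕ) : ℤ) : ℂ) + c - k := by push_cast; ring
        have z4 : (c : ℂ) - (k + 1 : ℕ) + 1 = c - k := by push_cast; ring
        rw [z1, z2, z3, z4]
        simp only [Nat.cast_add, Nat.cast_one]
      · have hC : aeval h (C ((c : ℂ) + 1)) = ((c : ℂ) + 1) • (1 : A) := by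
          rw [aeval_C, Algebra.smul_def, mul_one]
        simp only [binomPoly, Nat.factorial_zero, descPochhammer_zero, one_comp, Nat.cast_one,
          inv_one, mul_one, map_one, Nat.cast_zero, sub_zero, hC, mul_smul_comm,
          smul_mul_assoc]
        push_cast
        rfl
    exact smul_right_injective A hne h3

theorem binom_add_mem (S : Subring A) (h : A) (M : ℕ)
    (hS : ∀ k ≤ M, binom h k ∈ S) (r : ℤ) : ∀ k ≤ M, binom (h + (r : A)) k ∈ S := by
  have step : ∀ (z : ℤ) (k : ℕ), binom (h + ((z + 1 : ℤ) : A)) (k + 1) =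
      binom (h + (z : A)) (k + 1) + binom (h + (z : A)) k := by
    intro z k
    have h0 := binomPoly_step 0 k ((z + 1 : ℤ) : ℂ)
    have h1 := binomPoly_step 1 k ((z + 1 : ℤ) : ℂ)
    have hz : ((z + 1 : ℤ) : ℂ) - 1 = z := by push_cast; ring
    rw [hz] at h0 h1
    rw [← aeval_binomPoly, ← aeval_binomPoly, ← aeval_binomPoly, ← map_add]
    congr 1
    simp only [C_add, C_sub, C_1, C_0] at h0 h1
    linear_combination h0 - h1
  have zero : ∀ z : ℤ, binom (h + (z : A)) 0 ∈ S := fun z => by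
    simp [binom, S.one_mem]
  induction r using Int.induction_on with
  | zero => simpa using hS
  | succ i ih =>
    intro k hk
    cases k with
    | zero => exact zero _
    | succ k =>
      rw [step]
      exact S.add_mem (ih _ hk) (ih _ (by omega))
  | pred i ih =>
    intro k
    induction k with
    | zero => intro _; exact zero _
    | succ k ihk =>
      intro hk
      have := step (-i - 1) k
      rw [sub_add_cancel] at this
      rw [eq_sub_iff_add_eq.2 this.symm]
      exact S.sub_mem (ih _ hk) (ihk (by omega))

theorem binom_mem (hef : e * f = f * e + h) (hhe : e * h = (h - 2) * e) (hhf : h * f = f * (h - 2))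
    (S : Subring A) (he : ∀ m, divPow e m ∈ S) (hf : ∀ m, divPow f m ∈ S) (m : ℕ) :
    ∀ r : ℤ, binom (h + (r : A)) m ∈ S := by
  induction m using Nat.strong_induction_on with
  | _ m ih =>
    have hz : binom h m ∈ S := by
      have key := divPow_comm hef hhe hhf (m : ℤ) m (m + 1) (by omega)
      rw [Finset.sum_range_succ] at key
      have hlast : divPowInt f ((m : ℤ) - m) * aeval h (binomPoly m ((-m - m + 2 * m : ℤ) : ℂ)) *
          divPowInt e ((m : ℤ) - m) = binom h m := by
        rw [show (-m - m + 2 * m : ℤ) = 0 by ring, aeval_binomPoly]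
        simp [divPowInt, divPow]
      have hI : ∀ (x : A), (∀ m, divPow x m ∈ S) → ∀ j : ℤ, divPowInt x j ∈ S := by
        intro x hx j
        rw [divPowInt]; split_ifs
        · exact S.zero_mem
        · exact hx _
      rw [hlast] at key
      rw [eq_sub_iff_add_eq'.2 key.symm]
      refine S.sub_mem (S.mul_mem (hI e he _) (hI f hf _)) (S.sum_mem fun k hk => ?_)
      rw [aeval_binomPoly]
      exact S.mul_mem (S.mul_mem (hI f hf _) (ih k (Finset.mem_range.1 hk) _)) (hI e he _)
    intro r
    refine binom_add_mem S h m (fun k hk => ?_) r m le_rfl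
    rcases hk.lt_or_eq with hk | rfl
    · simpa using ih k hk 0
    · exact hz
end sl2

end DividedPowers

/-! ### The hyperalgebra of `SL_n`, `n = ℓ + 1`

Rows and columns of `n × n` matrices are indexed by `Fin (ℓ + 1)` and simple roots by `Fin ℓ`; both
index sets start at `0`. The positive roots are the pairs `s < t`, and the simple root with index `l`
is the pair `(l.castSucc, l.succ)`, that is, `(l, l + 1)`. -/

/-- The Lie algebra `𝔰𝔩_n(ℂ)`, `n = ℓ + 1`. -/
abbrev LieSL (ℓ : ℕ) := LieAlgebra.SpecialLinear.sl (Fin (ℓ + 1)) ℂ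

/-- The universal enveloping algebra of `𝔰𝔩_n(ℂ)`. -/
abbrev EnvSL (ℓ : ℕ) := UniversalEnvelopingAlgebra ℂ (LieSL ℓ)

/-- The root vector `E_{s,t}`, `s ≠ t`, in the universal enveloping algebra. -/
def rootVec {ℓ : ℕ} (s t : Fin (ℓ + 1)) (h : s ≠ t) : EnvSL ℓ :=
  UniversalEnvelopingAlgebra.ι ℂ (LieAlgebra.SpecialLinear.single s t h 1)

/-- The element `H_{α_l} = E_{l,l} - E_{l+1,l+1}` of the universal enveloping algebra. -/
def coroot {ℓ : ℕ} (l : Fin ℓ) : EnvSL ℓ :=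
  UniversalEnvelopingAlgebra.ι ℂ (LieAlgebra.SpecialLinear.singleSubSingle l.castSucc l.succ 1)

/-- The integral form `𝒰_ℤ`: the subring generated by all `E_{s,t} ^ m / m!` with `s ≠ t`. -/
def kostantForm (ℓ : ℕ) : Subring (EnvSL ℓ) :=
  Subring.closure {x | ∃ (s t : Fin (ℓ + 1)) (h : s ≠ t) (m : ℕ), x = divPow (rootVec s t h) m}

theorem divPow_mem {ℓ : ℕ} (s t : Fin (ℓ + 1)) (h : s ≠ t) (m : ℕ) :
    divPow (rootVec s t h) m ∈ kostantForm ℓ :=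
  Subring.subset_closure ⟨s, t, h, m, rfl⟩

theorem binom_coroot_mem {ℓ : ℕ} (l : Fin ℓ) (r : ℤ) (m : ℕ) :
    binom (coroot l + (r : EnvSL ℓ)) m ∈ kostantForm ℓ := by
  have hne : l.castSucc ≠ l.succ := l.castSucc_lt_succ.ne
  have hι : ∀ x y z : LieSL ℓ, ⁅x, y⁆ = z →
      UniversalEnvelopingAlgebra.ι ℂ x * UniversalEnvelopingAlgebra.ι ℂ y
        - UniversalEnvelopingAlgebra.ι ℂ y * UniversalEnvelopingAlgebra.ι ℂ x
        = UniversalEnvelopingAlgebra.ι ℂ z := by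
    rintro x y z rfl
    let : LieRing (EnvSL ℓ) := LieRing.ofAssociativeRing
    exact (LieHom.map_lie (UniversalEnvelopingAlgebra.ι ℂ) x y).symm
  have h1 := hι (LieAlgebra.SpecialLinear.single _ _ hne 1)
    (LieAlgebra.SpecialLinear.single _ _ hne.symm 1)
    (LieAlgebra.SpecialLinear.singleSubSingle l.castSucc l.succ 1) (by
      apply Subtype.ext
      rw [LieAlgebra.SpecialLinear.sl_bracket]
      simp)
  have h2 := hι (LieAlgebra.SpecialLinear.singleSubSingle l.castSucc l.succ 1)
    (LieAlgebra.SpecialLinear.single _ _ hne 1)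
    ((2 : ℂ) • LieAlgebra.SpecialLinear.single _ _ hne 1) (by
      apply Subtype.ext
      rw [LieAlgebra.SpecialLinear.sl_bracket]
      simp [sub_mul, mul_sub, hne.symm, two_smul])
  have h3 := hι (LieAlgebra.SpecialLinear.singleSubSingle l.castSucc l.succ 1)
    (LieAlgebra.SpecialLinear.single _ _ hne.symm 1)
    ((-2 : ℂ) • LieAlgebra.SpecialLinear.single _ _ hne.symm 1) (by
      apply Subtype.ext
      rw [LieAlgebra.SpecialLinear.sl_bracket]
      simp [sub_mul, mul_sub, hne, two_smul]
      try abel)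
  rw [map_smul, Algebra.smul_def] at h2 h3
  rw [map_ofNat] at h2
  rw [map_neg, map_ofNat] at h3
  refine binom_mem (e := rootVec _ _ hne) (f := rootVec _ _ hne.symm) (h := coroot l)
    ?_ ?_ ?_ _ (divPow_mem _ _ _) (divPow_mem _ _ _) m r
  · exact eq_add_of_sub_eq' h1
  · rw [sub_mul]
    exact (sub_eq_of_eq_add (sub_eq_iff_eq_add.1 h2 |>.trans (add_comm _ _))).symm
  · have hc : rootVec _ _ hne.symm * 2 = 2 * rootVec _ _ hne.symm :=
      (Nat.cast_commute 2 (rootVec _ _ hne.symm)).symm.eq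
    rw [mul_sub, hc]
    have h4 := sub_eq_iff_eq_add.1 h3
    rw [neg_mul, neg_add_eq_sub] at h4
    exact h4

/-- The hyperalgebra `𝒰 = 𝒰_ℤ ⊗ K` of `SL_n` over `K`. -/
abbrev Hyp (K : Type*) [Field K] (ℓ : ℕ) := K ⊗[ℤ] (kostantForm ℓ)

variable (K : Type*) [Field K] {ℓ : ℕ}

/-- The element `E_{s,t}^{(m)} = (E_{s,t} ^ m / m!) ⊗ 1` of the hyperalgebra. -/
def X (s t : Fin (ℓ + 1)) (h : s ≠ t) (m : ℕ) : Hyp K ℓ :=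
  1 ⊗ₜ[ℤ] ⟨divPow (rootVec s t h) m, divPow_mem s t h m⟩

/-- The element `binom(H_{α_l} + r, m) ⊗ 1` of the hyperalgebra, `r ∈ ℤ`. -/
def HBinom (l : Fin ℓ) (r : ℤ) (m : ℕ) : Hyp K ℓ :=
  1 ⊗ₜ[ℤ] ⟨binom (coroot l + (r : EnvSL ℓ)) m, binom_coroot_mem l r m⟩

variable (ℓ) in
/-- `𝒰⁻`: the subalgebra generated by all `X_{α,m}` with `α` negative. -/
def uMinus : Subalgebra K (Hyp K ℓ) :=
  Algebra.adjoin K {x | ∃ (s t : Fin (ℓ + 1)) (h : s < t) (m : ℕ), x = X K t s h.ne' m}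

variable (ℓ) in
/-- `𝒰⁰`: the subalgebra generated by all `H_{α_l,m}`. -/
def uZero : Subalgebra K (Hyp K ℓ) :=
  Algebra.adjoin K {x | ∃ (l : Fin ℓ) (m : ℕ), x = HBinom K l 0 m}

variable (ℓ) in
/-- `𝒰^{-,0} = 𝒰⁻ 𝒰⁰`. -/
def uMinusZero : Submodule K (Hyp K ℓ) :=
  (uMinus K ℓ).toSubmodule * (uZero K ℓ).toSubmodule

variable (ℓ) in
/-- The left ideal of `𝒰` generated by all `X_{β,k}` with `β` positive and `k > 0`. -/
def posLeftIdeal : Ideal (Hyp K ℓ) :=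
  Ideal.span {x | ∃ (s t : Fin (ℓ + 1)) (h : s < t) (k : ℕ), 0 < k ∧ x = X K s t h.ne k}

/-- An element of `𝒰⁰` as an element of `𝒰^{-,0}`. -/
def zeroIncl (h : uZero K ℓ) : uMinusZero K ℓ :=
  ⟨h, by
    have h1 : (1 : Hyp K ℓ) ∈ (uMinus K ℓ).toSubmodule := one_mem (uMinus K ℓ)
    have h2 : (h : Hyp K ℓ) ∈ (uZero K ℓ).toSubmodule := h.2
    rw [← one_mul (h : Hyp K ℓ)]
    exact Submodule.mul_mem_mul h1 h2⟩

/-! ### The elements `F^{(N)}` -/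

/-- `UT(n)`: the integer matrices whose entries on and below the diagonal are zero. -/
def UT (n : ℕ) : AddSubgroup (Matrix (Fin n) (Fin n) ℤ) where
  carrier := {N | ∀ a b, b ≤ a → N a b = 0}
  zero_mem' := fun _ _ _ => rfl
  add_mem' := fun {M N} hM hN a b h => by simp [hM a b h, hN a b h]
  neg_mem' := fun {M} hM a b h => by simp [hM a b h]

/-- `E_{s,t}^{(m)}` for `m ∈ ℤ`, zero for `m < 0`. -/
def XInt (s t : Fin (ℓ + 1)) (h : s ≠ t) (m : ℤ) : Hyp K ℓ :=
  if m < 0 then 0 else X K s t h m.toNat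

/-- `F^{(N)}`: the product of all `E_{b,a}^{(N_{a,b})}` with `a < b`, where the factor with `(b, a)`
precedes the factor with `(d, c)` if `b < d`, or `b = d` and `a < c`. -/
def F (N : UT (ℓ + 1)) : Hyp K ℓ :=
  (List.ofFn fun b : Fin (ℓ + 1) =>
    (List.ofFn fun a : Fin (ℓ + 1) =>
      if h : a < b then XInt K b a h.ne' (N.1 a b) else 1).prod).prod

theorem F_mem (N : UT (ℓ + 1)) : F K N ∈ uMinus K ℓ := by
  refine list_prod_mem fun x hx => ?_
  obtain ⟨b, rfl⟩ := (List.mem_ofFn' _ _).1 hx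
  refine list_prod_mem fun y hy => ?_
  obtain ⟨a, rfl⟩ := (List.mem_ofFn' _ _).1 hy
  dsimp only
  split_ifs with h
  · unfold XInt
    split_ifs
    · exact zero_mem _
    · exact Algebra.subset_adjoin ⟨a, b, h, _, rfl⟩
  · exact one_mem _

/-- The element `F^{(N)} h` of `𝒰^{-,0}`, where `h ∈ 𝒰⁰`. -/
def FMul (N : UT (ℓ + 1)) (h : uZero K ℓ) : uMinusZero K ℓ :=
  ⟨F K N * h, Submodule.mul_mem_mul (F_mem K N) h.2⟩

/-! ### The operators `η_{α,m}`, `θ_δ` and their commutators -/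

/-- The operator `η_{α,m}` on `𝒰^{-,0}`, where `α` is the positive root `(s, t)`: the linear operator
with `X_{α,m} P ≡ η_{α,m}(P)` modulo the left ideal generated by all `X_{β,k}` with `β` positive and
`k > 0`. It exists and is unique, since `𝒰` is the direct sum of `𝒰^{-,0}` and this left ideal. -/
def eta (s t : Fin (ℓ + 1)) (h : s < t) (m : ℕ) : Module.End K (uMinusZero K ℓ) :=
  Classical.epsilon fun f => ∀ P : uMinusZero K ℓ,
    X K s t h.ne m * (P : Hyp K ℓ) - (f P : Hyp K ℓ) ∈ posLeftIdeal K ℓ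

/-- The operator `η_{α_l} = η_{α_l,1}`. -/
def etaSimple (l : Fin ℓ) : Module.End K (uMinusZero K ℓ) :=
  eta K l.castSucc l.succ l.castSucc_lt_succ 1

/-- The twisting operator `θ_δ` on `𝒰^{-,0}`, where the weight `δ` is given by its coordinates with
respect to the fundamental weights, so that `δ(H_{α_l}) = δ l`: the linear operator that takes
`F^{(N)} ∏ H_{α_l,k_l}` to `F^{(N)} ∏ binom(H_{α_l} + δ(H_{α_l}), k_l) ⊗ 1`. It exists and is unique,
since the elements `F^{(N)} ∏ H_{α_l,k_l}` with `N ≥ 0` form a basis of `𝒰^{-,0}`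
(and `F^{(N)} = 0` if `N` has a negative entry). -/
def theta (δ : Fin ℓ → ℤ) : Module.End K (uMinusZero K ℓ) :=
  Classical.epsilon fun f => ∀ (N : UT (ℓ + 1)) (k : Fin ℓ → ℕ) (P : uMinusZero K ℓ),
    (P : Hyp K ℓ) = F K N * (List.ofFn fun l => HBinom K l 0 (k l)).prod →
    (f P : Hyp K ℓ) = F K N * (List.ofFn fun l => HBinom K l (δ l) (k l)).prod

/-- The fundamental weight `ω_i`. -/
def fundWeight (i : Fin ℓ) : Fin ℓ → ℤ := Pi.single i 1

/-- The right-normed commutator `⟦i_1, …, i_k⟧_i = [η_{α_{i_1}}, [… [η_{α_{i_k}}, θ_{ω_i}] …]]`,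
where `[x, y] = x y - y x`. -/
def bracket (i : Fin ℓ) : List (Fin ℓ) → Module.End K (uMinusZero K ℓ)
  | [] => theta K (fundWeight i)
  | l :: w => etaSimple K l * bracket i w - bracket i w * etaSimple K l

/-! ### Interleaved sequences -/

/-- `Shuffle u v w`: the sequence `w` is obtained by inserting `u` and `v` into one another, preserving
the order in either of them. -/
inductive Shuffle {T : Type*} : List T → List T → List T → Prop
  | nil : Shuffle [] [] []
  | left {u v w : List T} (x : T) : Shuffle u v w → Shuffle (x :: u) v (x :: w)
  | right {u v w : List T} (x : T) : Shuffle u v w → Shuffle u (x :: v) (x :: w)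

/-- Condition `𝒪(a, i, b)`, where `a ≤ i ≤ b`: the sequence is obtained by inserting the sequences
`a, a + 1, …, i - 1` and `b, b - 1, …, i + 1` into one another. -/
def SatisfiesO (a i b : ℕ) (w : List ℕ) : Prop :=
  Shuffle (List.range' a (i - a)) (List.range' (i + 1) (b - i)).reverse w

/-- The sequence `s_q, i, s_{q-1}, i, …, s_1, i`, for sequences `s_1, …, s_q`. -/
def word {q : ℕ} (i : Fin ℓ) (s : Fin q → List (Fin ℓ)) : List (Fin ℓ) :=
  (List.ofFn fun j : Fin q => s j.rev ++ [i]).flatten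

/-! ### Flows -/

section Flows

variable {V : Type*} [LinearOrder V] {q : ℕ}

/-- The directed graph with vertex set `V` and edge set `Γ` is a flow with sources `a_1, …, a_q` and
sinks `b_1, …, b_q`. -/
structure IsFlow (a b : Fin q → V) (Γ : Finset (V × V)) : Prop where
  lt : ∀ s t, (s, t) ∈ Γ → s < t
  source : ∀ j, (∃! t, (a j, t) ∈ Γ) ∧ ∀ s, (s, a j) ∉ Γ
  sink : ∀ j, (∃! s, (s, b j) ∈ Γ) ∧ ∀ t, (b j, t) ∉ Γ
  transit : ∀ r, (∀ j, r ≠ a j) → (∀ j, r ≠ b j) →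
    ((∀ s, (s, r) ∉ Γ) ∧ ∀ t, (r, t) ∉ Γ) ∨ ((∃! s, (s, r) ∈ Γ) ∧ ∃! t, (r, t) ∈ Γ)

/-- A transit point: neither a source nor a sink, with an edge ending and an edge beginning at it. -/
def IsTransit (a b : Fin q → V) (Γ : Finset (V × V)) (r : V) : Prop :=
  (∀ j, r ≠ a j) ∧ (∀ j, r ≠ b j) ∧ (∃ s, (s, r) ∈ Γ) ∧ ∃ t, (r, t) ∈ Γ

/-- `u` and `v` lie in the same connected component of the graph with edge set `Γ`. -/
def Linked (Γ : Finset (V × V)) (u v : V) : Prop :=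
  Relation.EqvGen (fun s t => (s, t) ∈ Γ) u v

/-- The linking permutation `σ` of a flow: `a_j` and `b_{σ(j)}` are linked for every `j`. -/
def linkPerm (a b : Fin q → V) (Γ : Finset (V × V)) : Equiv.Perm (Fin q) :=
  Classical.epsilon fun σ => ∀ j, Linked Γ (a j) (b (σ j))

end Flows

open Classical in
/-- `ℱ_i(a_1, …, a_q; b_1, …, b_q)`: the flows with sources `a_j ≤ i` and sinks `b_j > i` that have no
transit point greater than `i`. All edges of such a flow lie between its sources and sinks, so it is
enough to take the vertices from the index set of the rows and columns. -/
def flows {q : ℕ} (i : Fin ℓ) (a b : Fin q → Fin (ℓ + 1)) :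
    Finset (Finset (Fin (ℓ + 1) × Fin (ℓ + 1))) :=
  {Γ | IsFlow a b Γ ∧ (∀ j, a j ≤ i.castSucc) ∧ (∀ j, i.castSucc < b j) ∧
    ∀ r, IsTransit a b Γ r → r ≤ i.castSucc}

open Classical in
/-- The `i`-sign of a flow: the sign of the linking permutation times `(-1)` to the power
`∑ (b_j - i)` plus the number of transit points. -/
def sgn {q : ℕ} (i : Fin ℓ) (a b : Fin q → Fin (ℓ + 1))
    (Γ : Finset (Fin (ℓ + 1) × Fin (ℓ + 1))) : ℤ :=
  (Equiv.Perm.sign (linkPerm a b Γ) : ℤ) *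
    (-1) ^ ((∑ j, ((b j : ℕ) - (i : ℕ))) + ({r | IsTransit a b Γ r} : Finset (Fin (ℓ + 1))).card)

/-- A graph all of whose edges `(s, t)` have `s < t`, as a matrix of `UT(n)`: the entry in row `s` and
column `t` is the number of edges from `s` to `t`. -/
def toUT {n : ℕ} (Γ : Finset (Fin n × Fin n)) : UT n :=
  ⟨fun s t => if s < t ∧ (s, t) ∈ Γ then 1 else 0, fun _ _ h => if_neg fun h' => h'.1.not_ge h⟩

end Hyperalgebra

end

/-!
The operators `η_{α_l}` and `θ_{ω_i}` become transparent after transposition. The hyperalgebra acts on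
the integral polynomial functions of a generic `n × n` matrix by row operations, and a function `f`
gives the linear form `pairing K f` on `𝒰`: the value of `u f` at the identity matrix.

If `f` is invariant under the unipotent row operations `row t ↦ row t + u · row s`, `s < t`, this form
kills the left ideal generated by the positive root vectors (`pairing_posLeftIdeal`). If `f` is moreover
a weight vector of weight `μ`, then `pairing K f (x ∏ binom(H_{α_l} + r_l, k_l))` is the product of the
binomial coefficients `binom(μ_l + r_l, k_l)` and of `pairing K f x` (`pairing_mul_prod`). The value at
`F^{(N)}` is the coefficient of `u^N` in `f(1 + U)`, where `U` is the strictly upper triangular matrix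
of variables `u` (`pairing_F`). The products of minors of the first rows are invariant weight vectors,
and there are enough of them to separate the elements of `𝒰^{-,0}` (`exists_invariant`,
`uMinusZero_ext`); since the `F^{(M)} ∏ H_{α_l,k_l}` span `𝒰^{-,0}`, they form a basis.

The transpose of `θ_{ω_i}` is the multiplication by the principal minor formed by the rows and columns
up to `i` (`pairing_theta`), because this minor has weight `ω_i` and its value at `1 + U` is `1`. The
transpose of `η_{α_l}` is the derivation that replaces column `l` by column `l + 1`
(`pairing_etaSimple`). By the Leibniz rule the transpose of `⟦i_1, …, i_k⟧_i` is the multiplication by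
the function obtained from the principal minor by the negatives of these derivations
(`pairing_bracket`). For the word of the statement this function is, up to the sign
`(-1) ^ ∑ (b_j - i)`, the minor in which the columns `a_j` are replaced by the columns `b_j`
(`bracketFun_word`); in particular it depends only on `a`, `b` and `i`.

Finally, the nonzero terms of the Leibniz expansion of this minor at `1 + U` correspond to the flows:
the permutation that leads from rows to columns is read as a graph, and the entries `1` on the
diagonal are its omitted loops (`unipotent_minor_extend`). The sign of the permutation is the sign of
its first return map on the sources, which is the linking permutation, times one sign for every
transit point (`exists_firstReturn`, `sign_permGraph`).
-/

noncomputable section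

namespace Hyperalgebra

open scoped TensorProduct

/-! ### Shears of polynomial rings and divided powers of derivations -/

section Shear

variable {σ R : Type*} [CommRing R]

/-- The substitution `x_v ↦ x_v + u y_v`, where `u` is a new variable. If `x_v ↦ y_v` extends to a
derivation `D` that kills all `y_v`, this is `exp (u D)`. -/
def shear (y : σ → MvPolynomial σ R) : MvPolynomial σ R →ₐ[R] Polynomial (MvPolynomial σ R) :=
  MvPolynomial.aeval fun v => Polynomial.C (MvPolynomial.X v) + Polynomial.X * Polynomial.C (y v)

theorem shear_X (y : σ → MvPolynomial σ R) (v : σ) : shear y (MvPolynomial.X v) =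
    Polynomial.C (MvPolynomial.X v) + Polynomial.X * Polynomial.C (y v) := by
  simp [shear]

theorem coeff_zero_shear (y : σ → MvPolynomial σ R) (f : MvPolynomial σ R) :
    (shear y f).coeff 0 = f := by
  induction f using MvPolynomial.induction_on with
  | C a => simp [shear, ← MvPolynomial.algebraMap_eq, Polynomial.algebraMap_apply]
  | add p q hp hq => simp [hp, hq]
  | mul_X p v hp => rw [map_mul, Polynomial.mul_coeff_zero, hp, shear_X]; simp

theorem coeff_one_shear (y : σ → MvPolynomial σ R) (f : MvPolynomial σ R) :
    (shear y f).coeff 1 = MvPolynomial.mkDerivation R y f := by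
  induction f using MvPolynomial.induction_on with
  | C a => simp [shear, ← MvPolynomial.algebraMap_eq, Polynomial.algebraMap_apply]
  | add p q hp hq => simp [hp, hq]
  | mul_X p v hp =>
    rw [map_mul, Polynomial.mul_coeff_one, hp, shear_X, coeff_zero_shear]
    simp [MvPolynomial.mkDerivation_X, Polynomial.coeff_C]
    ring

theorem derivative_shear {y : σ → MvPolynomial σ R}
    (hy : ∀ v, shear y (y v) = Polynomial.C (y v)) (f : MvPolynomial σ R) :
    Polynomial.derivative (shear y f) = shear y (MvPolynomial.mkDerivation R y f) := by
  induction f using MvPolynomial.induction_on with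
  | C a => simp [shear, ← MvPolynomial.algebraMap_eq, Polynomial.algebraMap_apply]
  | add p q hp hq => simp [hp, hq]
  | mul_X p v hp =>
    rw [map_mul, Polynomial.derivative_mul, hp, shear_X]
    simp [MvPolynomial.mkDerivation_X, shear_X, hy]
    ring

/-- The coefficients of a shear are the divided powers of its derivation; they are defined over every ring. -/
theorem factorial_smul_coeff_shear {y : σ → MvPolynomial σ R}
    (hy : ∀ v, shear y (y v) = Polynomial.C (y v)) (m : ℕ) (f : MvPolynomial σ R) :
    m.factorial • (shear y f).coeff m = (MvPolynomial.mkDerivation R y)^[m] f := by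
  induction m generalizing f with
  | zero => simp [coeff_zero_shear]
  | succ m ih =>
    rw [Function.iterate_succ_apply, ← ih, ← derivative_shear hy, Polynomial.coeff_derivative,
      Nat.factorial_succ]
    simp only [nsmul_eq_mul]
    push_cast
    ring

theorem map_shear {S : Type*} [CommRing S] (φ : R →+* S) (y : σ → MvPolynomial σ R)
    (f : MvPolynomial σ R) (m : ℕ) : (shear (fun v => MvPolynomial.map φ (y v))
      (MvPolynomial.map φ f)).coeff m = MvPolynomial.map φ ((shear y f).coeff m) := by
  rw [← Polynomial.coeff_map]
  congr 1
  induction f using MvPolynomial.induction_on with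
  | C a => simp [shear, ← MvPolynomial.algebraMap_eq, Polynomial.algebraMap_apply]
  | add p q hp hq => simp [hp, hq]
  | mul_X p v hp => rw [map_mul, map_mul, hp, map_mul, MvPolynomial.map_X, shear_X, shear_X]; simp

end Shear

/-! ### The action on polynomial functions of an `n × n` matrix -/

/-- The polynomial functions of an `n × n` matrix, `n = ℓ + 1`. -/
abbrev MatPoly (ℓ : ℕ) (R : Type*) [CommRing R] := MvPolynomial (Fin (ℓ + 1) × Fin (ℓ + 1)) R

section Action

-- The commutator bracket of an associative algebra is not a global instance.
attribute [local instance] LieRing.ofAssociativeRing LieAlgebra.ofAssociativeAlgebra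

variable {ℓ : ℕ}

/-- The derivation of the ring of polynomial functions that is given by a matrix `M`: it takes the
generic matrix `x` to `Mᵀ x`. -/
def rowDer (M : Matrix (Fin (ℓ + 1)) (Fin (ℓ + 1)) ℂ) : Derivation ℂ (MatPoly ℓ ℂ) (MatPoly ℓ ℂ) :=
  MvPolynomial.mkDerivation ℂ fun v => ∑ s, M s v.1 • MvPolynomial.X (s, v.2)

theorem rowDer_X (M : Matrix (Fin (ℓ + 1)) (Fin (ℓ + 1)) ℂ) (v : Fin (ℓ + 1) × Fin (ℓ + 1)) :
    rowDer M (MvPolynomial.X v) = ∑ s, M s v.1 • MvPolynomial.X (s, v.2) :=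
  MvPolynomial.mkDerivation_X _ _ _

theorem rowDer_lie (M N : Matrix (Fin (ℓ + 1)) (Fin (ℓ + 1)) ℂ) :
    rowDer ⁅M, N⁆ = ⁅rowDer M, rowDer N⁆ := by
  apply MvPolynomial.derivation_ext
  intro v
  rw [Derivation.commutator_apply]
  simp only [rowDer_X, map_sum, Ring.lie_def,
    Matrix.sub_apply, Matrix.mul_apply, sub_smul, Finset.sum_sub_distrib, Finset.sum_smul]
  simp only [Derivation.map_smul, rowDer_X, Finset.smul_sum, smul_smul]
  congr 1 <;>
  · rw [Finset.sum_comm]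
    simp only [mul_comm]

/-- The representation of `𝔰𝔩_n(ℂ)` on polynomial functions. -/
def rowRep (ℓ : ℕ) : LieSL ℓ →ₗ⁅ℂ⁆ Module.End ℂ (MatPoly ℓ ℂ) where
  toFun M := (rowDer M.1 : Module.End ℂ (MatPoly ℓ ℂ))
  map_add' M N := by
    have : rowDer (M + N).1 = rowDer M.1 + rowDer N.1 := by
      apply MvPolynomial.derivation_ext
      intro v
      simp [rowDer_X, add_smul, Finset.sum_add_distrib]
    rw [this]; rfl
  map_smul' c M := by
    have : rowDer (c • M).1 = c • rowDer M.1 := by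
      apply MvPolynomial.derivation_ext
      intro v
      simp [rowDer_X, Finset.smul_sum, smul_smul]
    rw [this]; rfl
  map_lie' {M N} := by
    rw [LieSubalgebra.coe_bracket, rowDer_lie, Derivation.commutator_coe_linear_map]

/-- The representation of the universal enveloping algebra on polynomial functions. -/
def envRep (ℓ : ℕ) : EnvSL ℓ →ₐ[ℂ] Module.End ℂ (MatPoly ℓ ℂ) :=
  UniversalEnvelopingAlgebra.lift ℂ (rowRep ℓ)

/-- The image of the generic matrix under `E_{s,t}`: row `t` is replaced by row `s`, and all other
rows by zero. -/
def rowMove (R : Type*) [CommRing R] (s t : Fin (ℓ + 1)) (v : Fin (ℓ + 1) × Fin (ℓ + 1)) :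
    MatPoly ℓ R :=
  if v.1 = t then MvPolynomial.X (s, v.2) else 0

theorem envRep_rootVec (s t : Fin (ℓ + 1)) (h : s ≠ t) :
    envRep ℓ (rootVec s t h) = (MvPolynomial.mkDerivation ℂ (rowMove ℂ s t)).toLinearMap := by
  have h1 : envRep ℓ (rootVec s t h) =
      (rowDer (LieAlgebra.SpecialLinear.single s t h (1 : ℂ)).1).toLinearMap := by
    rw [envRep, rootVec, UniversalEnvelopingAlgebra.lift_ι_apply]; rfl
  have h2 : rowDer (LieAlgebra.SpecialLinear.single s t h (1 : ℂ)).1 =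
      MvPolynomial.mkDerivation ℂ (rowMove ℂ s t) := ?_
  · rw [h1, h2]
  apply MvPolynomial.derivation_ext
  intro v
  rw [rowDer_X, MvPolynomial.mkDerivation_X, rowMove]
  simp [Matrix.single_apply, eq_comm, ite_and]

theorem envRep_coroot (l : Fin ℓ) (f : MatPoly ℓ ℂ) :
    envRep ℓ (coroot l) f = MvPolynomial.mkDerivation ℂ (fun v : Fin (ℓ + 1) × Fin (ℓ + 1) =>
      (if v.1 = l.castSucc then MvPolynomial.X v else 0) -
      (if v.1 = l.succ then MvPolynomial.X v else 0)) f := by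
  have h1 : envRep ℓ (coroot l) =
      (rowDer (LieAlgebra.SpecialLinear.singleSubSingle l.castSucc l.succ (1 : ℂ)).1).toLinearMap := by
    rw [envRep, coroot, UniversalEnvelopingAlgebra.lift_ι_apply]; rfl
  have h2 : rowDer (LieAlgebra.SpecialLinear.singleSubSingle l.castSucc l.succ (1 : ℂ)).1 =
      MvPolynomial.mkDerivation ℂ (fun v : Fin (ℓ + 1) × Fin (ℓ + 1) =>
      (if v.1 = l.castSucc then MvPolynomial.X v else 0) -
      (if v.1 = l.succ then MvPolynomial.X v else 0)) := ?_
  · rw [h1, h2]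
    rfl
  apply MvPolynomial.derivation_ext
  rintro ⟨r, j⟩
  rw [rowDer_X, MvPolynomial.mkDerivation_X]
  simp [Matrix.single_apply, sub_smul, Finset.sum_sub_distrib, ite_and]
  congr 1 <;>
  · split_ifs with h1 h2 h2
    · rw [h1]
    · exact absurd h1.symm h2
    · exact absurd h2.symm h1
    · rfl

theorem shear_rowMove {R : Type*} [CommRing R] {s t : Fin (ℓ + 1)} (h : s ≠ t)
    (v : Fin (ℓ + 1) × Fin (ℓ + 1)) :
    shear (rowMove R s t) (rowMove R s t v) = Polynomial.C (rowMove R s t v) := by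
  rw [rowMove]
  split_ifs
  · rw [shear_X, rowMove, if_neg h]; simp
  · simp

theorem envRep_divPow (s t : Fin (ℓ + 1)) (h : s ≠ t) (m : ℕ) (f : MatPoly ℓ ℂ) :
    envRep ℓ (divPow (rootVec s t h) m) f = (shear (rowMove ℂ s t) f).coeff m := by
  have hm : (m.factorial : ℂ) ≠ 0 := by exact_mod_cast m.factorial_ne_zero
  rw [divPow, map_smul, map_pow, envRep_rootVec, LinearMap.smul_apply, Module.End.pow_apply]
  rw [inv_smul_eq_iff₀ hm, Nat.cast_smul_eq_nsmul,
    factorial_smul_coeff_shear (shear_rowMove h)]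
  rfl

/-- Complexification of integral polynomial functions. -/
abbrev complexify (ℓ : ℕ) : MatPoly ℓ ℤ →+* MatPoly ℓ ℂ := MvPolynomial.map (Int.castRingHom ℂ)

theorem complexify_injective (ℓ : ℕ) : Function.Injective (complexify ℓ) :=
  MvPolynomial.map_injective _ Int.cast_injective

theorem envRep_divPow_complexify (s t : Fin (ℓ + 1)) (h : s ≠ t) (m : ℕ) (f : MatPoly ℓ ℤ) :
    envRep ℓ (divPow (rootVec s t h) m) (complexify ℓ f) =
      complexify ℓ ((shear (rowMove ℤ s t) f).coeff m) := by
  rw [envRep_divPow, ← map_shear]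
  congr 3
  funext v
  simp only [rowMove]
  split_ifs <;> simp

/-- The integral form preserves the integral polynomial functions, because the divided powers of root
vectors act by the coefficients of shears. -/
theorem exists_integral_action (u : EnvSL ℓ) (hu : u ∈ kostantForm ℓ) :
    ∀ f : MatPoly ℓ ℤ, ∃ g, complexify ℓ g = envRep ℓ u (complexify ℓ f) := by
  induction hu using Subring.closure_induction with
  | mem x hx =>
    obtain ⟨s, t, h, m, rfl⟩ := hx
    exact fun f => ⟨_, (envRep_divPow_complexify s t h m f).symm⟩
  | zero => exact fun f => ⟨0, by simp⟩
  | one => exact fun f => ⟨f, by simp⟩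
  | add x y _ _ hx hy =>
    intro f
    obtain ⟨g, hg⟩ := hx f
    obtain ⟨g', hg'⟩ := hy f
    exact ⟨g + g', by simp [hg, hg']⟩
  | neg x _ hx =>
    intro f
    obtain ⟨g, hg⟩ := hx f
    exact ⟨-g, by simp [hg]⟩
  | mul x y _ _ hx hy =>
    intro f
    obtain ⟨g, hg⟩ := hy f
    obtain ⟨g', hg'⟩ := hx g
    exact ⟨g', by simp [hg, hg']⟩

/-- The action of the integral form on integral polynomial functions. -/
def act (u : kostantForm ℓ) (f : MatPoly ℓ ℤ) : MatPoly ℓ ℤ :=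
  (exists_integral_action u.1 u.2 f).choose

theorem complexify_act (u : kostantForm ℓ) (f : MatPoly ℓ ℤ) :
    complexify ℓ (act u f) = envRep ℓ u (complexify ℓ f) :=
  (exists_integral_action u.1 u.2 f).choose_spec

theorem act_add_left (u v : kostantForm ℓ) (f : MatPoly ℓ ℤ) :
    act (u + v) f = act u f + act v f :=
  complexify_injective ℓ (by simp [complexify_act])

theorem act_add_right (u : kostantForm ℓ) (f g : MatPoly ℓ ℤ) :
    act u (f + g) = act u f + act u g :=
  complexify_injective ℓ (by simp [complexify_act])

theorem act_mul (u v : kostantForm ℓ) (f : MatPoly ℓ ℤ) :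
    act (u * v) f = act u (act v f) :=
  complexify_injective ℓ (by simp [complexify_act])

theorem act_one (f : MatPoly ℓ ℤ) : act 1 f = f :=
  complexify_injective ℓ (by simp [complexify_act])

theorem act_zero_right (u : kostantForm ℓ) : act u 0 = 0 :=
  complexify_injective ℓ (by simp [complexify_act])

theorem act_smul_right (u : kostantForm ℓ) (z : ℤ) (f : MatPoly ℓ ℤ) :
    act u (z • f) = z • act u f :=
  complexify_injective ℓ (by
    rw [complexify_act, map_zsmul, map_zsmul, map_zsmul, complexify_act])

theorem act_divPow (s t : Fin (ℓ + 1)) (h : s ≠ t) (m : ℕ) (f : MatPoly ℓ ℤ) :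
    act ⟨divPow (rootVec s t h) m, divPow_mem s t h m⟩ f = (shear (rowMove ℤ s t) f).coeff m :=
  complexify_injective ℓ (by rw [complexify_act, envRep_divPow_complexify])

/-- The value of a polynomial function at the identity matrix. -/
def evalOne (ℓ : ℕ) : MatPoly ℓ ℤ →+* ℤ :=
  MvPolynomial.eval fun v => if v.1 = v.2 then 1 else 0

/-- The pairing of the hyperalgebra with integral polynomial functions: `u` and `f` are taken to the
value of `u f` at the identity matrix. -/
def pairing (K : Type*) [Field K] (f : MatPoly ℓ ℤ) : Hyp K ℓ →ₗ[K] K :=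
  (TensorProduct.AlgebraTensorModule.rid ℤ K K).toLinearMap ∘ₗ
    LinearMap.baseChange K
      (AddMonoidHom.toIntLinearMap (AddMonoidHom.mk' (fun u => evalOne ℓ (act u f)) fun u v => by
        rw [act_add_left, map_add]) : kostantForm ℓ →ₗ[ℤ] ℤ)

theorem pairing_tmul (K : Type*) [Field K] (f : MatPoly ℓ ℤ) (c : K) (u : kostantForm ℓ) :
    pairing K f (c ⊗ₜ u) = c * (evalOne ℓ (act u f) : ℤ) := by
  simp [pairing, mul_comm]

end Action

/-! ### Invariants, weights and the column derivations -/

section Invariants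

variable {ℓ : ℕ}

/-- The invariants of the group generated by all positive root subgroups. -/
def IsInv (f : MatPoly ℓ ℤ) : Prop :=
  ∀ s t : Fin (ℓ + 1), s < t → shear (rowMove ℤ s t) f = Polynomial.C f

theorem IsInv.one : IsInv (1 : MatPoly ℓ ℤ) := fun s t _ => by simp

theorem IsInv.mul {f g : MatPoly ℓ ℤ} (hf : IsInv f) (hg : IsInv g) : IsInv (f * g) :=
  fun s t h => by rw [map_mul, hf s t h, hg s t h, Polynomial.C_mul]

theorem IsInv.smul {f : MatPoly ℓ ℤ} (z : ℤ) (hf : IsInv f) : IsInv (z • f) :=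
  fun s t h => by rw [map_zsmul, hf s t h, map_zsmul]

/-- The element `H_{α_l}` of the integral form. -/
def corootInt (l : Fin ℓ) : kostantForm ℓ :=
  ⟨coroot l, by simpa [binom] using binom_coroot_mem l 0 1⟩

/-- The integral polynomial function `f` has weight `μ`, given by the integers `μ(H_{α_l})`. -/
def IsWeight (μ : Fin ℓ → ℤ) (f : MatPoly ℓ ℤ) : Prop := ∀ l, act (corootInt l) f = μ l • f

theorem act_corootInt_mul (l : Fin ℓ) (f g : MatPoly ℓ ℤ) :
    act (corootInt l) (f * g) = f * act (corootInt l) g + g * act (corootInt l) f :=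
  complexify_injective ℓ (by
    simp only [complexify_act, corootInt, envRep_coroot, map_mul, map_add, Derivation.leibniz,
      smul_eq_mul])

theorem IsWeight.one : IsWeight 0 (1 : MatPoly ℓ ℤ) := fun l =>
  complexify_injective ℓ (by simp [complexify_act, corootInt, envRep_coroot])

theorem IsWeight.mul {f g : MatPoly ℓ ℤ} {μ ν : Fin ℓ → ℤ} (hf : IsWeight μ f)
    (hg : IsWeight ν g) : IsWeight (μ + ν) (f * g) := fun l => by
  rw [act_corootInt_mul, hf l, hg l, Pi.add_apply, add_smul, mul_smul_comm, mul_smul_comm,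
    add_comm, mul_comm]

theorem IsWeight.smul {f : MatPoly ℓ ℤ} {μ : Fin ℓ → ℤ} (z : ℤ) (hf : IsWeight μ f) :
    IsWeight μ (z • f) := fun l => by rw [act_smul_right, hf l, smul_comm]

theorem IsWeight.add {f g : MatPoly ℓ ℤ} {μ : Fin ℓ → ℤ} (hf : IsWeight μ f)
    (hg : IsWeight μ g) : IsWeight μ (f + g) := fun l => by
  rw [act_add_right, hf l, hg l, smul_add]

theorem IsWeight.sum {ι : Type*} (s : Finset ι) {f : ι → MatPoly ℓ ℤ} {μ : Fin ℓ → ℤ}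
    (hf : ∀ i ∈ s, IsWeight μ (f i)) : IsWeight μ (∑ i ∈ s, f i) := by
  classical
  induction s using Finset.induction_on with
  | empty => exact fun l => by simp [act_zero_right]
  | insert i s hi ih =>
    rw [Finset.sum_insert hi]
    exact (hf _ (Finset.mem_insert_self _ _)).add
      (ih fun j hj => hf j (Finset.mem_insert_of_mem hj))

theorem IsWeight.prod {ι : Type*} (s : Finset ι) {f : ι → MatPoly ℓ ℤ} {μ : ι → Fin ℓ → ℤ}
    (hf : ∀ i ∈ s, IsWeight (μ i) (f i)) : IsWeight (∑ i ∈ s, μ i) (∏ i ∈ s, f i) := by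
  classical
  induction s using Finset.induction_on with
  | empty => simpa using IsWeight.one
  | insert i s hi ih =>
    rw [Finset.prod_insert hi, Finset.sum_insert hi]
    exact (hf _ (Finset.mem_insert_self _ _)).mul
      (ih fun j hj => hf j (Finset.mem_insert_of_mem hj))

theorem IsInv.prod {ι : Type*} (s : Finset ι) {f : ι → MatPoly ℓ ℤ}
    (hf : ∀ i ∈ s, IsInv (f i)) : IsInv (∏ i ∈ s, f i) :=
  Finset.prod_induction _ IsInv (fun _ _ => IsInv.mul) IsInv.one hf

theorem IsWeight.pow {f : MatPoly ℓ ℤ} {μ : Fin ℓ → ℤ} (hf : IsWeight μ f) (m : ℕ) :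
    IsWeight (m • μ) (f ^ m) := by
  simpa using IsWeight.prod (Finset.range m) (f := fun _ => f) (μ := fun _ => μ) fun _ _ => hf

theorem IsInv.pow {f : MatPoly ℓ ℤ} (hf : IsInv f) (m : ℕ) : IsInv (f ^ m) := by
  simpa using IsInv.prod (Finset.range m) (f := fun _ => f) fun _ _ => hf

/-- The weight of the entries of row `r`. -/
def rowWeight (r : Fin (ℓ + 1)) (l : Fin ℓ) : ℤ :=
  (if r = l.castSucc then 1 else 0) - (if r = l.succ then 1 else 0)

theorem IsWeight.X (r j : Fin (ℓ + 1)) : IsWeight (rowWeight r) (MvPolynomial.X (r, j)) :=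
  fun l => complexify_injective ℓ (by
    rw [complexify_act, corootInt, envRep_coroot, MvPolynomial.map_X, MvPolynomial.mkDerivation_X,
      rowWeight, map_zsmul, MvPolynomial.map_X, sub_smul]
    congr 1 <;> split_ifs <;> simp)

theorem act_binom {μ : Fin ℓ → ℤ} {f : MatPoly ℓ ℤ} (hf : IsWeight μ f) (l : Fin ℓ) (r : ℤ)
    (m : ℕ) : act ⟨binom (coroot l + (r : EnvSL ℓ)) m, binom_coroot_mem l r m⟩ f =
      Ring.choose (μ l + r) m • f := by
  apply complexify_injective ℓ
  have h0 : envRep ℓ (coroot l + (r : EnvSL ℓ)) (complexify ℓ f) =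
      ((μ l + r : ℤ) : ℂ) • complexify ℓ f := by
    have h1 := congrArg (complexify ℓ) (hf l)
    rw [complexify_act, corootInt, map_zsmul, ← Int.cast_smul_eq_zsmul ℂ] at h1
    rw [map_add, LinearMap.add_apply, h1, map_intCast, Int.cast_add, add_smul]
    congr 1
    rw [Module.End.intCast_apply, Int.cast_smul_eq_zsmul]
  have hm : (m.factorial : ℂ) ≠ 0 := by exact_mod_cast m.factorial_ne_zero
  have h2 : Polynomial.aeval (envRep ℓ (coroot l + (r : EnvSL ℓ))) (descPochhammer ℂ m)
      (complexify ℓ f) = (descPochhammer ℂ m).eval ((μ l + r : ℤ) : ℂ) • complexify ℓ f := by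
    by_cases h3 : complexify ℓ f = 0
    · simp [h3]
    · exact Module.End.aeval_apply_of_hasEigenvector
        ⟨Module.End.mem_eigenspace_iff.2 h0, h3⟩
  have h4 : (descPochhammer ℂ m).eval ((μ l + r : ℤ) : ℂ) =
      (m.factorial : ℂ) * (Ring.choose (μ l + r) m : ℤ) := by
    have h5 := Ring.descPochhammer_eq_factorial_smul_choose (μ l + r) m
    rw [← Polynomial.aeval_eq_smeval, Polynomial.coe_aeval_eq_eval] at h5
    rw [← descPochhammer_map (Int.castRingHom ℂ), Polynomial.eval_intCast_map, Int.cast_id, h5]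
    simp
  rw [complexify_act]
  change envRep ℓ (binom _ _) _ = _
  rw [binom, map_smul, ← Polynomial.aeval_algHom_apply, LinearMap.smul_apply, h2,
    h4, smul_smul, inv_mul_cancel_left₀ hm, map_zsmul, Int.cast_smul_eq_zsmul]

/-- The derivation that replaces column `l` of the generic matrix by column `l + 1`, and all other
columns by zero. -/
def colDer (l : Fin ℓ) : Derivation ℤ (MatPoly ℓ ℤ) (MatPoly ℓ ℤ) :=
  MvPolynomial.mkDerivation ℤ fun v =>
    if v.2 = l.castSucc then MvPolynomial.X (v.1, l.succ) else 0

theorem colDer_X (l : Fin ℓ) (v : Fin (ℓ + 1) × Fin (ℓ + 1)) : colDer l (MvPolynomial.X v) =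
    if v.2 = l.castSucc then MvPolynomial.X (v.1, l.succ) else 0 :=
  MvPolynomial.mkDerivation_X _ _ _

theorem coeff_shear_colDer {s t : Fin (ℓ + 1)} (l : Fin ℓ) (f : MatPoly ℓ ℤ) (m : ℕ) :
    (shear (rowMove ℤ s t) (colDer l f)).coeff m =
      colDer l ((shear (rowMove ℤ s t) f).coeff m) := by
  have hmul : ∀ (p : MatPoly ℓ ℤ) (v : Fin (ℓ + 1) × Fin (ℓ + 1)) (m : ℕ),
      (shear (rowMove ℤ s t) (p * MvPolynomial.X v)).coeff m =
        (shear (rowMove ℤ s t) p).coeff m * MvPolynomial.X v +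
          (if m = 0 then 0 else (shear (rowMove ℤ s t) p).coeff (m - 1)) * rowMove ℤ s t v := by
    intro p v m
    rw [map_mul, shear_X, mul_add, Polynomial.coeff_add, Polynomial.coeff_mul_C, ← mul_assoc,
      Polynomial.coeff_mul_C]
    cases m <;> simp
  induction f using MvPolynomial.induction_on generalizing m with
  | C a =>
    have hC : shear (rowMove ℤ s t) (MvPolynomial.C a) = Polynomial.C (MvPolynomial.C a) := by
      simp [shear, ← MvPolynomial.algebraMap_eq]
    rw [hC, Polynomial.coeff_C]
    split_ifs <;> simp
  | add p q hp hq => simp [hp, hq]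
  | mul_X p v hp =>
    rw [hmul p, map_add, Derivation.leibniz, Derivation.leibniz, Derivation.leibniz, map_add,
      smul_eq_mul, smul_eq_mul, mul_comm _ (colDer l p), Polynomial.coeff_add, hmul]
    simp only [smul_eq_mul]
    by_cases h1 : v.2 = l.castSucc <;> by_cases h2 : v.1 = t <;> cases m <;>
      simp [h1, h2, hp, hmul, rowMove, colDer_X, -map_mul] <;> ring

/-- Row operations commute with column operations. -/
theorem act_colDer (u : kostantForm ℓ) (l : Fin ℓ) (f : MatPoly ℓ ℤ) :
    act u (colDer l f) = colDer l (act u f) := by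
  obtain ⟨u, hu⟩ := u
  have key : ∀ (x y : kostantForm ℓ), (∀ f, act x (colDer l f) = colDer l (act x f)) →
      (∀ f, act y (colDer l f) = colDer l (act y f)) →
      (∀ f, act (x * y) (colDer l f) = colDer l (act (x * y) f)) ∧
      (∀ f, act (x + y) (colDer l f) = colDer l (act (x + y) f)) := fun x y hx hy =>
    ⟨fun f => by rw [act_mul, hy, hx, act_mul],
      fun f => by rw [act_add_left, act_add_left, hx, hy, map_add]⟩
  have h0 : ∀ f : MatPoly ℓ ℤ, act 0 f = 0 := fun f =>
    complexify_injective ℓ (by simp [complexify_act])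
  induction hu using Subring.closure_induction generalizing f with
  | mem x hx =>
    obtain ⟨s, t, h, m, rfl⟩ := hx
    rw [act_divPow s t h m, act_divPow s t h m, coeff_shear_colDer]
  | zero =>
    change act (0 : kostantForm ℓ) _ = colDer l (act (0 : kostantForm ℓ) f)
    rw [h0, h0, map_zero]
  | one =>
    change act (1 : kostantForm ℓ) _ = colDer l (act (1 : kostantForm ℓ) f)
    rw [act_one, act_one]
  | add x y hx' hy' hx hy => exact (key ⟨x, hx'⟩ ⟨y, hy'⟩ hx hy).2 f
  | neg x hx' hx =>
    have hneg : ∀ f : MatPoly ℓ ℤ, act (-⟨x, hx'⟩) f = -act ⟨x, hx'⟩ f := fun f =>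
      complexify_injective ℓ (by simp [complexify_act])
    change act (-⟨x, hx'⟩ : kostantForm ℓ) _ = colDer l (act (-⟨x, hx'⟩ : kostantForm ℓ) f)
    rw [hneg, hneg, hx, map_neg]
  | mul x y hx' hy' hx hy => exact (key ⟨x, hx'⟩ ⟨y, hy'⟩ hx hy).1 f

theorem IsInv.colDer {f : MatPoly ℓ ℤ} (hf : IsInv f) (l : Fin ℓ) : IsInv (colDer l f) :=
  fun s t h => by
    apply Polynomial.ext
    intro m
    rw [coeff_shear_colDer, hf s t h]
    simp only [Polynomial.coeff_C]
    split_ifs <;> simp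

theorem IsWeight.colDer {f : MatPoly ℓ ℤ} {μ : Fin ℓ → ℤ} (hf : IsWeight μ f) (l : Fin ℓ) :
    IsWeight μ (colDer l f) := fun k => by
  rw [act_colDer, hf k, map_zsmul]

theorem evalOne_colDer (l : Fin ℓ) (f : MatPoly ℓ ℤ) :
    evalOne ℓ (colDer l f) =
      evalOne ℓ (MvPolynomial.mkDerivation ℤ (rowMove ℤ l.castSucc l.succ) f) := by
  induction f using MvPolynomial.induction_on with
  | C a => simp
  | add p q hp hq => simp [hp, hq]
  | mul_X p v hp =>
    rw [Derivation.leibniz, Derivation.leibniz, map_add, map_add, smul_eq_mul, smul_eq_mul,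
      smul_eq_mul, smul_eq_mul, map_mul, map_mul, map_mul, map_mul, hp, colDer_X,
      MvPolynomial.mkDerivation_X, rowMove]
    congr 2
    obtain ⟨r, j⟩ := v
    simp only [evalOne]
    by_cases h1 : j = l.castSucc <;> by_cases h2 : r = l.succ <;> simp [h1, h2, eq_comm]

end Invariants

section Pairing

variable (K : Type*) [Field K] {ℓ : ℕ}

theorem pairing_add (f g : MatPoly ℓ ℤ) (x : Hyp K ℓ) :
    pairing K (f + g) x = pairing K f x + pairing K g x := by
  induction x using TensorProduct.induction_on with
  | zero => simp
  | tmul c u => simp only [pairing_tmul, act_add_right, map_add, Int.cast_add, mul_add]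
  | add x y hx hy => rw [map_add, map_add, map_add, hx, hy]; ring

theorem pairing_smul (z : ℤ) (f : MatPoly ℓ ℤ) (x : Hyp K ℓ) :
    pairing K (z • f) x = z * pairing K f x := by
  induction x using TensorProduct.induction_on with
  | zero => simp
  | tmul c u => rw [pairing_tmul, pairing_tmul, act_smul_right, map_zsmul]; simp; ring
  | add x y hx hy => rw [map_add, map_add, hx, hy]; ring

theorem pairing_mul_HBinom {μ : Fin ℓ → ℤ} {f : MatPoly ℓ ℤ} (hf : IsWeight μ f) (l : Fin ℓ)
    (r : ℤ) (m : ℕ) (x : Hyp K ℓ) : pairing K f (x * HBinom K l r m) =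
      (Ring.choose (μ l + r) m : ℤ) * pairing K f x := by
  induction x using TensorProduct.induction_on with
  | zero => simp
  | tmul c u =>
    rw [HBinom, Algebra.TensorProduct.tmul_mul_tmul, pairing_tmul, pairing_tmul, act_mul,
      act_binom hf, act_smul_right, map_zsmul]
    simp; ring
  | add x y hx hy => rw [add_mul, map_add, map_add, hx, hy]; ring

/-- The elements of `𝒰⁰` act on weight functions by scalars. -/
theorem pairing_mul_prod {μ : Fin ℓ → ℤ} {f : MatPoly ℓ ℤ} (hf : IsWeight μ f) (r : Fin ℓ → ℤ)
    (k : Fin ℓ → ℕ) (x : Hyp K ℓ) :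
    pairing K f (x * (List.ofFn fun l => HBinom K l (r l) (k l)).prod) =
      ((∏ l, Ring.choose (μ l + r l) (k l) : ℤ) : K) * pairing K f x := by
  have key : ∀ (L : List (Fin ℓ)) (x : Hyp K ℓ),
      pairing K f (x * (L.map fun l => HBinom K l (r l) (k l)).prod) =
        (((L.map fun l => Ring.choose (μ l + r l) (k l)).prod : ℤ) : K) * pairing K f x := by
    intro L
    induction L with
    | nil => simp
    | cons l L ih =>
      intro x
      rw [List.map_cons, List.prod_cons, ← mul_assoc, ih, pairing_mul_HBinom K hf, List.map_cons,
        List.prod_cons]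
      push_cast
      ring
  have h := key (List.finRange ℓ) x
  rwa [← List.ofFn_eq_map, ← List.ofFn_eq_map, List.prod_ofFn] at h

/-- At the identity matrix, adding a multiple of row `l` to row `l + 1` is the same as adding this
multiple of column `l + 1` to column `l`. -/
theorem pairing_X_mul (l : Fin ℓ) (f : MatPoly ℓ ℤ) (x : Hyp K ℓ) :
    pairing K f (X K l.castSucc l.succ l.castSucc_lt_succ.ne 1 * x) =
      pairing K (colDer l f) x := by
  induction x using TensorProduct.induction_on with
  | zero => simp
  | tmul c u =>
    rw [X, Algebra.TensorProduct.tmul_mul_tmul, pairing_tmul, pairing_tmul, act_mul, act_colDer,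
      act_divPow _ _ l.castSucc_lt_succ.ne, coeff_one_shear, evalOne_colDer, one_mul]
  | add x y hx hy => rw [mul_add, map_add, map_add, hx, hy]

theorem pairing_posLeftIdeal {f : MatPoly ℓ ℤ} (hf : IsInv f) {x : Hyp K ℓ}
    (hx : x ∈ posLeftIdeal K ℓ) : pairing K f x = 0 := by
  suffices h : ∀ y, pairing K f (y * x) = 0 by simpa using h 1
  rw [posLeftIdeal] at hx
  induction hx using Submodule.span_induction with
  | mem x hx =>
    obtain ⟨s, t, h, k, hk, rfl⟩ := hx
    intro y
    induction y using TensorProduct.induction_on with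
    | zero => simp
    | tmul c u =>
      rw [X, Algebra.TensorProduct.tmul_mul_tmul, pairing_tmul, act_mul, act_divPow s t h.ne,
        hf s t h, Polynomial.coeff_C_of_ne_zero hk.ne', act_zero_right]
      simp
    | add y z hy hz => rw [add_mul, map_add, hy, hz, add_zero]
  | zero => simp
  | add x z _ _ hx hz => intro y; rw [mul_add, map_add, hx, hz, add_zero]
  | smul a x _ hx => intro y; rw [smul_eq_mul, ← mul_assoc, hx]

end Pairing

/-! ### The pairing of `F^{(N)}` with a polynomial function -/

section Generating

variable {ℓ : ℕ}

/-- The factor of `F^{(N)}` that belongs to the pair `p`, as an element of the integral form. -/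
def factor (N : Fin (ℓ + 1) × Fin (ℓ + 1) →₀ ℕ) (p : Fin (ℓ + 1) × Fin (ℓ + 1)) : kostantForm ℓ :=
  if h : p.1 < p.2 then ⟨divPow (rootVec p.2 p.1 h.ne') (N p), divPow_mem _ _ _ _⟩ else 1

/-- The generating function of the action of all `E_{b,a}^{(m)}`, where `p = (a, b)` and `a < b`. -/
def genAct (p : Fin (ℓ + 1) × Fin (ℓ + 1)) :
    MatPoly ℓ ℤ →+* MvPolynomial (Fin (ℓ + 1) × Fin (ℓ + 1)) (MatPoly ℓ ℤ) :=
  if p.1 < p.2 then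
    (Polynomial.eval₂RingHom MvPolynomial.C (MvPolynomial.X p)).comp
      (shear (rowMove ℤ p.2 p.1) : MatPoly ℓ ℤ →+* Polynomial (MatPoly ℓ ℤ))
  else MvPolynomial.C

theorem genAct_X (p : Fin (ℓ + 1) × Fin (ℓ + 1)) (r j : Fin (ℓ + 1)) :
    genAct p (MvPolynomial.X (r, j)) = MvPolynomial.C (MvPolynomial.X (r, j)) +
      if p.1 = r ∧ p.1 < p.2 then MvPolynomial.X p * MvPolynomial.C (MvPolynomial.X (p.2, j))
      else 0 := by
  rw [genAct]
  by_cases h : p.1 < p.2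
  · by_cases h' : p.1 = r
    · subst h'
      simp [h, shear_X, rowMove]
      exact mul_comm _ _
    · simp [h, h', Ne.symm h', shear_X, rowMove]
  · simp [h]

theorem coeff_genAct (p : Fin (ℓ + 1) × Fin (ℓ + 1)) (M : Fin (ℓ + 1) × Fin (ℓ + 1) →₀ ℕ)
    (f : MatPoly ℓ ℤ) : (genAct p f).coeff M =
      if M = Finsupp.single p (M p) ∧ (M p ≠ 0 → p.1 < p.2) then act (factor M p) f else 0 := by
  rw [genAct, factor]
  by_cases h : p.1 < p.2
  · simp only [h, if_true, dif_pos, act_divPow _ _ h.ne', implies_true, and_true]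
    have key : ∀ q : Polynomial (MatPoly ℓ ℤ),
        (Polynomial.eval₂RingHom MvPolynomial.C (MvPolynomial.X p) q).coeff M =
          if M = Finsupp.single p (M p) then q.coeff (M p) else 0 := by
      intro q
      induction q using Polynomial.induction_on' with
      | add q q' hq hq' => rw [map_add, MvPolynomial.coeff_add, hq, hq']; split_ifs <;> simp
      | monomial m a =>
        rw [Polynomial.coe_eval₂RingHom, Polynomial.eval₂_monomial, MvPolynomial.coeff_C_mul,
          MvPolynomial.coeff_X_pow, Polynomial.coeff_monomial]
        by_cases h1 : Finsupp.single p m = M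
        · subst h1; simp
        · by_cases h2 : M = Finsupp.single p (M p)
          · have h3 : m ≠ M p := fun h3 => h1 (h3 ▸ h2.symm)
            simp [h1, h3]
          · simp [h1, h2]
    exact key _
  · simp only [h, if_false, dif_neg, not_false_eq_true, act_one, MvPolynomial.coeff_C]
    congr 1
    apply propext
    constructor
    · rintro rfl; simp
    · rintro ⟨h1, h2⟩
      rw [h1, not_not.1 h2, Finsupp.single_zero]

/-- The generating function of the action of the products of the factors that belong to the pairs of
a list. -/
def genList : List (Fin (ℓ + 1) × Fin (ℓ + 1)) →
    (MatPoly ℓ ℤ →+* MvPolynomial (Fin (ℓ + 1) × Fin (ℓ + 1)) (MatPoly ℓ ℤ))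
  | [] => MvPolynomial.C
  | p :: L => (MvPolynomial.eval₂Hom (genAct p) MvPolynomial.X).comp (genList L)

theorem coeff_eval₂_genAct (p : Fin (ℓ + 1) × Fin (ℓ + 1))
    (φ : MvPolynomial (Fin (ℓ + 1) × Fin (ℓ + 1)) (MatPoly ℓ ℤ))
    (hφ : ∀ M, M p ≠ 0 → φ.coeff M = 0) (N : Fin (ℓ + 1) × Fin (ℓ + 1) →₀ ℕ) :
    (MvPolynomial.eval₂Hom (genAct p) MvPolynomial.X φ).coeff N =
      (genAct p (φ.coeff (N.erase p))).coeff (Finsupp.single p (N p)) := by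
  rw [MvPolynomial.coe_eval₂Hom, MvPolynomial.eval₂_eq, MvPolynomial.coeff_sum]
  have hX : ∀ d : Fin (ℓ + 1) × Fin (ℓ + 1) →₀ ℕ,
      ∏ i ∈ d.support, (MvPolynomial.X i : MvPolynomial _ (MatPoly ℓ ℤ)) ^ d i =
        MvPolynomial.monomial d 1 := fun d => by
    rw [MvPolynomial.monomial_eq, map_one, one_mul]; rfl
  have hN : Finsupp.single p (N p) + N.erase p = N := Finsupp.single_add_erase p N
  simp only [hX, MvPolynomial.coeff_mul_monomial', mul_one]
  rw [Finset.sum_eq_single (N.erase p)]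
  · rw [if_pos (by rw [← hN]; simp)]
    congr 1
    nth_rewrite 1 [← hN]
    simp
  · intro d hd hne
    split_ifs with hle
    · rw [coeff_genAct]
      split_ifs with h
      · exfalso
        apply hne
        have h0 : d p = 0 := by
          by_contra h0
          exact MvPolynomial.mem_support_iff.1 hd (hφ d h0)
        ext q
        by_cases hq : q = p
        · subst hq; simp [h0]
        · have h1 := DFunLike.congr_fun h.1 q
          rw [Finsupp.single_eq_of_ne hq, Finsupp.tsub_apply] at h1
          rw [Finsupp.erase_ne hq]
          have := hle q
          omega
      · rfl
    · rfl
  · intro h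
    rw [MvPolynomial.notMem_support_iff.1 h]
    simp

/-- The coefficients of the generating function are the actions of the products of divided powers;
monomials that involve a pair outside the list or a pair `(a, b)` with `a ≥ b` do not occur. -/
theorem coeff_genList (L : List (Fin (ℓ + 1) × Fin (ℓ + 1))) (hL : L.Nodup)
    (N : Fin (ℓ + 1) × Fin (ℓ + 1) →₀ ℕ) (f : MatPoly ℓ ℤ) [Decidable (∀ q, N q ≠ 0 → q ∈ L ∧ q.1 < q.2)] :
    (genList L f).coeff N =
      if ∀ q, N q ≠ 0 → q ∈ L ∧ q.1 < q.2 then act (L.map (factor N)).prod f else 0 := by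
  classical
  induction L generalizing N with
  | nil =>
    simp only [genList, MvPolynomial.coeff_C, List.map_nil, List.prod_nil, act_one]
    congr 1
    apply propext
    constructor
    · rintro rfl; simp
    · intro h
      ext q
      by_contra hq
      simpa using h q fun h0 => hq h0.symm
  | cons p L ih =>
    obtain ⟨hp, hL'⟩ := List.nodup_cons.1 hL
    have hmap : L.map (factor (N.erase p)) = L.map (factor N) := by
      refine List.map_congr_left fun q hq => ?_
      have : q ≠ p := fun h => hp (h ▸ hq)
      simp only [factor, Finsupp.erase_ne this]
    have hfac : factor (Finsupp.single p (N p)) p = factor N p := by simp [factor]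
    rw [genList, RingHom.comp_apply, coeff_eval₂_genAct, ih hL', hmap, coeff_genAct, hfac,
      List.map_cons, List.prod_cons, act_mul]
    · simp only [Finsupp.single_eq_same, true_and]
      have hiff : (∀ q, N q ≠ 0 → q ∈ p :: L ∧ q.1 < q.2) ↔ (N p ≠ 0 → p.1 < p.2) ∧
          ∀ q, N.erase p q ≠ 0 → q ∈ L ∧ q.1 < q.2 := by
        constructor
        · refine fun h => ⟨fun h' => (h p h').2, fun q hq => ?_⟩
          by_cases hqp : q = p
          · subst hqp; simp at hq
          · rw [Finsupp.erase_ne hqp] at hq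
            exact ⟨(List.mem_cons.1 (h q hq).1).resolve_left hqp, (h q hq).2⟩
        · rintro ⟨h1, h2⟩ q hq
          by_cases hqp : q = p
          · subst hqp; exact ⟨List.mem_cons_self, h1 hq⟩
          · rw [← Finsupp.erase_ne hqp] at hq
            exact ⟨List.mem_cons_of_mem _ (h2 q hq).1, (h2 q hq).2⟩
      by_cases h1 : N p ≠ 0 → p.1 < p.2
      · by_cases h2 : ∀ q, N.erase p q ≠ 0 → q ∈ L ∧ q.1 < q.2
        · rw [if_pos h1, if_pos h2, if_pos (hiff.2 ⟨h1, h2⟩)]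
        · rw [if_pos h1, if_neg h2, if_neg fun h => h2 (hiff.1 h).2, act_zero_right]
      · rw [if_neg h1, if_neg fun h => h1 (hiff.1 h).1]
    · intro M hM
      rw [ih hL', if_neg]
      exact fun h => hp (h p hM).1

/-- The pair `(a, b)` adds a multiple of row `b` to row `a`. The row `b` of a later pair of the list is not
changed by the earlier pairs, so that the generating function is linear in the parameters. -/
theorem genList_X (L : List (Fin (ℓ + 1) × Fin (ℓ + 1))) (hL : L.Pairwise fun p q => p.2 ≤ q.2)
    (r j : Fin (ℓ + 1)) : genList L (MvPolynomial.X (r, j)) =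
      MvPolynomial.C (MvPolynomial.X (r, j)) +
        (L.map fun p => if p.1 = r ∧ p.1 < p.2 then
          MvPolynomial.X p * MvPolynomial.C (MvPolynomial.X (p.2, j)) else 0).sum := by
  induction L with
  | nil => simp [genList]
  | cons p L ih =>
    obtain ⟨hp, hL'⟩ := List.pairwise_cons.1 hL
    rw [genList, RingHom.comp_apply, ih hL', map_add, MvPolynomial.eval₂Hom_C, genAct_X, add_assoc,
      List.map_cons, List.sum_cons, map_list_sum, List.map_map]
    congr 3
    refine List.map_congr_left fun q hq => ?_
    rw [Function.comp_apply]
    split_ifs with h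
    · rw [map_mul, MvPolynomial.eval₂Hom_X', MvPolynomial.eval₂Hom_C, genAct_X, if_neg, add_zero]
      rintro ⟨h1, h2⟩
      exact absurd (hp q hq) (by rw [← h1]; exact h2.not_ge)
    · simp

/-- The pairs of indices in the order of the factors of `F^{(N)}`. -/
def pairList (ℓ : ℕ) : List (Fin (ℓ + 1) × Fin (ℓ + 1)) :=
  (List.ofFn fun b : Fin (ℓ + 1) => List.ofFn fun a : Fin (ℓ + 1) => (a, b)).flatten

theorem mem_pairList (p : Fin (ℓ + 1) × Fin (ℓ + 1)) : p ∈ pairList ℓ := by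
  refine List.mem_flatten.2 ⟨_, (List.mem_ofFn' _ _).2 ⟨p.2, rfl⟩, (List.mem_ofFn' _ _).2 ⟨p.1, rfl⟩⟩

theorem pairList_pairwise (ℓ : ℕ) : (pairList ℓ).Pairwise fun p q => p.2 ≤ q.2 := by
  rw [pairList, List.pairwise_flatten]
  constructor
  · intro l hl
    obtain ⟨b, rfl⟩ := (List.mem_ofFn' _ _).1 hl
    rw [List.pairwise_ofFn]
    exact fun _ _ _ => le_rfl
  · rw [List.pairwise_ofFn]
    intro b b' hb p hp q hq
    obtain ⟨a, rfl⟩ := (List.mem_ofFn' _ _).1 hp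
    obtain ⟨a', rfl⟩ := (List.mem_ofFn' _ _).1 hq
    exact hb.le

theorem pairList_nodup (ℓ : ℕ) : (pairList ℓ).Nodup := by
  rw [pairList, List.Nodup, List.pairwise_flatten]
  constructor
  · intro l hl
    obtain ⟨b, rfl⟩ := (List.mem_ofFn' _ _).1 hl
    rw [List.pairwise_ofFn]
    exact fun a a' h h' => h.ne (Prod.ext_iff.1 h').1
  · rw [List.pairwise_ofFn]
    intro b b' hb p hp q hq
    obtain ⟨a, rfl⟩ := (List.mem_ofFn' _ _).1 hp
    obtain ⟨a', rfl⟩ := (List.mem_ofFn' _ _).1 hq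
    exact fun h' => hb.ne (Prod.ext_iff.1 h').2

/-- The restriction of a polynomial function to the upper unitriangular matrices. -/
def unipotent (ℓ : ℕ) : MatPoly ℓ ℤ →+* MvPolynomial (Fin (ℓ + 1) × Fin (ℓ + 1)) ℤ :=
  (MvPolynomial.aeval fun v => if v.1 = v.2 then 1 else if v.1 < v.2 then MvPolynomial.X v else 0 :
    MatPoly ℓ ℤ →ₐ[ℤ] MvPolynomial (Fin (ℓ + 1) × Fin (ℓ + 1)) ℤ)

theorem unipotent_X (v : Fin (ℓ + 1) × Fin (ℓ + 1)) : unipotent ℓ (MvPolynomial.X v) =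
    if v.1 = v.2 then 1 else if v.1 < v.2 then MvPolynomial.X v else 0 :=
  MvPolynomial.aeval_X _ _

theorem map_evalOne_genList (f : MatPoly ℓ ℤ) :
    MvPolynomial.map (evalOne ℓ) (genList (pairList ℓ) f) = unipotent ℓ f := by
  have : (MvPolynomial.map (evalOne ℓ)).comp (genList (pairList ℓ)) = unipotent ℓ := by
    apply MvPolynomial.ringHom_ext
    · intro z; simp
    · rintro ⟨r, j⟩
      rw [RingHom.comp_apply, genList_X _ (pairList_pairwise ℓ), unipotent_X, map_add,
        MvPolynomial.map_C, map_list_sum, List.map_map, ← List.sum_toFinset _ (pairList_nodup ℓ),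
        show (pairList ℓ).toFinset = Finset.univ from
          Finset.eq_univ_iff_forall.2 fun p => List.mem_toFinset.2 (mem_pairList p),
        Finset.sum_eq_single (r, j)]
      · rcases eq_or_ne r j with rfl | h
        · simp [evalOne]
        · by_cases h' : r < j <;> simp [evalOne, h, h']
      · rintro ⟨a, b⟩ _ hne
        rw [Function.comp_apply]
        split_ifs with h
        · obtain ⟨rfl, -⟩ := h
          have : b ≠ j := fun h => hne (h ▸ rfl)
          simp [evalOne, this]
        · simp
      · simp
  exact RingHom.congr_fun this f

/-- The exponents of a matrix of `UT(n)`; negative entries are replaced by zero. -/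
def expo (N : UT (ℓ + 1)) : Fin (ℓ + 1) × Fin (ℓ + 1) →₀ ℕ :=
  Finsupp.equivFunOnFinite.symm fun p => (N.1 p.1 p.2).toNat

theorem expo_apply (N : UT (ℓ + 1)) (p : Fin (ℓ + 1) × Fin (ℓ + 1)) :
    expo N p = (N.1 p.1 p.2).toNat := rfl

theorem F_eq_prod (K : Type*) [Field K] (N : UT (ℓ + 1)) : F K N =
    ((pairList ℓ).map fun p =>
      if h : p.1 < p.2 then XInt K p.2 p.1 h.ne' (N.1 p.1 p.2) else 1).prod := by
  rw [F, pairList, List.map_flatten, List.prod_flatten, List.map_map, List.map_ofFn]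
  congr 2
  funext b
  simp [List.map_ofFn, Function.comp_def]

theorem F_eq_tmul (K : Type*) [Field K] {N : UT (ℓ + 1)} (hN : ∀ a b, 0 ≤ N.1 a b) : F K N =
    (1 : K) ⊗ₜ[ℤ] ((pairList ℓ).map (factor (expo N))).prod := by
  have key : ∀ L : List (Fin (ℓ + 1) × Fin (ℓ + 1)), (L.map fun p =>
      if h : p.1 < p.2 then XInt K p.2 p.1 h.ne' (N.1 p.1 p.2) else 1).prod =
      (1 : K) ⊗ₜ[ℤ] (L.map (factor (expo N))).prod := by
    intro L
    induction L with
    | nil => rfl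
    | cons p L ih =>
      rw [List.map_cons, List.prod_cons, ih, List.map_cons, List.prod_cons]
      rw [← mul_one (1 : K), ← Algebra.TensorProduct.tmul_mul_tmul, mul_one]
      congr 1
      rw [factor]
      split_ifs with h
      · rw [XInt, if_neg (hN _ _).not_gt]; rfl
      · rfl
  rw [F_eq_prod, key]

theorem F_eq_zero (K : Type*) [Field K] {N : UT (ℓ + 1)} {a b : Fin (ℓ + 1)} (h : N.1 a b < 0) :
    F K N = 0 := by
  have hab : a < b := by
    by_contra hab
    rw [N.2 a b (not_lt.1 hab)] at h
    exact lt_irrefl _ h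
  rw [F_eq_prod]
  apply List.prod_eq_zero
  refine List.mem_map.2 ⟨(a, b), mem_pairList _, ?_⟩
  simp [hab, XInt, h]

/-- The product of the row operations of all pairs, in the order of the factors of `F^{(N)}`, takes the
identity matrix to the unitriangular matrix whose entries are the parameters. -/
theorem pairing_F (K : Type*) [Field K] {N : UT (ℓ + 1)} (hN : ∀ a b, 0 ≤ N.1 a b)
    (f : MatPoly ℓ ℤ) : pairing K f (F K N) = ((unipotent ℓ f).coeff (expo N) : ℤ) := by
  classical
  rw [F_eq_tmul K hN, pairing_tmul, one_mul, ← map_evalOne_genList, MvPolynomial.coeff_map,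
    coeff_genList _ (pairList_nodup ℓ), if_pos]
  intro p hp
  refine ⟨mem_pairList p, ?_⟩
  by_contra h
  exact hp (by rw [expo_apply, N.2 _ _ (not_lt.1 h)]; rfl)

end Generating

/-! ### Minors of the generic matrix -/

section Minors

variable {ℓ : ℕ}

/-- The minor of the generic matrix in the rows `r ≤ k` and the columns `c r`, `r ≤ k`, taken in the
order of the indices `r`. -/
def minor (k : Fin (ℓ + 1)) (c : Fin (ℓ + 1) → Fin (ℓ + 1)) : MatPoly ℓ ℤ :=
  Matrix.det (Matrix.of fun r r' : {r : Fin (ℓ + 1) // r ≤ k} =>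
    (MvPolynomial.X (r.1, c r'.1) : MatPoly ℓ ℤ))

/-- A unipotent row operation adds to a row `t ≤ k` a multiple of a row `s < t`, which also belongs to
the minor. -/
theorem minor_isInv (k : Fin (ℓ + 1)) (c : Fin (ℓ + 1) → Fin (ℓ + 1)) : IsInv (minor k c) := by
  intro s t hst
  rw [minor, AlgHom.map_det, RingHom.map_det]
  by_cases ht : t ≤ k
  · let t' : {r : Fin (ℓ + 1) // r ≤ k} := ⟨t, ht⟩
    let s' : {r : Fin (ℓ + 1) // r ≤ k} := ⟨s, hst.le.trans ht⟩
    have hne : t' ≠ s' := fun h => hst.ne' (congrArg Subtype.val h)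
    refine Eq.trans (congrArg Matrix.det ?_)
      (Matrix.det_updateRow_add_smul_self _ hne Polynomial.X)
    ext1 r r'
    by_cases hr : r = t'
    · subst hr
      simp [shear_X, rowMove, t', s']
    · have hr' : (r : Fin (ℓ + 1)) ≠ t := fun h => hr (Subtype.ext h)
      simp [Matrix.updateRow_ne hr, shear_X, rowMove, hr']
  · congr 1
    ext1 r r'
    have hr' : (r : Fin (ℓ + 1)) ≠ t := fun h => ht (h ▸ r.2)
    simp [shear_X, rowMove, hr']

theorem sum_rowWeight (i : Fin ℓ) :
    ∑ r : {r : Fin (ℓ + 1) // r ≤ i.castSucc}, rowWeight r.1 = fundWeight i := by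
  have key : ∀ s : Fin (ℓ + 1), (∑ r : {r : Fin (ℓ + 1) // r ≤ i.castSucc},
      if r.1 = s then (1 : ℤ) else 0) = if s ≤ i.castSucc then 1 else 0 := by
    intro s
    split_ifs with hs
    · rw [Finset.sum_eq_single ⟨s, hs⟩]
      · simp
      · intro r _ hr
        rw [if_neg fun h => hr (Subtype.ext h)]
      · simp
    · refine Finset.sum_eq_zero fun r _ => if_neg fun (h : r.1 = s) => hs (h ▸ r.2)
  funext l
  rw [Finset.sum_apply]
  simp only [rowWeight, Finset.sum_sub_distrib]
  rw [key, key, fundWeight, Pi.single_apply]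
  simp only [Fin.le_def, Fin.val_castSucc, Fin.val_succ, Fin.ext_iff]
  split_ifs <;> first | rfl | omega

theorem minor_isWeight (i : Fin ℓ) (c : Fin (ℓ + 1) → Fin (ℓ + 1)) :
    IsWeight (fundWeight i) (minor i.castSucc c) := by
  rw [minor, Matrix.det_apply]
  refine IsWeight.sum _ fun σ _ => ?_
  rw [Units.smul_def]
  refine IsWeight.smul _ ?_
  have h := IsWeight.prod Finset.univ
    (f := fun r : {r : Fin (ℓ + 1) // r ≤ i.castSucc} => MvPolynomial.X ((σ r).1, c r.1))
    (μ := fun r => rowWeight (σ r).1) fun r _ => IsWeight.X _ _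
  rwa [Equiv.sum_comp σ fun r => rowWeight r.1, sum_rowWeight] at h

theorem minor_exchange {k r₁ r₂ : Fin (ℓ + 1)} (h₁ : r₁ ≤ k) (h₂ : r₂ ≤ k) (hne : r₁ ≠ r₂)
    {c c' : Fin (ℓ + 1) → Fin (ℓ + 1)} (hc₁ : c' r₁ = c r₂) (hc₂ : c' r₂ = c r₁)
    (hc : ∀ r, r ≠ r₁ → r ≠ r₂ → c' r = c r) : minor k c' = -minor k c := by
  let s₁ : {r : Fin (ℓ + 1) // r ≤ k} := ⟨r₁, h₁⟩
  let s₂ : {r : Fin (ℓ + 1) // r ≤ k} := ⟨r₂, h₂⟩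
  have hs : s₁ ≠ s₂ := fun h => hne (congrArg Subtype.val h)
  have h := Matrix.det_permute' (Equiv.swap s₁ s₂)
    (Matrix.of fun r r' : {r : Fin (ℓ + 1) // r ≤ k} =>
      (MvPolynomial.X (r.1, c r'.1) : MatPoly ℓ ℤ))
  rw [Equiv.Perm.sign_swap hs] at h
  rw [minor, minor]
  convert h using 1
  · congr 1
    ext1 r r'
    rw [Matrix.submatrix_apply, Matrix.of_apply, Matrix.of_apply, id]
    congr 2
    by_cases e₁ : r' = s₁
    · rw [e₁, Equiv.swap_apply_left]; exact hc₁
    · by_cases e₂ : r' = s₂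
      · rw [e₂, Equiv.swap_apply_right]; exact hc₂
      · rw [Equiv.swap_apply_of_ne_of_ne e₁ e₂]
        exact hc _ (fun h => e₁ (Subtype.ext h)) fun h => e₂ (Subtype.ext h)
  · simp

theorem colDer_minor {k r₀ : Fin (ℓ + 1)} (h₀ : r₀ ≤ k) (l : Fin ℓ)
    {c : Fin (ℓ + 1) → Fin (ℓ + 1)} (hc : ∀ r ≤ k, c r = l.castSucc ↔ r = r₀) :
    colDer l (minor k c) = minor k (Function.update c r₀ l.succ) := by
  let s₀ : {r : Fin (ℓ + 1) // r ≤ k} := ⟨r₀, h₀⟩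
  rw [colDer, ← coeff_one_shear, minor, AlgHom.map_det]
  set A : Matrix {r : Fin (ℓ + 1) // r ≤ k} {r : Fin (ℓ + 1) // r ≤ k}
    (Polynomial (MatPoly ℓ ℤ)) := Polynomial.C.mapMatrix
      (Matrix.of fun r r' => (MvPolynomial.X (r.1, c r'.1) : MatPoly ℓ ℤ)) with hA
  set A' : Matrix {r : Fin (ℓ + 1) // r ≤ k} {r : Fin (ℓ + 1) // r ≤ k}
    (Polynomial (MatPoly ℓ ℤ)) := Polynomial.C.mapMatrix
      (Matrix.of fun r r' =>
        (MvPolynomial.X (r.1, Function.update c r₀ l.succ r'.1) : MatPoly ℓ ℤ)) with hA'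
  have h1 : A'.det = Polynomial.C (minor k (Function.update c r₀ l.succ)) := by
    rw [minor, RingHom.map_det]
  have h2 : A.det = Polynomial.C (minor k c) := by
    rw [minor, RingHom.map_det]
  have h3 : A' = A.updateCol s₀ fun r => A' r s₀ := by
    ext1 r r'
    by_cases hr : r' = s₀
    · subst hr; simp
    · have hr' : (r' : Fin (ℓ + 1)) ≠ r₀ := fun h => hr (Subtype.ext h)
      simp [Matrix.updateCol_ne hr, hA, hA', Function.update_of_ne hr']
  have h4 : (shear fun v : Fin (ℓ + 1) × Fin (ℓ + 1) => if v.2 = l.castSucc then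
      (MvPolynomial.X (v.1, l.succ) : MatPoly ℓ ℤ) else 0).mapMatrix
      (Matrix.of fun r r' : {r : Fin (ℓ + 1) // r ≤ k} => MvPolynomial.X (r.1, c r'.1)) =
      A.updateCol s₀ ((fun r => A r s₀) + (Polynomial.X : Polynomial (MatPoly ℓ ℤ)) •
        fun r => A' r s₀) := by
    ext1 r r'
    by_cases hr : r' = s₀
    · subst hr
      have : c r₀ = l.castSucc := (hc _ h₀).2 rfl
      simp [shear_X, hA, hA', s₀, this]
    · have hr' : (r' : Fin (ℓ + 1)) ≠ r₀ := fun h => hr (Subtype.ext h)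
      have : c r'.1 ≠ l.castSucc := fun h => hr' ((hc _ r'.2).1 h)
      simp [Matrix.updateCol_ne hr, hA, shear_X, this]
  have h5 : (A.updateCol s₀ fun r => A r s₀) = A := Matrix.updateCol_eq_self A s₀
  rw [h4, Matrix.det_updateCol_add, Matrix.det_updateCol_smul, ← h3, h5, h1, h2]
  simp [Polynomial.coeff_C]

/-- At an upper unitriangular matrix, the minor whose columns are the first ones, except that `a` is
replaced by `b ≥ a`, is the entry in row `a` and column `b`. -/
theorem unipotent_minor {a b : Fin (ℓ + 1)} (h : a ≤ b) :
    unipotent ℓ (minor a (Function.update id a b)) =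
      if a = b then 1 else MvPolynomial.X (a, b) := by
  rw [minor, RingHom.map_det, Matrix.det_of_isUpperTriangular]
  · rw [Finset.prod_eq_single ⟨a, le_rfl⟩]
    · rcases h.eq_or_lt with rfl | h
      · simp [unipotent_X]
      · simp [unipotent_X, h, h.ne]
    · intro r _ hr
      have hr' : (r : Fin (ℓ + 1)) ≠ a := fun h => hr (Subtype.ext h)
      simp [unipotent_X, hr']
    · simp
  · intro r r' hr
    have hr : (r' : Fin (ℓ + 1)) < r := hr
    have hr' : (r' : Fin (ℓ + 1)) ≠ a := (hr.trans_le r.2).ne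
    simp [unipotent_X, hr', hr.ne', hr.not_gt]

theorem update_id_self {α : Type*} [DecidableEq α] (a : α) :
    Function.update id a a = id := Function.update_eq_self a id

/-- Invariant weight functions that restrict to a given monomial on the upper unitriangular matrices
exist for all sufficiently dominant weights. -/
theorem exists_invariant (M : Fin (ℓ + 1) × Fin (ℓ + 1) →₀ ℕ)
    (hM : ∀ p, M p ≠ 0 → p.1 < p.2) : ∃ μ : Fin ℓ → ℤ, (M = 0 → μ = 0) ∧ ∀ k : Fin ℓ → ℕ,
      ∃ f, IsInv f ∧ IsWeight (fun l => μ l + k l) f ∧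
        unipotent ℓ f = MvPolynomial.monomial M 1 := by
  have h1 : ∀ p : Fin (ℓ + 1) × Fin (ℓ + 1), ∃ (μ : Fin ℓ → ℤ) (f : MatPoly ℓ ℤ),
      IsInv f ∧ IsWeight μ f ∧ (p.1 < p.2 → unipotent ℓ f = MvPolynomial.X p) := by
    rintro ⟨a, b⟩
    by_cases h : a < b
    · obtain ⟨i, rfl⟩ := Fin.exists_castSucc_eq.2 (h.trans_le (Fin.le_last b)).ne
      refine ⟨_, _, minor_isInv _ (Function.update id i.castSucc b), minor_isWeight i _, fun _ => ?_⟩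
      rw [unipotent_minor h.le, if_neg h.ne]
    · exact ⟨0, 1, IsInv.one, IsWeight.one, fun h' => absurd h' h⟩
  choose ν g hg1 hg2 hg3 using h1
  refine ⟨∑ p, M p • ν p, fun h => by simp [h], fun k => ?_⟩
  refine ⟨(∏ p, g p ^ M p) * ∏ l : Fin ℓ, minor l.castSucc id ^ k l,
    (IsInv.prod _ fun p _ => (hg1 p).pow _).mul (IsInv.prod _ fun l _ => (minor_isInv _ _).pow _),
    ?_, ?_⟩
  · have h2 := (IsWeight.prod Finset.univ fun p _ => (hg2 p).pow (M p)).mul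
      (IsWeight.prod Finset.univ fun l _ => (minor_isWeight l (id : Fin (ℓ + 1) → _)).pow (k l))
    convert h2 using 1
    funext l
    rw [Pi.add_apply]
    congr 1
    simp [Finset.sum_apply, fundWeight, Pi.single_apply]
  · have h3 : ∀ l : Fin ℓ, unipotent ℓ (minor l.castSucc id) = 1 := fun l => by
      have := unipotent_minor (le_refl l.castSucc)
      rwa [if_pos rfl, update_id_self] at this
    rw [map_mul, map_prod, map_prod]
    simp only [map_pow, h3, one_pow, Finset.prod_const_one, mul_one]
    rw [MvPolynomial.monomial_eq, map_one, one_mul, Finsupp.prod_fintype _ _ fun _ => pow_zero _]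
    refine Finset.prod_congr rfl fun p _ => ?_
    by_cases hp : M p = 0
    · rw [hp, pow_zero, pow_zero]
    · rw [hg3 p (hM p hp)]

end Minors

/-! ### Commutation relations -/

section DividedPowerRelations

variable {A : Type*} [Ring A] [Algebra ℂ A] {x y z h : A}

theorem divPow_zero (x : A) : divPow x 0 = 1 := by simp [divPow]

theorem divPow_one (x : A) : divPow x 1 = x := by simp [divPow]

theorem divPow_mul_divPow (x : A) (m k : ℕ) :
    divPow x m * divPow x k = ((m + k).choose m : ℂ) • divPow x (m + k) := by
  have h1 : (m.factorial : ℂ) ≠ 0 := by exact_mod_cast m.factorial_ne_zero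
  have h2 : (k.factorial : ℂ) ≠ 0 := by exact_mod_cast k.factorial_ne_zero
  have h3 : ((m + k).factorial : ℂ) ≠ 0 := by exact_mod_cast (m + k).factorial_ne_zero
  have h4 : ((m + k).choose m : ℂ) * m.factorial * k.factorial = (m + k).factorial := by
    rw [mul_assoc]
    exact_mod_cast (mul_assoc _ _ _).symm.trans
      (Nat.choose_symm_add ▸ Nat.add_choose_mul_factorial_mul_factorial m k)
  rw [divPow, divPow, divPow, smul_mul_smul_comm, ← pow_add, smul_smul]
  congr 1
  field_simp
  rw [← h4]
  ring

theorem commute_divPow (h : Commute x y) (m k : ℕ) : Commute (divPow x m) (divPow y k) :=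
  ((h.pow_pow m k).smul_left _).smul_right _

theorem mul_divPow_succ (hxy : x * y = y * x + z) (hzy : Commute z y) (m : ℕ) :
    x * divPow y (m + 1) = divPow y (m + 1) * x + divPow y m * z := by
  have key : ∀ m : ℕ, x * y ^ (m + 1) = y ^ (m + 1) * x + ((m : ℂ) + 1) • (y ^ m * z) := by
    intro m
    induction m with
    | zero => simp [hxy]
    | succ m ih =>
      rw [pow_succ y (m + 1), ← mul_assoc, ih, add_mul, mul_assoc _ x, hxy, smul_mul_assoc,
        mul_assoc _ z, hzy.eq, ← mul_assoc (y ^ m), ← pow_succ, mul_add, ← mul_assoc, Nat.cast_add,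
        Nat.cast_one]
      module
  have h1 : (m.factorial : ℂ) ≠ 0 := by exact_mod_cast m.factorial_ne_zero
  have h' : (m : ℂ) + 1 ≠ 0 := by exact_mod_cast m.succ_ne_zero
  simp only [divPow, mul_smul_comm, smul_mul_assoc, key, smul_add, smul_smul]
  congr 2
  rw [Nat.factorial_succ]
  push_cast
  field_simp

/-- The commutation rule for divided powers in a Heisenberg algebra. -/
theorem divPow_mul_divPow_heisenberg (hxy : x * y = y * x + z) (hzx : Commute z x)
    (hzy : Commute z y) (m k : ℕ) : divPow x m * divPow y k =
      ∑ j ∈ Finset.range (k + 1),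
        divPow y (k - j) * divPow z j * divPowInt x ((m : ℤ) - j) := by
  induction m with
  | zero =>
    rw [Finset.sum_eq_single 0]
    · simp [divPow_zero, divPowInt]
    · intro j _ hj
      rw [divPowInt_neg x (by omega), mul_zero]
    · simp
  | succ m ih =>
    have hm : (m : ℂ) + 1 ≠ 0 := by exact_mod_cast m.succ_ne_zero
    apply smul_right_injective A hm
    change ((m : ℂ) + 1) • _ = ((m : ℂ) + 1) • _
    rw [← smul_mul_assoc, ← mul_divPow, mul_assoc, ih, Finset.mul_sum, Finset.smul_sum]
    have hz : ∀ j, x * divPow z j = divPow z j * x := fun j => by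
      have := commute_divPow hzx.symm 1 j
      rw [divPow_one] at this
      exact this.eq
    have hs : ∀ j, z * divPow z j = ((j : ℂ) + 1) • divPow z (j + 1) := mul_divPow z
    -- The summand with index `j` contributes to the summands with indices `j` and `j + 1`.
    have h1 : ∀ j ∈ Finset.range (k + 1),
        x * (divPow y (k - j) * divPow z j * divPowInt x ((m : ℤ) - j)) =
        ((m : ℂ) - j + 1) • (divPow y (k - j) * divPow z j *
          divPowInt x (((m + 1 : ℕ) : ℤ) - j)) +
        (if j = k then 0 else ((j : ℂ) + 1) • (divPow y (k - (j + 1)) * divPow z (j + 1) *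
          divPowInt x (((m + 1 : ℕ) : ℤ) - (j + 1 : ℕ)))) := by
      intro j hj
      have hx := mul_divPowInt x ((m : ℤ) - j)
      have e1 : ((m + 1 : ℕ) : ℤ) - j = (m : ℤ) - j + 1 := by push_cast; ring
      have e2 : ((m + 1 : ℕ) : ℤ) - (j + 1 : ℕ) = (m : ℤ) - j := by push_cast; ring
      have e3 : ((((m : ℤ) - j : ℤ) : ℂ)) = (m : ℂ) - j := by push_cast; ring
      rw [e3] at hx
      rw [e1, e2]
      split_ifs with hjk
      · subst hjk
        rw [Nat.sub_self, divPow_zero, one_mul, ← mul_assoc, hz, mul_assoc, hx, mul_smul_comm,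
          add_zero]
      · obtain ⟨i, hi⟩ : ∃ i, k - j = i + 1 := ⟨k - j - 1, by
          have := Finset.mem_range.1 hj
          omega⟩
        rw [show k - (j + 1) = i by omega, hi, ← mul_assoc, ← mul_assoc, mul_divPow_succ hxy hzy,
          add_mul, add_mul, mul_assoc _ x, hz, mul_assoc (divPow y i) z, hs, ← mul_assoc,
          mul_assoc _ x, hx, mul_smul_comm, mul_smul_comm, smul_mul_assoc]
    rw [Finset.sum_congr rfl h1, Finset.sum_add_distrib]
    have h2 : ∑ j ∈ Finset.range (k + 1), (if j = k then (0 : A) else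
        ((j : ℂ) + 1) • (divPow y (k - (j + 1)) * divPow z (j + 1) *
          divPowInt x (((m + 1 : ℕ) : ℤ) - (j + 1 : ℕ)))) =
        ∑ j ∈ Finset.range (k + 1), (j : ℂ) • (divPow y (k - j) * divPow z j *
          divPowInt x (((m + 1 : ℕ) : ℤ) - j)) := by
      rw [Finset.sum_range_succ, Finset.sum_range_succ', if_pos rfl, Nat.cast_zero, zero_smul]
      congr 1
      refine Finset.sum_congr rfl fun j hj => ?_
      rw [if_neg (Finset.mem_range.1 hj).ne]
      push_cast
      rfl
    rw [h2, ← Finset.sum_add_distrib]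
    refine Finset.sum_congr rfl fun j _ => ?_
    rw [← add_smul]
    congr 1
    ring

theorem binom_mul_divPow (c : ℤ) (hhx : h * x = x * (h + (c : A))) (m k : ℕ) (r : ℤ) :
    binom (h + (r : A)) m * divPow x k =
      divPow x k * binom (h + ((r + k * c : ℤ) : A)) m := by
  have h1 : ∀ (s : ℤ) (p : Polynomial ℂ), Polynomial.aeval (h + (s : A)) p * x =
      x * Polynomial.aeval (h + ((s + c : ℤ) : A)) p := by
    intro s p
    have h0 : (h + (s : A)) * x = x * (h + ((s + c : ℤ) : A)) := by
      rw [add_mul, hhx, Int.cast_add, (Int.cast_commute s x).eq]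
      noncomm_ring
    induction p using Polynomial.induction_on' with
    | add p q hp hq => simp [mul_add, add_mul, hp, hq]
    | monomial n a =>
      rw [Polynomial.aeval_monomial, Polynomial.aeval_monomial, mul_assoc, ← mul_assoc x,
        ← Algebra.commutes, mul_assoc]
      congr 1
      induction n with
      | zero => simp
      | succ n ih => rw [pow_succ, mul_assoc, h0, ← mul_assoc, ih, mul_assoc, ← pow_succ]
  have h2 : ∀ (k : ℕ) (s : ℤ) (p : Polynomial ℂ), Polynomial.aeval (h + (s : A)) p * x ^ k =
      x ^ k * Polynomial.aeval (h + ((s + k * c : ℤ) : A)) p := by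
    intro k
    induction k with
    | zero => simp
    | succ k ih =>
      intro s p
      rw [pow_succ, ← mul_assoc, ih, mul_assoc, h1, mul_assoc]
      have e : s + k * c + c = s + (k + 1 : ℕ) * c := by push_cast; ring
      rw [e]
  rw [binom, binom, divPow, smul_mul_smul_comm, smul_mul_smul_comm, h2, mul_comm]

theorem binom_zero_right (h : A) : binom h 0 = 1 := by simp [binom]

theorem binom_one_right (h : A) : binom h 1 = h := by simp [binom]

theorem binom_add_one (h : A) (z : ℤ) (k : ℕ) : binom (h + ((z + 1 : ℤ) : A)) (k + 1) =
    binom (h + (z : A)) (k + 1) + binom (h + (z : A)) k := by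
  have h0 := binomPoly_step 0 k ((z + 1 : ℤ) : ℂ)
  have h1 := binomPoly_step 1 k ((z + 1 : ℤ) : ℂ)
  have hz : ((z + 1 : ℤ) : ℂ) - 1 = z := by push_cast; ring
  rw [hz] at h0 h1
  rw [← aeval_binomPoly, ← aeval_binomPoly, ← aeval_binomPoly, ← map_add]
  congr 1
  simp only [Polynomial.C_add, Polynomial.C_sub, Polynomial.C_1, Polynomial.C_0] at h0 h1
  linear_combination h0 - h1

theorem binom_mul_binom (h : A) (r : ℤ) (k j : ℕ) :
    binom (h + (r : A)) k * binom (h + ((r - k : ℤ) : A)) j =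
      ((k + j).choose k : ℂ) • binom (h + (r : A)) (k + j) := by
  have h1 : (k.factorial : ℂ) ≠ 0 := by exact_mod_cast k.factorial_ne_zero
  have h2 : (j.factorial : ℂ) ≠ 0 := by exact_mod_cast j.factorial_ne_zero
  have h3 : ((k + j).factorial : ℂ) ≠ 0 := by exact_mod_cast (k + j).factorial_ne_zero
  have h4 : ((k + j).choose k : ℂ) * k.factorial * j.factorial = (k + j).factorial := by
    rw [mul_assoc]
    exact_mod_cast (mul_assoc _ _ _).symm.trans
      (Nat.choose_symm_add ▸ Nat.add_choose_mul_factorial_mul_factorial k j)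
  have h5 : Polynomial.aeval (h + ((r - k : ℤ) : A)) (descPochhammer ℂ j) =
      Polynomial.aeval (h + (r : A)) ((descPochhammer ℂ j).comp (Polynomial.X - (k : Polynomial ℂ))) := by
    rw [Polynomial.aeval_comp]
    congr 2
    simp
    abel
  rw [binom, binom, binom, smul_mul_smul_comm, h5, ← map_mul, descPochhammer_mul, smul_smul]
  congr 1
  field_simp
  rw [← h4]
  ring

theorem commute_binom {h' : A} (hc : Commute h h') (r r' : ℤ) (m m' : ℕ) :
    Commute (binom (h + (r : A)) m) (binom (h' + (r' : A)) m') := by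
  have h1 : Commute (h + (r : A)) (h' + (r' : A)) :=
    (hc.add_right (Int.commute_cast h r')).add_left (Int.cast_commute r _)
  have h2 : ∀ p q : Polynomial ℂ, Commute (Polynomial.aeval (h + (r : A)) p)
      (Polynomial.aeval (h' + (r' : A)) q) := by
    intro p q
    have h3 : ∀ (a b : A) (q : Polynomial ℂ), Commute a b → Commute a (Polynomial.aeval b q) := by
      intro a b q hab
      induction q using Polynomial.induction_on' with
      | add p q hp hq => rw [map_add]; exact hp.add_right hq
      | monomial n c =>
        rw [Polynomial.aeval_monomial]
        exact (Algebra.commute_algebraMap_right c a).mul_right (hab.pow_right n)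
    exact (h3 _ _ _ (h3 _ _ _ h1).symm).symm
  exact ((h2 _ _).smul_left _).smul_right _

end DividedPowerRelations

section EnvRelations

variable {ℓ : ℕ}

theorem ι_mul_sub (x y : LieSL ℓ) :
    UniversalEnvelopingAlgebra.ι ℂ x * UniversalEnvelopingAlgebra.ι ℂ y
      - UniversalEnvelopingAlgebra.ι ℂ y * UniversalEnvelopingAlgebra.ι ℂ x
      = UniversalEnvelopingAlgebra.ι ℂ ⁅x, y⁆ := by
  let : LieRing (EnvSL ℓ) := LieRing.ofAssociativeRing
  exact (LieHom.map_lie (UniversalEnvelopingAlgebra.ι ℂ) x y).symm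

theorem commute_rootVec {s t u v : Fin (ℓ + 1)} (hst : s ≠ t) (huv : u ≠ v) (h₁ : t ≠ u)
    (h₂ : v ≠ s) : Commute (rootVec s t hst) (rootVec u v huv) := by
  refine sub_eq_zero.1 ((ι_mul_sub _ _).trans ?_)
  rw [show ⁅_, _⁆ = (0 : LieSL ℓ) from Subtype.ext ?_, map_zero]
  rw [LieAlgebra.SpecialLinear.sl_bracket]
  simp [h₁, h₂]

theorem rootVec_mul_rootVec {s t v : Fin (ℓ + 1)} (hst : s ≠ t) (htv : t ≠ v) (hsv : s ≠ v) :
    rootVec s t hst * rootVec t v htv = rootVec t v htv * rootVec s t hst + rootVec s v hsv := by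
  refine eq_add_of_sub_eq' ((ι_mul_sub _ _).trans ?_)
  rw [rootVec]
  congr 1
  apply Subtype.ext
  rw [LieAlgebra.SpecialLinear.sl_bracket]
  simp [hsv.symm]

theorem rootVec_mul_rootVec_neg {s t : Fin (ℓ + 1)} (u : Fin (ℓ + 1)) (hst : s ≠ t) (hus : u ≠ s)
    (hut : u ≠ t) : rootVec s t hst * rootVec u s hus =
      rootVec u s hus * rootVec s t hst + -rootVec u t hut := by
  rw [rootVec_mul_rootVec hus hst hut]
  abel

theorem val_singleSubSingle_eq_diagonal (l : Fin ℓ) :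
    (LieAlgebra.SpecialLinear.singleSubSingle l.castSucc l.succ (1 : ℂ)).1 =
      Matrix.diagonal fun r => (rowWeight r l : ℂ) := by
  rw [LieAlgebra.SpecialLinear.val_singleSubSingle, ← Matrix.diagonal_single,
    ← Matrix.diagonal_single, Matrix.diagonal_sub]
  congr 1
  funext r
  simp [rowWeight, Pi.single_apply]

theorem commute_coroot (l k : Fin ℓ) : Commute (coroot l) (coroot k) := by
  refine sub_eq_zero.1 ((ι_mul_sub _ _).trans ?_)
  rw [show ⁅_, _⁆ = (0 : LieSL ℓ) from Subtype.ext ?_, map_zero]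
  rw [LieAlgebra.SpecialLinear.sl_bracket]
  refine sub_eq_zero.2 ?_
  rw [val_singleSubSingle_eq_diagonal, val_singleSubSingle_eq_diagonal,
    Matrix.diagonal_mul_diagonal, Matrix.diagonal_mul_diagonal]
  simp only [mul_comm]

theorem coroot_mul_rootVec (l : Fin ℓ) {s t : Fin (ℓ + 1)} (h : s ≠ t) :
    coroot l * rootVec s t h =
      rootVec s t h * (coroot l + ((rowWeight s l - rowWeight t l : ℤ) : EnvSL ℓ)) := by
  have h1 : coroot l * rootVec s t h - rootVec s t h * coroot l =
      ((rowWeight s l - rowWeight t l : ℤ) : ℂ) • rootVec s t h := by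
    refine (ι_mul_sub _ _).trans ?_
    rw [rootVec, ← map_smul]
    congr 1
    apply Subtype.ext
    rw [LieAlgebra.SpecialLinear.sl_bracket, val_singleSubSingle_eq_diagonal]
    ext i j
    change (_ - _ : Matrix (Fin (ℓ + 1)) (Fin (ℓ + 1)) ℂ) i j =
      ((rowWeight s l - rowWeight t l : ℤ) : ℂ) •
        (LieAlgebra.SpecialLinear.single s t h (1 : ℂ)).1 i j
    rw [LieAlgebra.SpecialLinear.val_single, Matrix.sub_apply, Matrix.diagonal_mul,
      Matrix.mul_diagonal, Matrix.single_apply]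
    split_ifs with hij
    · obtain ⟨rfl, rfl⟩ := hij
      simp
    · simp
  rw [mul_add, ← (Int.cast_commute _ _).eq, ← zsmul_eq_mul, ← Int.cast_smul_eq_zsmul ℂ, ← h1]
  abel

theorem rootVec_simple_mul (l : Fin ℓ) :
    rootVec l.castSucc l.succ l.castSucc_lt_succ.ne * rootVec l.succ l.castSucc l.castSucc_lt_succ.ne'
      = rootVec l.succ l.castSucc l.castSucc_lt_succ.ne' *
        rootVec l.castSucc l.succ l.castSucc_lt_succ.ne + coroot l := by
  refine eq_add_of_sub_eq' ((ι_mul_sub _ _).trans ?_)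
  rw [coroot]
  congr 1
  apply Subtype.ext
  rw [LieAlgebra.SpecialLinear.sl_bracket]
  simp

end EnvRelations

section HypRelations

variable (K : Type*) [Field K] {ℓ : ℕ}

variable (ℓ) in
/-- The canonical homomorphism from the integral form to the hyperalgebra. -/
def toHyp : kostantForm ℓ →+* Hyp K ℓ :=
  (Algebra.TensorProduct.includeRight : kostantForm ℓ →ₐ[ℤ] Hyp K ℓ).toRingHom

theorem X_eq (s t : Fin (ℓ + 1)) (h : s ≠ t) (m : ℕ) :
    X K s t h m = toHyp K ℓ ⟨divPow (rootVec s t h) m, divPow_mem s t h m⟩ := rfl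

theorem HBinom_eq (l : Fin ℓ) (r : ℤ) (m : ℕ) :
    HBinom K l r m = toHyp K ℓ ⟨binom (coroot l + (r : EnvSL ℓ)) m, binom_coroot_mem l r m⟩ := rfl

theorem X_zero (s t : Fin (ℓ + 1)) (h : s ≠ t) : X K s t h 0 = 1 := by
  rw [X_eq, ← map_one (toHyp K ℓ)]
  congr 1
  exact Subtype.ext (divPow_zero _)

theorem X_commute {s t u v : Fin (ℓ + 1)} (hst : s ≠ t) (huv : u ≠ v) (h₁ : t ≠ u)
    (h₂ : v ≠ s) (m k : ℕ) : Commute (X K s t hst m) (X K u v huv k) := by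
  rw [X_eq, X_eq]
  refine Commute.map ?_ _
  exact Subtype.ext (commute_divPow (commute_rootVec hst huv h₁ h₂) m k)

theorem X_mul_X_self {s t : Fin (ℓ + 1)} (h : s ≠ t) (m k : ℕ) :
    X K s t h m * X K s t h k = (m + k).choose m • X K s t h (m + k) := by
  rw [X_eq, X_eq, X_eq, ← map_mul, ← map_nsmul]
  congr 1
  apply Subtype.ext
  rw [Subring.coe_mul, divPow_mul_divPow, Nat.cast_smul_eq_nsmul]
  rfl

theorem divPowInt_mem (s t : Fin (ℓ + 1)) (h : s ≠ t) (m : ℤ) :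
    divPowInt (rootVec s t h) m ∈ kostantForm ℓ := by
  rw [divPowInt]
  split_ifs
  · exact zero_mem _
  · exact divPow_mem _ _ _ _

theorem XInt_eq (s t : Fin (ℓ + 1)) (h : s ≠ t) (m : ℤ) :
    XInt K s t h m = toHyp K ℓ ⟨divPowInt (rootVec s t h) m, divPowInt_mem s t h m⟩ := by
  rw [XInt]
  split_ifs with hm
  · rw [← map_zero (toHyp K ℓ)]
    congr 1
    exact Subtype.ext (divPowInt_neg _ hm).symm
  · rw [X_eq]
    congr 1
    exact Subtype.ext (by simp [divPowInt, hm])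

theorem X_mul_X {s t v : Fin (ℓ + 1)} (hst : s ≠ t) (htv : t ≠ v) (hsv : s ≠ v) (m k : ℕ) :
    X K s t hst m * X K t v htv k = ∑ j ∈ Finset.range (k + 1),
      X K t v htv (k - j) * X K s v hsv j * XInt K s t hst ((m : ℤ) - j) := by
  simp only [X_eq, XInt_eq, ← map_mul, ← map_sum]
  congr 1
  apply Subtype.ext
  simp only [Subring.coe_mul, AddSubmonoidClass.coe_finsetSum]
  exact divPow_mul_divPow_heisenberg (rootVec_mul_rootVec hst htv hsv)
    (commute_rootVec hsv hst hsv.symm hst.symm) (commute_rootVec hsv htv htv.symm hsv.symm) m k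

theorem HBinom_mul_X (l : Fin ℓ) (r : ℤ) (m : ℕ) {s t : Fin (ℓ + 1)} (h : s ≠ t) (k : ℕ) :
    HBinom K l r m * X K s t h k =
      X K s t h k * HBinom K l (r + k * (rowWeight s l - rowWeight t l)) m := by
  rw [X_eq, HBinom_eq, HBinom_eq, ← map_mul, ← map_mul]
  congr 1
  exact Subtype.ext (binom_mul_divPow _ (coroot_mul_rootVec l h) m k r)

theorem HBinom_zero (l : Fin ℓ) (r : ℤ) : HBinom K l r 0 = 1 := by
  rw [HBinom_eq, ← map_one (toHyp K ℓ)]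
  congr 1
  exact Subtype.ext (binom_zero_right _)

theorem HBinom_add_one (l : Fin ℓ) (r : ℤ) (k : ℕ) :
    HBinom K l (r + 1) (k + 1) = HBinom K l r (k + 1) + HBinom K l r k := by
  rw [HBinom_eq, HBinom_eq, HBinom_eq]
  refine Eq.trans (congrArg (toHyp K ℓ) (Subtype.ext ?_)) (map_add (toHyp K ℓ) _ _)
  rw [Subring.coe_add]
  exact binom_add_one _ _ _

theorem HBinom_mul_HBinom (l : Fin ℓ) (r : ℤ) (k j : ℕ) :
    HBinom K l r k * HBinom K l (r - k) j = (k + j).choose k • HBinom K l r (k + j) := by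
  rw [HBinom_eq, HBinom_eq, HBinom_eq, ← map_mul, ← map_nsmul]
  congr 1
  apply Subtype.ext
  refine (binom_mul_binom _ r k j).trans ?_
  rw [Nat.cast_smul_eq_nsmul]
  rfl

theorem HBinom_commute (l l' : Fin ℓ) (r r' : ℤ) (m m' : ℕ) :
    Commute (HBinom K l r m) (HBinom K l' r' m') := by
  rw [HBinom_eq, HBinom_eq]
  refine Commute.map ?_ _
  exact Subtype.ext (commute_binom (commute_coroot l l') r r' m m')

/-- The action of `E_{l,l+1}` on a divided power of another root vector. -/
theorem X_one_mul_X {l : Fin ℓ} {s t : Fin (ℓ + 1)} (h : s ≠ t) {z : kostantForm ℓ}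
    (hz : rootVec l.castSucc l.succ l.castSucc_lt_succ.ne * rootVec s t h =
      rootVec s t h * rootVec l.castSucc l.succ l.castSucc_lt_succ.ne + z)
    (hzc : Commute (z : EnvSL ℓ) (rootVec s t h)) (m : ℕ) :
    X K l.castSucc l.succ l.castSucc_lt_succ.ne 1 * X K s t h (m + 1) =
      X K s t h (m + 1) * X K l.castSucc l.succ l.castSucc_lt_succ.ne 1 +
        X K s t h m * toHyp K ℓ z := by
  simp only [X_eq, ← map_mul, ← map_add]
  congr 1
  apply Subtype.ext
  simp only [Subring.coe_mul, Subring.coe_add, divPow_one]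
  exact mul_divPow_succ hz hzc m

/-- The action of `E_{l,l+1}` on a divided power of `E_{l+1,l}`. -/
theorem X_one_mul_X_neg (l : Fin ℓ) (m : ℕ) :
    X K l.castSucc l.succ l.castSucc_lt_succ.ne 1 *
        X K l.succ l.castSucc l.castSucc_lt_succ.ne' (m + 1) =
      X K l.succ l.castSucc l.castSucc_lt_succ.ne' (m + 1) *
        X K l.castSucc l.succ l.castSucc_lt_succ.ne 1 +
        X K l.succ l.castSucc l.castSucc_lt_succ.ne' m * HBinom K l (-m) 1 := by
  simp only [X_eq, HBinom_eq, ← map_mul, ← map_add]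
  congr 1
  apply Subtype.ext
  simp only [Subring.coe_mul, Subring.coe_add, divPow_one, binom_one_right]
  have h1 := coroot_mul_rootVec l (l.castSucc_lt_succ (n := ℓ)).ne'
  have h2 := mul_divPow_f (rootVec_simple_mul l) (h1.trans ?_) m
  · rw [h2]
    congr 2
    push_cast
    abel
  · congr 1
    have : (l.succ : Fin (ℓ + 1)) ≠ l.castSucc := l.castSucc_lt_succ.ne'
    simp [rowWeight, this, this.symm]
    abel_nf

end HypRelations

/-! ### Spanning sets of `𝒰⁰` and `𝒰⁻` -/

section SpanZero

variable (K : Type*) [Field K] {ℓ : ℕ}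

/-- The product of the elements `binom(H_{α_l} + r_l, k_l) ⊗ 1`. -/
def prodH (r : Fin ℓ → ℤ) (k : Fin ℓ → ℕ) : Hyp K ℓ :=
  (List.ofFn fun l => HBinom K l (r l) (k l)).prod

/-- By Pascal's rule, the span of the elements `binom(H_{α_l} + r, k) ⊗ 1`, `k ≥ 0`, does not depend
on `r`. -/
theorem HBinom_mem_of_shift (S : Submodule K (Hyp K ℓ)) (l : Fin ℓ) (r : ℤ)
    (hS : ∀ k, HBinom K l r k ∈ S) (r' : ℤ) : ∀ k, HBinom K l r' k ∈ S := by
  have zero : ∀ z : ℤ, HBinom K l z 0 ∈ S := fun z => by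
    rw [HBinom_zero, ← HBinom_zero K l r]; exact hS 0
  induction r' using Int.inductionOn' (b := r) with
  | zero => exact hS
  | succ z _ ih =>
    intro k
    cases k with
    | zero => exact zero _
    | succ k => rw [HBinom_add_one]; exact S.add_mem (ih _) (ih _)
  | pred z _ ih =>
    intro k
    induction k with
    | zero => exact zero _
    | succ k ihk =>
      have h := HBinom_add_one K l (z - 1) k
      rw [sub_add_cancel] at h
      rw [eq_sub_iff_add_eq.2 h.symm]
      exact S.sub_mem (ih _) ihk

theorem HBinom_mem (l : Fin ℓ) (r : ℤ) (k : ℕ) : HBinom K l r k ∈ uZero K ℓ :=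
  HBinom_mem_of_shift K (uZero K ℓ).toSubmodule l 0
    (fun k => Algebra.subset_adjoin ⟨l, k, rfl⟩) r k

theorem prodH_mem (r : Fin ℓ → ℤ) (k : Fin ℓ → ℕ) : prodH K r k ∈ uZero K ℓ := by
  refine list_prod_mem fun x hx => ?_
  obtain ⟨l, rfl⟩ := (List.mem_ofFn' _ _).1 hx
  exact HBinom_mem K l _ _

theorem prodH_zero_right (r : Fin ℓ → ℤ) : prodH K r 0 = 1 := by
  rw [prodH]
  refine List.prod_eq_one fun x hx => ?_
  obtain ⟨l, rfl⟩ := (List.mem_ofFn' _ _).1 hx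
  exact HBinom_zero K l _

theorem prod_ofFn_mul {M : Type*} [Monoid M] {n : ℕ} (f : Fin n → M) (i : Fin n) (x : M)
    (hx : ∀ j, Commute x (f j)) :
    (List.ofFn f).prod * x = (List.ofFn (Function.update f i (f i * x))).prod := by
  induction n with
  | zero => exact i.elim0
  | succ n ih =>
    rw [List.ofFn_succ, List.ofFn_succ, List.prod_cons, List.prod_cons]
    cases i using Fin.cases with
    | zero =>
      have h : Commute x (List.ofFn fun j : Fin n => f j.succ).prod := by
        refine Commute.list_prod_right _ _ fun y hy => ?_
        obtain ⟨j, rfl⟩ := (List.mem_ofFn' _ _).1 hy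
        exact hx _
      simp only [Function.update_self, Function.update_of_ne (Fin.succ_ne_zero _)]
      rw [mul_assoc, ← h.eq, mul_assoc]
    | succ i =>
      rw [Function.update_of_ne (Fin.succ_ne_zero i).symm, mul_assoc,
        ih (fun j => f j.succ) i fun j => hx _]
      congr 4
      funext j
      by_cases h : j = i
      · subst h; simp
      · rw [Function.update_of_ne h, Function.update_of_ne fun h' => h (Fin.succ_injective _ h')]

theorem prodH_mul_HBinom_mem (r : Fin ℓ → ℤ) (k : Fin ℓ → ℕ) (l : Fin ℓ) (m : ℕ) :
    prodH K r k * HBinom K l 0 m ∈ Submodule.span K (Set.range (prodH K r)) := by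
  rw [prodH, prod_ofFn_mul _ l _ fun j => HBinom_commute K _ _ _ _ _ _]
  -- The factor with index `l` enters linearly.
  let φ : Hyp K ℓ →ₗ[K] Hyp K ℓ :=
    (MultilinearMap.mkPiAlgebraFin K ℓ (Hyp K ℓ)).toLinearMap
      (fun l => HBinom K l (r l) (k l)) l
  have hφ : ∀ x, φ x = (List.ofFn (Function.update (fun l => HBinom K l (r l) (k l)) l x)).prod :=
    fun x => MultilinearMap.mkPiAlgebraFin_apply (R := K) (A := Hyp K ℓ) _
  rw [← hφ]
  have h1 : ∀ j, HBinom K l (r l - k l) j ∈ Submodule.comap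
      (φ ∘ₗ LinearMap.mulLeft K (HBinom K l (r l) (k l)))
      (Submodule.span K (Set.range (prodH K r))) := by
    intro j
    rw [Submodule.mem_comap, LinearMap.comp_apply, LinearMap.mulLeft_apply, HBinom_mul_HBinom,
      map_nsmul]
    refine Submodule.smul_of_tower_mem _ _ (Submodule.subset_span
      ⟨Function.update k l (k l + j), ?_⟩)
    rw [hφ, prodH]
    congr 2
    funext l'
    by_cases h : l' = l
    · subst h; simp
    · simp [h]
  exact HBinom_mem_of_shift K _ l _ h1 0 m

/-- For every `r`, the products of the elements `binom(H_{α_l} + r_l, k_l) ⊗ 1` span `𝒰⁰`. -/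
theorem uZero_eq_span (r : Fin ℓ → ℤ) :
    (uZero K ℓ).toSubmodule = Submodule.span K (Set.range (prodH K r)) := by
  apply le_antisymm
  · intro x hx
    have key : ∀ y ∈ Submodule.span K (Set.range (prodH K r)),
        y * x ∈ Submodule.span K (Set.range (prodH K r)) := by
      replace hx : x ∈ uZero K ℓ := hx
      rw [uZero] at hx
      induction hx using Algebra.adjoin_induction with
      | mem x hx =>
        obtain ⟨l, m, rfl⟩ := hx
        intro y hy
        induction hy using Submodule.span_induction with
        | mem y hy => obtain ⟨k, rfl⟩ := hy; exact prodH_mul_HBinom_mem K r k l m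
        | zero => rw [zero_mul]; exact zero_mem _
        | add y z _ _ hy hz => rw [add_mul]; exact add_mem hy hz
        | smul c y _ hy => rw [smul_mul_assoc]; exact Submodule.smul_mem _ _ hy
      | algebraMap c =>
        intro y hy
        rw [← Algebra.commutes, ← Algebra.smul_def]
        exact Submodule.smul_mem _ _ hy
      | add x z _ _ hx hz => intro y hy; rw [mul_add]; exact add_mem (hx y hy) (hz y hy)
      | mul x z _ _ hx hz => intro y hy; rw [← mul_assoc]; exact hz _ (hx y hy)
    have := key 1 (Submodule.subset_span ⟨0, prodH_zero_right K r⟩)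
    rwa [one_mul] at this
  · rw [Submodule.span_le]
    rintro _ ⟨k, rfl⟩
    exact prodH_mem K r k

end SpanZero

section SubmoduleProducts

variable {R A : Type*} [CommSemiring R] [Semiring A] [Algebra R A]

theorem one_le_listProd {L : List (Submodule R A)} (h : ∀ T ∈ L, 1 ≤ T) : 1 ≤ L.prod := by
  induction L with
  | nil => exact le_rfl
  | cons T L ih =>
    rw [List.prod_cons, ← one_mul 1]
    exact mul_le_mul' (h T List.mem_cons_self) (ih fun T' hT' => h T' (List.mem_cons_of_mem _ hT'))

theorem le_listProd {L : List (Submodule R A)} (h : ∀ T ∈ L, 1 ≤ T) {T : Submodule R A}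
    (hT : T ∈ L) : T ≤ L.prod := by
  induction L with
  | nil => simp at hT
  | cons T' L ih =>
    have hL : ∀ S ∈ L, 1 ≤ S := fun S hS => h S (List.mem_cons_of_mem _ hS)
    rw [List.prod_cons]
    rcases List.mem_cons.1 hT with rfl | hT
    · exact le_trans (mul_one T).ge (mul_le_mul' le_rfl (one_le_listProd hL))
    · exact le_trans (one_mul T).ge (mul_le_mul' (h _ List.mem_cons_self) (ih hL hT))

theorem listProd_mul_le_mul_listProd {L : List (Submodule R A)} {T : Submodule R A}
    (h : ∀ T' ∈ L, T' * T ≤ T * T') : L.prod * T ≤ T * L.prod := by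
  induction L with
  | nil => simp
  | cons T' L ih =>
    rw [List.prod_cons, mul_assoc]
    calc T' * (L.prod * T) ≤ T' * (T * L.prod) :=
          mul_le_mul' le_rfl (ih fun S hS => h S (List.mem_cons_of_mem _ hS))
      _ = T' * T * L.prod := (mul_assoc _ _ _).symm
      _ ≤ T * T' * L.prod := mul_le_mul' (h _ List.mem_cons_self) le_rfl
      _ = T * (T' * L.prod) := mul_assoc _ _ _

/-- If later factors can be moved to the left past earlier ones, the product absorbs its factors. -/
theorem listProd_mul_le {L : List (Submodule R A)} (h : ∀ T ∈ L, T * T ≤ T)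
    (hL : L.Pairwise fun T T' => T' * T ≤ T * T') {T : Submodule R A} (hT : T ∈ L) :
    L.prod * T ≤ L.prod := by
  induction L with
  | nil => simp at hT
  | cons T' L ih =>
    obtain ⟨h1, h2⟩ := List.pairwise_cons.1 hL
    rw [List.prod_cons, mul_assoc]
    rcases List.mem_cons.1 hT with rfl | hT
    · refine (mul_le_mul' le_rfl (listProd_mul_le_mul_listProd h1)).trans ?_
      rw [← mul_assoc]
      exact mul_le_mul' (h _ List.mem_cons_self) le_rfl
    · exact mul_le_mul' le_rfl (ih (fun S hS => h S (List.mem_cons_of_mem _ hS)) h2 hT)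

theorem mul_listProd_le {L : List (Submodule R A)} {S : Submodule R A} (h : ∀ T ∈ L, S * T ≤ S) :
    S * L.prod ≤ S := by
  induction L with
  | nil => simp
  | cons T L ih =>
    rw [List.prod_cons, ← mul_assoc]
    exact (mul_le_mul' (h _ List.mem_cons_self) le_rfl).trans
      (ih fun T' hT' => h T' (List.mem_cons_of_mem _ hT'))

end SubmoduleProducts

/-- The exponents of the elements `F^{(N)}` with `N ≥ 0`. -/
abbrev PosExp (ℓ : ℕ) := {M : Fin (ℓ + 1) × Fin (ℓ + 1) →₀ ℕ // ∀ p, M p ≠ 0 → p.1 < p.2}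

section NegFamily

variable {K A : Type*} [Field K] [Ring A] [Algebra K A] {ℓ : ℕ}

/-- The relations between the divided powers `y_p^{(m)}` of the negative root vectors `E_{b,a}`,
`p = (a, b)`, that are used for writing every product of them in the order of the factors of
`F^{(N)}`. Pairs with `a ≥ b` stand for the factor `1`. -/
structure NegFamily (K : Type*) {A : Type*} [Field K] [Ring A] [Algebra K A]
    (y : Fin (ℓ + 1) × Fin (ℓ + 1) → ℕ → A) : Prop where
  zero : ∀ p, y p 0 = 1
  eq_one : ∀ p, ¬p.1 < p.2 → ∀ m, y p m = 1
  mul_self : ∀ p m k, ∃ c : ℕ, y p m * y p k = c • y p (m + k)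
  commute : ∀ p q, (p.1 < p.2 → q.1 < q.2 → p.1 ≠ q.2 ∧ q.1 ≠ p.2) → ∀ m k,
    Commute (y p m) (y q k)
  heisenberg : ∀ a b c, c < a → a < b → ∀ m k, ∃ u : ℕ → A,
    (∀ j, u j ∈ Submodule.span K (Set.range (y (a, b)))) ∧
    y (a, b) m * y (c, a) k = ∑ j ∈ Finset.range (k + 1), y (c, a) (k - j) * (y (c, b) j * u j)

/-- The span of all divided powers of the negative root vector `E_{b,a}`, where `p = (a, b)`. -/
def negSpan (K : Type*) {A : Type*} [Field K] [Ring A] [Algebra K A]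
    (y : Fin (ℓ + 1) × Fin (ℓ + 1) → ℕ → A) (p : Fin (ℓ + 1) × Fin (ℓ + 1)) : Submodule K A :=
  Submodule.span K (Set.range (y p))

/-- The span of the products of divided powers of root vectors `E_{b,a}` with a given `b`. -/
def negRow (K : Type*) {A : Type*} [Field K] [Ring A] [Algebra K A]
    (y : Fin (ℓ + 1) × Fin (ℓ + 1) → ℕ → A) (b : Fin (ℓ + 1)) : Submodule K A :=
  ((List.finRange (ℓ + 1)).map fun a => negSpan K y (a, b)).prod

variable {y : Fin (ℓ + 1) × Fin (ℓ + 1) → ℕ → A}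

theorem mem_negSpan (p : Fin (ℓ + 1) × Fin (ℓ + 1)) (m : ℕ) : y p m ∈ negSpan K y p :=
  Submodule.subset_span ⟨m, rfl⟩

theorem negSpan_mul_le {p q : Fin (ℓ + 1) × Fin (ℓ + 1)} {S : Submodule K A}
    (h : ∀ m k : ℕ, y p m * y q k ∈ S) : negSpan K y p * negSpan K y q ≤ S := by
  rw [negSpan, negSpan, Submodule.span_mul_span, Submodule.span_le]
  rintro _ ⟨_, ⟨m, rfl⟩, _, ⟨k, rfl⟩, rfl⟩
  exact h m k

theorem le_mul_of_one_le_left {S T : Submodule K A} (h : 1 ≤ S) : T ≤ S * T :=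
  (one_mul T).ge.trans (mul_le_mul' h le_rfl)

theorem le_mul_of_one_le_right {S T : Submodule K A} (h : 1 ≤ T) : S ≤ S * T :=
  (mul_one S).ge.trans (mul_le_mul' le_rfl h)

namespace NegFamily

variable (hy : NegFamily K y)
include hy

theorem one_le_negSpan (p : Fin (ℓ + 1) × Fin (ℓ + 1)) : 1 ≤ negSpan K y p := by
  rw [Submodule.one_le, ← hy.zero p]
  exact mem_negSpan p 0

theorem negSpan_mul_self (p : Fin (ℓ + 1) × Fin (ℓ + 1)) :
    negSpan K y p * negSpan K y p ≤ negSpan K y p :=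
  negSpan_mul_le fun m k => by
    obtain ⟨c, hc⟩ := hy.mul_self p m k
    rw [hc]
    exact Submodule.smul_of_tower_mem _ _ (mem_negSpan p _)

theorem negSpan_mul_comm {p q : Fin (ℓ + 1) × Fin (ℓ + 1)}
    (h : p.1 < p.2 → q.1 < q.2 → p.1 ≠ q.2 ∧ q.1 ≠ p.2) :
    negSpan K y p * negSpan K y q ≤ negSpan K y q * negSpan K y p :=
  negSpan_mul_le fun m k => by
    rw [(hy.commute p q h m k).eq]
    exact Submodule.mul_mem_mul (mem_negSpan q k) (mem_negSpan p m)

theorem one_le_negRow (b : Fin (ℓ + 1)) : 1 ≤ negRow K y b :=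
  one_le_listProd fun T hT => by
    obtain ⟨a, -, rfl⟩ := List.mem_map.1 hT
    exact hy.one_le_negSpan _

theorem negSpan_le_negRow (a b : Fin (ℓ + 1)) : negSpan K y (a, b) ≤ negRow K y b :=
  le_listProd (fun T hT => by
    obtain ⟨a, -, rfl⟩ := List.mem_map.1 hT
    exact hy.one_le_negSpan _) (List.mem_map.2 ⟨a, List.mem_finRange a, rfl⟩)

theorem negRow_mul_self (b : Fin (ℓ + 1)) : negRow K y b * negRow K y b ≤ negRow K y b := by
  refine mul_listProd_le fun T hT => listProd_mul_le ?_ ?_ hT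
  · intro T hT
    obtain ⟨a, -, rfl⟩ := List.mem_map.1 hT
    exact hy.negSpan_mul_self _
  · rw [List.pairwise_map]
    refine (List.pairwise_lt_finRange (ℓ + 1)).imp ?_
    intro a a' _
    exact hy.negSpan_mul_comm (p := (a', b)) (q := (a, b)) fun h h' => ⟨h.ne, h'.ne⟩

/-- The products of row `b` can be moved to the right past root vectors of smaller rows: the commutator
of `E_{b,a}` and `E_{a,c}` is a multiple of `E_{b,c}`, which belongs to row `b` again. -/
theorem negRow_mul_negSpan {b : Fin (ℓ + 1)} {q : Fin (ℓ + 1) × Fin (ℓ + 1)} (hq : q.2 < b) :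
    negRow K y b * negSpan K y q ≤ negSpan K y q * negRow K y b := by
  have key : ∀ a, negSpan K y (a, b) * negSpan K y q ≤ negSpan K y q * negRow K y b := by
    intro a
    by_cases ha : a = q.2 ∧ q.1 < q.2
    · obtain ⟨c, d⟩ := q
      dsimp only at ha hq
      obtain ⟨rfl, hc⟩ := ha
      refine negSpan_mul_le fun m k => ?_
      obtain ⟨u, hu, h⟩ := hy.heisenberg a b c hc hq m k
      rw [h]
      exact Submodule.sum_mem _ fun j _ => Submodule.mul_mem_mul (mem_negSpan _ _)
        (hy.negRow_mul_self b (Submodule.mul_mem_mul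
          (hy.negSpan_le_negRow c b (mem_negSpan _ _)) (hy.negSpan_le_negRow a b (hu j))))
    · exact (hy.negSpan_mul_comm fun _ h => ⟨fun h' => ha ⟨h', h⟩, (h.trans hq).ne⟩).trans
        (mul_le_mul' le_rfl (hy.negSpan_le_negRow a b))
  have key' : ∀ J : List (Fin (ℓ + 1)), (J.map fun a => negSpan K y (a, b)).prod * negSpan K y q ≤
      negSpan K y q * negRow K y b := by
    intro J
    induction J with
    | nil =>
      rw [List.map_nil, List.prod_nil, one_mul]
      exact le_mul_of_one_le_right (hy.one_le_negRow b)
    | cons a J ih =>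
      rw [List.map_cons, List.prod_cons, mul_assoc]
      refine (mul_le_mul' le_rfl ih).trans ?_
      rw [← mul_assoc]
      refine (mul_le_mul' (key a) le_rfl).trans ?_
      rw [mul_assoc]
      exact mul_le_mul' le_rfl (hy.negRow_mul_self b)
  exact key' _

theorem negRow_mul_negRow {b b' : Fin (ℓ + 1)} (h : b' < b) :
    negRow K y b * negRow K y b' ≤ negRow K y b' * negRow K y b := by
  have key : ∀ J : List (Fin (ℓ + 1)),
      negRow K y b * (J.map fun a => negSpan K y (a, b')).prod ≤
        negRow K y b' * negRow K y b := by
    intro J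
    induction J with
    | nil =>
      rw [List.map_nil, List.prod_nil, mul_one]
      exact le_mul_of_one_le_left (hy.one_le_negRow b')
    | cons a J ih =>
      rw [List.map_cons, List.prod_cons, ← mul_assoc]
      refine (mul_le_mul' (hy.negRow_mul_negSpan (q := (a, b')) h) le_rfl).trans ?_
      rw [mul_assoc]
      refine (mul_le_mul' (hy.negSpan_le_negRow a b') ih).trans ?_
      rw [← mul_assoc]
      exact mul_le_mul' (hy.negRow_mul_self b') le_rfl
  exact key _

theorem adjoin_le_listProd_negRow :
    (Algebra.adjoin K {x | ∃ p m, x = y p m}).toSubmodule ≤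
      ((List.finRange (ℓ + 1)).map (negRow K y)).prod := by
  set W := ((List.finRange (ℓ + 1)).map (negRow K y)).prod with hW
  have h1 : ∀ b, W * negRow K y b ≤ W := fun b => by
    refine listProd_mul_le ?_ ?_ (List.mem_map.2 ⟨b, List.mem_finRange b, rfl⟩)
    · intro T hT
      obtain ⟨b, -, rfl⟩ := List.mem_map.1 hT
      exact hy.negRow_mul_self b
    · rw [List.pairwise_map]
      exact (List.pairwise_lt_finRange (ℓ + 1)).imp fun h => hy.negRow_mul_negRow h
  have h2 : (1 : A) ∈ W := Submodule.one_le.1 (one_le_listProd fun T hT => by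
    obtain ⟨b, -, rfl⟩ := List.mem_map.1 hT
    exact hy.one_le_negRow b)
  intro x hx
  suffices h : ∀ w ∈ W, w * x ∈ W by simpa using h 1 h2
  replace hx : x ∈ Algebra.adjoin K {x | ∃ p m, x = y p m} := hx
  induction hx using Algebra.adjoin_induction with
  | mem x hx =>
    obtain ⟨⟨s, t⟩, m, rfl⟩ := hx
    exact fun w hw => h1 t (Submodule.mul_mem_mul hw
      (hy.negSpan_le_negRow s t (mem_negSpan (s, t) m)))
  | algebraMap c =>
    intro w hw
    rw [← Algebra.commutes, ← Algebra.smul_def]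
    exact Submodule.smul_mem _ _ hw
  | add x z _ _ hx hz => intro w hw; rw [mul_add]; exact add_mem (hx w hw) (hz w hw)
  | mul x z _ _ hx hz => intro w hw; rw [← mul_assoc]; exact hz _ (hx w hw)

theorem listProd_negSpan_le (L : List (Fin (ℓ + 1) × Fin (ℓ + 1))) (hL : L.Nodup) :
    (L.map (negSpan K y)).prod ≤
      Submodule.span K (Set.range fun M : PosExp ℓ => (L.map fun p => y p (M.1 p)).prod) := by
  induction L with
  | nil =>
    simp only [List.map_nil, List.prod_nil]
    exact Submodule.one_le.2 (Submodule.subset_span ⟨⟨0, by simp⟩, rfl⟩)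
  | cons p L ih =>
    obtain ⟨hp, hL'⟩ := List.nodup_cons.1 hL
    rw [List.map_cons, List.prod_cons]
    refine (mul_le_mul' le_rfl (ih hL')).trans ?_
    rw [negSpan, Submodule.span_mul_span]
    apply Submodule.span_mono
    rintro _ ⟨_, ⟨m, rfl⟩, _, ⟨M, rfl⟩, rfl⟩
    refine ⟨⟨M.1.update p (if p.1 < p.2 then m else 0), fun q hq => ?_⟩, ?_⟩
    · by_cases hqp : q = p
      · subst hqp
        by_contra h
        simp [h] at hq
      · exact M.2 q (by rwa [Finsupp.coe_update, Function.update_of_ne hqp] at hq)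
    · simp only [List.map_cons, List.prod_cons]
      congr 1
      · by_cases h : p.1 < p.2
        · simp [h]
        · rw [hy.eq_one p h, hy.eq_one p h]
      · congr 1
        refine List.map_congr_left fun q hq => ?_
        have hqp : q ≠ p := fun h => hp (h ▸ hq)
        simp [hqp]

/-- Every product of divided powers of negative root vectors is a combination of ordered ones. -/
theorem adjoin_le_span : (Algebra.adjoin K {x | ∃ p m, x = y p m}).toSubmodule ≤
    Submodule.span K (Set.range fun M : PosExp ℓ =>
      ((pairList ℓ).map fun p => y p (M.1 p)).prod) := by
  refine hy.adjoin_le_listProd_negRow.trans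
    (le_of_eq_of_le ?_ (hy.listProd_negSpan_le (pairList ℓ) (pairList_nodup ℓ)))
  rw [pairList, List.map_flatten, List.prod_flatten, List.map_map, List.map_ofFn,
    ← List.ofFn_eq_map]
  congr 2
  funext b
  rw [Function.comp_apply, Function.comp_apply, List.map_ofFn, List.ofFn_eq_map]
  rfl

end NegFamily

end NegFamily

section SpanMinus

variable (K : Type*) [Field K] {ℓ : ℕ}

/-- The factor of `F^{(N)}` that belongs to the pair `p`, with exponent `m`. -/
def negPow (p : Fin (ℓ + 1) × Fin (ℓ + 1)) (m : ℕ) : Hyp K ℓ :=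
  if h : p.1 < p.2 then X K p.2 p.1 h.ne' m else 1

theorem negPow_of_lt {a b : Fin (ℓ + 1)} (h : a < b) (m : ℕ) :
    negPow K (a, b) m = X K b a h.ne' m := dif_pos h

theorem negFamily_negPow : NegFamily K (negPow K (ℓ := ℓ)) where
  zero p := by
    rw [negPow]
    split_ifs
    · exact X_zero K _ _ _
    · rfl
  eq_one p h m := dif_neg h
  mul_self p m k := by
    by_cases h : p.1 < p.2
    · exact ⟨_, by rw [negPow, negPow, negPow, dif_pos h, dif_pos h, dif_pos h, X_mul_X_self]⟩
    · exact ⟨1, by rw [negPow, negPow, negPow, dif_neg h, dif_neg h, dif_neg h, mul_one, one_smul]⟩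
  commute p q h m k := by
    rw [negPow, negPow]
    split_ifs with hp hq
    · exact X_commute K _ _ (h hp hq).1 (h hp hq).2 m k
    · exact Commute.one_right _
    · exact Commute.one_left _
    · exact Commute.one_left _
  heisenberg a b c hc hb m k := by
    refine ⟨fun j => XInt K b a hb.ne' ((m : ℤ) - j), fun j => ?_, ?_⟩
    · dsimp only
      rw [XInt]
      split_ifs
      · exact zero_mem _
      · exact Submodule.subset_span ⟨_, negPow_of_lt K hb _⟩
    · simp only [negPow_of_lt K hb, negPow_of_lt K hc, negPow_of_lt K (hc.trans hb), ← mul_assoc]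
      exact X_mul_X K hb.ne' hc.ne' (hc.trans hb).ne' m k

/-- The matrix of `UT(n)` with given natural exponents. -/
def ofExp (M : PosExp ℓ) : UT (ℓ + 1) :=
  ⟨fun a b => M.1 (a, b), fun a b h => by
    by_contra h'
    exact absurd (M.2 (a, b) fun h0 => h' (congrArg Nat.cast h0)) h.not_gt⟩

theorem ofExp_nonneg (M : PosExp ℓ) (a b : Fin (ℓ + 1)) : 0 ≤ (ofExp M).1 a b :=
  Int.natCast_nonneg _

theorem expo_ofExp (M : PosExp ℓ) : expo (ofExp M) = M.1 := by
  ext p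
  exact Int.toNat_natCast _

theorem F_ofExp (M : PosExp ℓ) :
    F K (ofExp M) = ((pairList ℓ).map fun p => negPow K p (M.1 p)).prod := by
  rw [F_eq_prod]
  rfl

/-- The elements `F^{(N)}` with `N ≥ 0` span `𝒰⁻`. -/
theorem mem_span_of_mem_uMinus {x : Hyp K ℓ} (hx : x ∈ uMinus K ℓ) :
    x ∈ Submodule.span K (Set.range fun M : PosExp ℓ => F K (ofExp M)) := by
  simp only [F_ofExp]
  refine (negFamily_negPow K).adjoin_le_span (Algebra.adjoin_mono ?_ hx)
  rintro _ ⟨s, t, h, m, rfl⟩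
  exact ⟨(s, t), m, (negPow_of_lt K h m).symm⟩

end SpanMinus

/-! ### The triangular basis and the operators `θ_δ` -/

section Triangular

variable (K : Type*) [Field K] {ℓ : ℕ}

/-- Multivariate integer-valued polynomials with coefficients in `K` are determined by their values
at the natural numbers. -/
theorem eq_zero_of_sum_choose (c : (Fin ℓ → ℕ) →₀ K)
    (h : ∀ n : Fin ℓ → ℕ,
      c.sum (fun k a => a * ((∏ l, Ring.choose (n l : ℤ) (k l) : ℤ) : K)) = 0) : c = 0 := by
  by_contra hc
  obtain ⟨k, hk⟩ := Finset.exists_minimal (Finsupp.support_nonempty_iff.2 hc)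
  have h1 := h k
  rw [Finsupp.sum, Finset.sum_eq_single k] at h1
  · simp [Ring.choose_natCast] at h1
    exact Finsupp.mem_support_iff.1 hk.1 h1
  · intro k' hk' hne
    have : ∃ l, k l < k' l := by
      by_contra hle
      push Not at hle
      exact hne (le_antisymm hle (hk.2 hk' hle))
    obtain ⟨l, hl⟩ := this
    rw [Finset.prod_eq_zero (Finset.mem_univ l), Int.cast_zero, mul_zero]
    rw [Ring.choose_natCast, Nat.choose_eq_zero_of_lt hl, Nat.cast_zero]
  · intro h'
    rw [Finsupp.notMem_support_iff.1 h', zero_mul]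

variable (ℓ) in
theorem uZero_induction {p : Hyp K ℓ → Prop} (r : Fin ℓ → ℤ) (h0 : p 0)
    (hadd : ∀ x y, p x → p y → p (x + y)) (hsmul : ∀ (c : K) x, p x → p (c • x))
    (hp : ∀ k, p (prodH K r k)) {x : Hyp K ℓ} (hx : x ∈ uZero K ℓ) : p x := by
  replace hx : x ∈ (uZero K ℓ).toSubmodule := hx
  rw [uZero_eq_span K r] at hx
  induction hx using Submodule.span_induction with
  | mem y hy => obtain ⟨k, rfl⟩ := hy; exact hp k
  | zero => exact h0
  | add y z _ _ hy hz => exact hadd _ _ hy hz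
  | smul c y _ hy => exact hsmul _ _ hy

theorem pairing_mul_eq_zero {μ : Fin ℓ → ℤ} {f : MatPoly ℓ ℤ} (hf : IsWeight μ f) {x : Hyp K ℓ}
    (hx : pairing K f x = 0) {h : Hyp K ℓ} (hh : h ∈ uZero K ℓ) : pairing K f (x * h) = 0 := by
  refine uZero_induction K ℓ 0 (p := fun h => pairing K f (x * h) = 0) (by simp) ?_ ?_ ?_ hh
  · intro y z hy hz
    rw [mul_add, map_add, hy, hz, add_zero]
  · intro c y hy
    rw [mul_smul_comm, map_smul, hy, smul_zero]
  · intro k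
    have := pairing_mul_prod K hf 0 k x
    rw [hx, mul_zero] at this
    exact this

theorem pairing_F_ofExp (M : PosExp ℓ) (f : MatPoly ℓ ℤ) :
    pairing K f (F K (ofExp M)) = ((unipotent ℓ f).coeff M.1 : ℤ) := by
  rw [pairing_F K (ofExp_nonneg M), expo_ofExp]

/-- The functions that restrict to the monomial of `M` on the unitriangular matrices separate the elements
of `𝒰⁰` behind `F^{(M)}`, because there are enough weights among them. -/
theorem eq_zero_of_pairing_F_mul (M : PosExp ℓ) {h : Hyp K ℓ} (hh : h ∈ uZero K ℓ)
    (hf : ∀ (μ : Fin ℓ → ℤ) (f : MatPoly ℓ ℤ), IsInv f → IsWeight μ f →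
      unipotent ℓ f = MvPolynomial.monomial M.1 1 → pairing K f (F K (ofExp M) * h) = 0) :
    h = 0 := by
  obtain ⟨μ, -, hμ⟩ := exists_invariant M.1 M.2
  have hh : h ∈ (uZero K ℓ).toSubmodule := hh
  -- The shift by `-μ` makes the pairings with `f` binomial coefficients of natural numbers.
  rw [uZero_eq_span K (-μ)] at hh
  obtain ⟨c, rfl⟩ := Finsupp.mem_span_range_iff_exists_finsupp.1 hh
  suffices hc : c = 0 by rw [hc, Finsupp.sum_zero_index]
  refine eq_zero_of_sum_choose K c fun n => ?_
  obtain ⟨f, hf1, hf2, hf3⟩ := hμ n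
  have h1 := hf _ f hf1 hf2 hf3
  rw [Finsupp.sum, Finset.mul_sum, map_sum] at h1
  rw [Finsupp.sum, ← h1]
  refine Finset.sum_congr rfl fun k _ => ?_
  have h2 := pairing_mul_prod K hf2 (-μ) k (F K (ofExp M))
  rw [pairing_F_ofExp, hf3, MvPolynomial.coeff_monomial, if_pos rfl, Int.cast_one, mul_one] at h2
  rw [mul_smul_comm, map_smul, smul_eq_mul]
  congr 1
  refine Eq.trans ?_ h2.symm
  simp

/-- The linear map that takes `h ∈ 𝒰⁰` to `F^{(N)} h`. -/
def FMulLin (N : UT (ℓ + 1)) : uZero K ℓ →ₗ[K] uMinusZero K ℓ where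
  toFun := FMul K N
  map_add' _ _ := Subtype.ext (mul_add _ _ _)
  map_smul' _ _ := Subtype.ext (mul_smul_comm _ _ _)

theorem coe_FMulLin (N : UT (ℓ + 1)) (h : uZero K ℓ) :
    (FMulLin K N h : Hyp K ℓ) = F K N * h := rfl

variable (ℓ) in
/-- The linear map that takes a family of elements `h_M ∈ 𝒰⁰` to `∑ F^{(M)} h_M`. -/
def triangular : (PosExp ℓ →₀ uZero K ℓ) →ₗ[K] uMinusZero K ℓ :=
  Finsupp.lsum K fun M => FMulLin K (ofExp M)

theorem triangular_single (M : PosExp ℓ) (h : uZero K ℓ) :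
    triangular K ℓ (Finsupp.single M h) = FMulLin K (ofExp M) h :=
  Finsupp.lsum_single _ _ _ _

theorem coe_triangular (H : PosExp ℓ →₀ uZero K ℓ) :
    (triangular K ℓ H : Hyp K ℓ) = ∑ M ∈ H.support, F K (ofExp M) * (H M : Hyp K ℓ) := by
  rw [triangular, Finsupp.lsum_apply, Finsupp.sum, AddSubmonoidClass.coe_finsetSum]
  rfl

theorem uMinusZero_induction {p : Hyp K ℓ → Prop} (h0 : p 0)
    (hadd : ∀ x y, p x → p y → p (x + y))
    (hp : ∀ (M : PosExp ℓ) (h : Hyp K ℓ), h ∈ uZero K ℓ → p (F K (ofExp M) * h))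
    {x : Hyp K ℓ} (hx : x ∈ uMinusZero K ℓ) : p x := by
  refine Submodule.mul_induction_on hx ?_ hadd
  intro u hu h hh
  replace hu := mem_span_of_mem_uMinus K hu
  have : ∀ h ∈ uZero K ℓ, p (u * h) := by
    induction hu using Submodule.span_induction with
    | mem y hy => obtain ⟨M, rfl⟩ := hy; exact hp M
    | zero => intro h _; rwa [zero_mul]
    | add y z _ _ hy hz => intro h hh; rw [add_mul]; exact hadd _ _ (hy h hh) (hz h hh)
    | smul c y _ hy =>
      intro h hh
      rw [smul_mul_assoc, ← mul_smul_comm]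
      exact hy _ (Subalgebra.smul_mem _ hh c)
  exact this h hh

theorem triangular_surjective : Function.Surjective (triangular K ℓ) := by
  rintro ⟨x, hx⟩
  suffices h : ∃ H, (triangular K ℓ H : Hyp K ℓ) = x by
    obtain ⟨H, hH⟩ := h
    exact ⟨H, Subtype.ext hH⟩
  refine uMinusZero_induction K (p := fun x => ∃ H, (triangular K ℓ H : Hyp K ℓ) = x) ⟨0, ?_⟩ ?_ ?_ hx
  · rw [map_zero]; rfl
  · rintro _ _ ⟨H, rfl⟩ ⟨H', rfl⟩
    exact ⟨H + H', by rw [map_add]; rfl⟩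
  · intro M h hh
    exact ⟨Finsupp.single M ⟨h, hh⟩, by rw [triangular_single]; rfl⟩

theorem eq_zero_of_pairing_triangular (H : PosExp ℓ →₀ uZero K ℓ)
    (hH : ∀ (μ : Fin ℓ → ℤ) (f : MatPoly ℓ ℤ), IsInv f → IsWeight μ f →
      pairing K f (triangular K ℓ H) = 0) : H = 0 := by
  ext1 M
  apply Subtype.ext
  refine eq_zero_of_pairing_F_mul K M (H M).2 fun μ f hf1 hf2 hf3 => ?_
  have h1 := hH μ f hf1 hf2
  rw [coe_triangular, map_sum, Finset.sum_eq_single M] at h1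
  · exact h1
  · intro M' _ hne
    refine pairing_mul_eq_zero K hf2 ?_ (H M').2
    rw [pairing_F_ofExp, hf3, MvPolynomial.coeff_monomial, if_neg fun h => hne (Subtype.ext h.symm),
      Int.cast_zero]
  · intro h
    rw [Finsupp.notMem_support_iff.1 h, ZeroMemClass.coe_zero, mul_zero, map_zero]

/-- The elements of `𝒰^{-,0}` are separated by the pairings with invariant weight functions. -/
theorem uMinusZero_ext {x y : uMinusZero K ℓ} (h : ∀ (μ : Fin ℓ → ℤ) (f : MatPoly ℓ ℤ), IsInv f →
    IsWeight μ f → pairing K f (x : Hyp K ℓ) = pairing K f (y : Hyp K ℓ)) : x = y := by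
  obtain ⟨H, hH⟩ := triangular_surjective K (x - y)
  have : H = 0 := eq_zero_of_pairing_triangular K H fun μ f hf1 hf2 => by
    rw [hH]
    change pairing K f ((x : Hyp K ℓ) - y) = 0
    rw [map_sub, h μ f hf1 hf2, sub_self]
  rw [this, map_zero] at hH
  exact sub_eq_zero.1 hH.symm

/-- This and the following lemma only use the structure of an `AddCommMonoid`, over which linear maps
are defined. -/
theorem add_neg_one_smul_self (R : Type*) {M : Type*} [Ring R] [AddCommMonoid M] [Module R M]
    (x : M) : x + (-1 : R) • x = 0 := by
  nth_rw 1 [← one_smul R x]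
  rw [← add_smul, add_neg_cancel, zero_smul]

theorem eq_of_add_neg_one_smul {R M : Type*} [Ring R] [AddCommMonoid M] [Module R M] {x y : M}
    (h : x + (-1 : R) • y = 0) : x = y := by
  rw [← zero_add y, ← h, add_assoc, add_comm _ y, add_neg_one_smul_self, add_zero]

theorem triangular_injective : Function.Injective (triangular K ℓ) := by
  intro H H' h
  have h1 : H + (-1 : K) • H' = 0 := eq_zero_of_pairing_triangular K _ fun μ f _ _ => by
    have h2 : (triangular K ℓ (H + (-1 : K) • H') : Hyp K ℓ) =
        triangular K ℓ H + (-1 : K) • (triangular K ℓ H' : Hyp K ℓ) := by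
      rw [map_add, map_smul]; rfl
    rw [h2, h]
    exact (congrArg _ (add_neg_one_smul_self K _)).trans (map_zero _)
  ext1 M
  exact Subtype.ext (eq_of_add_neg_one_smul (R := K)
    (congrArg Subtype.val (DFunLike.congr_fun h1 M)))

theorem F_zero : F K (0 : UT (ℓ + 1)) = 1 := by
  rw [F_eq_prod]
  refine List.prod_eq_one fun x hx => ?_
  obtain ⟨p, -, rfl⟩ := List.mem_map.1 hx
  split_ifs with h
  · exact X_zero K _ _ h.ne'
  · rfl

theorem ofExp_zero : ofExp (⟨0, fun _ h => absurd rfl h⟩ : PosExp ℓ) = 0 := rfl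

variable (ℓ) in
/-- The linear map that takes a finitely supported family of scalars `c_k` to
`∑ c_k ∏ H_{α_l,k_l}`. -/
def combProdH : ((Fin ℓ → ℕ) →₀ K) →ₗ[K] uZero K ℓ :=
  Finsupp.lsum K fun k => LinearMap.toSpanSingleton K (uZero K ℓ) ⟨prodH K 0 k, prodH_mem K 0 k⟩

theorem coe_combProdH (c : (Fin ℓ → ℕ) →₀ K) :
    (combProdH K ℓ c : Hyp K ℓ) = ∑ k ∈ c.support, c k • prodH K 0 k := by
  rw [combProdH, Finsupp.lsum_apply, Finsupp.sum, AddSubmonoidClass.coe_finsetSum]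
  rfl

theorem combProdH_single (k : Fin ℓ → ℕ) :
    combProdH K ℓ (Finsupp.single k 1) = ⟨prodH K 0 k, prodH_mem K 0 k⟩ := by
  rw [combProdH, Finsupp.lsum_single, LinearMap.toSpanSingleton_apply_one]

theorem eq_zero_of_combProdH_eq_zero (d : (Fin ℓ → ℕ) →₀ K)
    (h0 : (combProdH K ℓ d : Hyp K ℓ) = 0) : d = 0 := by
  refine eq_zero_of_sum_choose K d fun n => ?_
  obtain ⟨μ, hμ0, hμ⟩ := exists_invariant (ℓ := ℓ) 0 fun _ h => absurd rfl h
  obtain ⟨f, hf1, hf2, hf3⟩ := hμ n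
  rw [hμ0 rfl] at hf2
  have h1 := congrArg (fun x : Hyp K ℓ => pairing K f (F K (0 : UT (ℓ + 1)) * x)) h0
  simp only [mul_zero, map_zero] at h1
  rw [coe_combProdH, Finset.mul_sum, map_sum] at h1
  rw [Finsupp.sum, ← h1]
  refine Finset.sum_congr rfl fun k _ => ?_
  have h2 := pairing_mul_prod K hf2 0 k (F K (0 : UT (ℓ + 1)))
  rw [← ofExp_zero, pairing_F_ofExp, hf3, MvPolynomial.coeff_monomial, if_pos rfl, Int.cast_one,
    mul_one] at h2
  rw [mul_smul_comm, map_smul, smul_eq_mul]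
  congr 1
  refine Eq.trans ?_ h2.symm
  simp

theorem combProdH_injective : Function.Injective (combProdH K ℓ) := by
  intro c c' hcc
  refine eq_of_add_neg_one_smul (R := K) (eq_zero_of_combProdH_eq_zero K _ ?_)
  have h2 : (combProdH K ℓ (c + (-1 : K) • c') : Hyp K ℓ) =
      combProdH K ℓ c + (-1 : K) • (combProdH K ℓ c' : Hyp K ℓ) := by
    rw [map_add, map_smul]; rfl
  rw [h2, hcc]
  exact add_neg_one_smul_self K _

theorem combProdH_surjective : Function.Surjective (combProdH K ℓ) := by
  rintro ⟨x, hx⟩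
  suffices h : ∃ c, (combProdH K ℓ c : Hyp K ℓ) = x by
    obtain ⟨c, hc⟩ := h
    exact ⟨c, Subtype.ext hc⟩
  refine uZero_induction K ℓ 0 (p := fun x => ∃ c, (combProdH K ℓ c : Hyp K ℓ) = x) ⟨0, ?_⟩ ?_ ?_ ?_ hx
  · rw [map_zero]; rfl
  · rintro _ _ ⟨c, rfl⟩ ⟨c', rfl⟩
    exact ⟨c + c', by rw [map_add]; rfl⟩
  · rintro z _ ⟨c, rfl⟩
    exact ⟨z • c, by rw [map_smul]; rfl⟩
  · intro k
    exact ⟨Finsupp.single k 1, by rw [combProdH_single]⟩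

/-- The products of the elements `H_{α_l,k_l}` form a basis of `𝒰⁰`. -/
theorem exists_basis_uZero (ℓ : ℕ) : ∃ b : Module.Basis (Fin ℓ → ℕ) K (uZero K ℓ),
    ∀ k, (b k : Hyp K ℓ) = prodH K 0 k := by
  refine ⟨⟨(LinearEquiv.ofBijective (combProdH K ℓ)
    ⟨combProdH_injective K, combProdH_surjective K⟩).symm⟩, fun k => ?_⟩
  exact congrArg Subtype.val (combProdH_single K k)

/-- The shift of `𝒰⁰` by a weight: it takes `∏ H_{α_l,k_l}` to `∏ binom(H_{α_l} + δ_l, k_l) ⊗ 1`. -/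
def shift (δ : Fin ℓ → ℤ) : uZero K ℓ →ₗ[K] uZero K ℓ :=
  (exists_basis_uZero K ℓ).choose.constr K fun k => ⟨prodH K δ k, prodH_mem K δ k⟩

theorem shift_prodH (δ : Fin ℓ → ℤ) (k : Fin ℓ → ℕ) :
    shift K δ ⟨prodH K 0 k, prodH_mem K 0 k⟩ = ⟨prodH K δ k, prodH_mem K δ k⟩ := by
  have h := (exists_basis_uZero K ℓ).choose_spec k
  rw [show (⟨prodH K 0 k, prodH_mem K 0 k⟩ : uZero K ℓ) =
    (exists_basis_uZero K ℓ).choose k from Subtype.ext h.symm, shift, Module.Basis.constr_basis]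

theorem FMulLin_eq_zero {N : UT (ℓ + 1)} {a b : Fin (ℓ + 1)} (h : N.1 a b < 0) :
    FMulLin K N = 0 :=
  LinearMap.ext fun x => Subtype.ext (by rw [coe_FMulLin, F_eq_zero K h, zero_mul]; rfl)

theorem exists_ofExp_eq {N : UT (ℓ + 1)} (hN : ∀ a b, 0 ≤ N.1 a b) : ∃ M : PosExp ℓ, ofExp M = N := by
  refine ⟨⟨expo N, fun p hp => ?_⟩, Subtype.ext (funext fun a => funext fun b =>
    Int.toNat_of_nonneg (hN a b))⟩
  by_contra h
  exact hp (by rw [expo_apply, N.2 _ _ (not_lt.1 h)]; rfl)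

theorem exists_conj_of_bijective {R M N : Type*} [Semiring R] [AddCommMonoid M] [AddCommMonoid N]
    [Module R M] [Module R N] (e : M →ₗ[R] N) (he : Function.Bijective e) (T : M →ₗ[R] M) :
    ∃ f : N →ₗ[R] N, ∀ m, f (e m) = e (T m) := by
  refine ⟨(e ∘ₗ T) ∘ₗ (LinearEquiv.ofBijective e he).symm.toLinearMap, fun m => ?_⟩
  have h : (LinearEquiv.ofBijective e he).symm (e m) = m :=
    (LinearEquiv.ofBijective e he).symm_apply_apply m
  simp [h]

theorem exists_theta (δ : Fin ℓ → ℤ) : ∃ f : Module.End K (uMinusZero K ℓ),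
    ∀ (N : UT (ℓ + 1)) (h : uZero K ℓ), f (FMulLin K N h) = FMulLin K N (shift K δ h) := by
  obtain ⟨f, hf⟩ := exists_conj_of_bijective (triangular K ℓ)
    ⟨triangular_injective K, triangular_surjective K⟩ (Finsupp.mapRange.linearMap (shift K δ))
  refine ⟨f, fun N h => ?_⟩
  by_cases hN : ∀ a b, 0 ≤ N.1 a b
  · obtain ⟨M, rfl⟩ := exists_ofExp_eq hN
    have h1 := hf (Finsupp.single M h)
    exact (congrArg f (triangular_single K M h).symm).trans (h1.trans
      ((congrArg (triangular K ℓ) (Finsupp.mapRange_single (hf := map_zero (shift K δ)))).trans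
        (triangular_single K M _)))
  · push Not at hN
    obtain ⟨a, b, hab⟩ := hN
    rw [FMulLin_eq_zero K hab, LinearMap.zero_apply, LinearMap.zero_apply, map_zero]

/-- The operator `θ_δ` shifts the factor in `𝒰⁰`. -/
theorem theta_FMulLin (δ : Fin ℓ → ℤ) (N : UT (ℓ + 1)) (h : uZero K ℓ) :
    theta K δ (FMulLin K N h) = FMulLin K N (shift K δ h) := by
  have hex : ∃ f : Module.End K (uMinusZero K ℓ),
      ∀ (N : UT (ℓ + 1)) (k : Fin ℓ → ℕ) (P : uMinusZero K ℓ),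
        (P : Hyp K ℓ) = F K N * (List.ofFn fun l => HBinom K l 0 (k l)).prod →
        (f P : Hyp K ℓ) = F K N * (List.ofFn fun l => HBinom K l (δ l) (k l)).prod := by
    obtain ⟨f, hf⟩ := exists_theta K δ
    refine ⟨f, fun N k P hP => ?_⟩
    rw [show P = FMulLin K N ⟨prodH K 0 k, prodH_mem K 0 k⟩ from Subtype.ext hP, hf, shift_prodH]
    rfl
  have hspec := Classical.epsilon_spec hex
  obtain ⟨b, hb⟩ := exists_basis_uZero K ℓ
  have : theta K δ ∘ₗ FMulLin K N = FMulLin K N ∘ₗ shift K δ := by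
    refine b.ext fun k => ?_
    rw [show b k = ⟨prodH K 0 k, prodH_mem K 0 k⟩ from Subtype.ext (hb k), LinearMap.comp_apply,
      LinearMap.comp_apply, shift_prodH]
    exact Subtype.ext (hspec N k _ rfl)
  exact LinearMap.congr_fun this h

theorem zeroIncl_eq (h : uZero K ℓ) : zeroIncl K h = FMulLin K 0 h :=
  Subtype.ext (by rw [coe_FMulLin, F_zero, one_mul]; rfl)

theorem coe_theta_zeroIncl (δ : Fin ℓ → ℤ) (h : uZero K ℓ) :
    (theta K δ (zeroIncl K h) : Hyp K ℓ) = shift K δ h := by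
  rw [zeroIncl_eq, theta_FMulLin, coe_FMulLin, F_zero, one_mul]

/-- If `g` has weight `δ`, the pairing of `g f` with `F^{(N)} h` is determined by its values for
`h = 1` and by the shift of `h` by `δ`. -/
theorem pairing_mul_shift {μ δ : Fin ℓ → ℤ} {f g : MatPoly ℓ ℤ} (hf : IsWeight μ f)
    (hg : IsWeight δ g) {x : Hyp K ℓ} {J : Type*} (s : Finset J) (c : J → ℤ) (y : J → Hyp K ℓ)
    (hxy : pairing K (g * f) x = ∑ j ∈ s, (c j : K) * pairing K f (y j)) (h : uZero K ℓ) :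
    pairing K (g * f) (x * (h : Hyp K ℓ)) =
      ∑ j ∈ s, (c j : K) * pairing K f (y j * (shift K δ h : Hyp K ℓ)) := by
  obtain ⟨b, hb⟩ := exists_basis_uZero K ℓ
  have hsum : ∀ z : Hyp K ℓ, (∑ j ∈ s, (c j : K) • pairing K f ∘ₗ LinearMap.mulLeft K (y j)) z =
      ∑ j ∈ s, (c j : K) * pairing K f (y j * z) := fun z => by
    rw [LinearMap.sum_apply]; rfl
  have key : (pairing K (g * f) ∘ₗ LinearMap.mulLeft K x) ∘ₗ (uZero K ℓ).val.toLinearMap =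
      ((∑ j ∈ s, (c j : K) • pairing K f ∘ₗ LinearMap.mulLeft K (y j)) ∘ₗ
        (uZero K ℓ).val.toLinearMap) ∘ₗ shift K δ := by
    refine b.ext fun k => ?_
    rw [show b k = ⟨prodH K 0 k, prodH_mem K 0 k⟩ from Subtype.ext (hb k)]
    refine Eq.trans ?_ (congrArg (fun z : uZero K ℓ =>
      (∑ j ∈ s, (c j : K) • pairing K f ∘ₗ LinearMap.mulLeft K (y j)) (z : Hyp K ℓ))
      (shift_prodH K δ k).symm)
    refine Eq.trans ?_ (hsum _).symm
    have h1 := pairing_mul_prod K (hg.mul hf) 0 k x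
    rw [hxy, Finset.mul_sum] at h1
    refine h1.trans (Finset.sum_congr rfl fun j _ => ?_)
    have h2 := pairing_mul_prod K hf δ k (y j)
    refine Eq.trans ?_ (congrArg ((c j : K) * ·) h2.symm)
    simp only [Pi.zero_apply, add_zero, Pi.add_apply]
    rw [show (∏ l, Ring.choose (δ l + μ l) (k l)) = ∏ l, Ring.choose (μ l + δ l) (k l) by
      simp only [add_comm]]
    ring
  exact (LinearMap.congr_fun key h).trans (hsum _)

end Triangular

/-! ### The transposes of the operators `θ_{ω_i}`, `η_{α_l}` and of their commutators -/

section Transpose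

variable (K : Type*) [Field K] {ℓ : ℕ}

/-- The transpose of `θ_{ω_i}` is the multiplication by the principal minor of size `i`. -/
theorem pairing_theta (i : Fin ℓ) {μ : Fin ℓ → ℤ} {f : MatPoly ℓ ℤ} (hf : IsWeight μ f)
    (P : uMinusZero K ℓ) : pairing K f (theta K (fundWeight i) P : Hyp K ℓ) =
      pairing K (minor i.castSucc id * f) (P : Hyp K ℓ) := by
  obtain ⟨H, rfl⟩ := triangular_surjective K P
  have key : ((pairing K f ∘ₗ (uMinusZero K ℓ).subtype) ∘ₗ theta K (fundWeight i)) ∘ₗ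
      triangular K ℓ = (pairing K (minor i.castSucc id * f) ∘ₗ (uMinusZero K ℓ).subtype) ∘ₗ
        triangular K ℓ := by
    refine Finsupp.lhom_ext fun M h => ?_
    change pairing K f (theta K (fundWeight i) (triangular K ℓ (Finsupp.single M h)) : Hyp K ℓ) =
      pairing K (minor i.castSucc id * f) (triangular K ℓ (Finsupp.single M h) : Hyp K ℓ)
    rw [triangular_single, theta_FMulLin, coe_FMulLin, coe_FMulLin]
    have h1 := pairing_mul_shift K hf (minor_isWeight i id) (x := F K (ofExp M))
      {()} (fun _ => 1) (fun _ => F K (ofExp M)) (by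
        rw [Finset.sum_singleton, Int.cast_one, one_mul, pairing_F_ofExp, pairing_F_ofExp, map_mul]
        have h2 := unipotent_minor (le_refl i.castSucc)
        rw [if_pos rfl, update_id_self] at h2
        rw [h2, one_mul]) h
    rw [h1, Finset.sum_singleton, Int.cast_one, one_mul]
  exact LinearMap.congr_fun key H

theorem exists_mul_X_eq {h : Hyp K ℓ} (hh : h ∈ uZero K ℓ) {s t : Fin (ℓ + 1)} (hst : s ≠ t)
    (m : ℕ) : ∃ h' ∈ uZero K ℓ, h * X K s t hst m = X K s t hst m * h' := by
  induction hh using Algebra.adjoin_induction with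
  | mem x hx =>
    obtain ⟨l, k, rfl⟩ := hx
    exact ⟨_, HBinom_mem K l _ k, HBinom_mul_X K l 0 k hst m⟩
  | algebraMap r => exact ⟨_, Subalgebra.algebraMap_mem _ r, Algebra.commutes r _⟩
  | add x y _ _ hx hy =>
    obtain ⟨x', hx', hx⟩ := hx
    obtain ⟨y', hy', hy⟩ := hy
    exact ⟨x' + y', add_mem hx' hy', by rw [add_mul, mul_add, hx, hy]⟩
  | mul x y _ _ hx hy =>
    obtain ⟨x', hx', hx⟩ := hx
    obtain ⟨y', hy', hy⟩ := hy
    exact ⟨x' * y', mul_mem hx' hy', by rw [mul_assoc, hy, ← mul_assoc, hx, mul_assoc]⟩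

theorem exists_X_mul_eq {h : Hyp K ℓ} (hh : h ∈ uZero K ℓ) {s t : Fin (ℓ + 1)} (hst : s ≠ t)
    (m : ℕ) : ∃ h' ∈ uZero K ℓ, X K s t hst m * h = h' * X K s t hst m := by
  induction hh using Algebra.adjoin_induction with
  | mem x hx =>
    obtain ⟨l, k, rfl⟩ := hx
    refine ⟨_, HBinom_mem K l (-(m * (rowWeight s l - rowWeight t l))) k, ?_⟩
    rw [HBinom_mul_X, neg_add_cancel]
  | algebraMap r => exact ⟨_, Subalgebra.algebraMap_mem _ r, (Algebra.commutes r _).symm⟩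
  | add x y _ _ hx hy =>
    obtain ⟨x', hx', hx⟩ := hx
    obtain ⟨y', hy', hy⟩ := hy
    exact ⟨x' + y', add_mem hx' hy', by rw [add_mul, mul_add, hx, hy]⟩
  | mul x y _ _ hx hy =>
    obtain ⟨x', hx', hx⟩ := hx
    obtain ⟨y', hy', hy⟩ := hy
    exact ⟨x' * y', mul_mem hx' hy', by rw [← mul_assoc, hx, mul_assoc, hy, mul_assoc]⟩

variable {K}

theorem mul_mem_uMinusZero {u h : Hyp K ℓ} (hu : u ∈ uMinus K ℓ) (hh : h ∈ uZero K ℓ) :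
    u * h ∈ uMinusZero K ℓ := Submodule.mul_mem_mul hu hh

theorem uMinus_mul_mem {u x : Hyp K ℓ} (hu : u ∈ uMinus K ℓ) (hx : x ∈ uMinusZero K ℓ) :
    u * x ∈ uMinusZero K ℓ := by
  refine Submodule.mul_induction_on hx (fun v hv h hh => ?_) fun y z hy hz => ?_
  · rw [← mul_assoc]
    exact mul_mem_uMinusZero (mul_mem hu hv) hh
  · rw [mul_add]
    exact add_mem hy hz

theorem mul_uZero_mem {x h : Hyp K ℓ} (hx : x ∈ uMinusZero K ℓ) (hh : h ∈ uZero K ℓ) :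
    x * h ∈ uMinusZero K ℓ := by
  refine Submodule.mul_induction_on hx (fun v hv h' hh' => ?_) fun y z hy hz => ?_
  · rw [mul_assoc]
    exact mul_mem_uMinusZero hv (mul_mem hh' hh)
  · rw [add_mul]
    exact add_mem hy hz

theorem uZero_mul_uMinus_mem {u : Hyp K ℓ} (hu : u ∈ uMinus K ℓ) :
    ∀ h ∈ uZero K ℓ, h * u ∈ uMinusZero K ℓ := by
  induction hu using Algebra.adjoin_induction with
  | mem x hx =>
    obtain ⟨s, t, hst, m, rfl⟩ := hx
    intro h hh
    obtain ⟨h', hh', he⟩ := exists_mul_X_eq K hh hst.ne' m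
    rw [he]
    exact mul_mem_uMinusZero (Algebra.subset_adjoin ⟨s, t, hst, m, rfl⟩) hh'
  | algebraMap r =>
    intro h hh
    rw [← Algebra.commutes]
    exact mul_mem_uMinusZero (Subalgebra.algebraMap_mem _ r) hh
  | add x y _ _ hx hy =>
    intro h hh
    rw [mul_add]
    exact add_mem (hx h hh) (hy h hh)
  | mul x y _ _ hx hy =>
    intro h hh
    rw [← mul_assoc]
    refine Submodule.mul_induction_on (hx h hh) (fun v hv h' hh' => ?_) fun z z' hz hz' => ?_
    · rw [mul_assoc]
      exact uMinus_mul_mem hv (hy h' hh')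
    · rw [add_mul]
      exact add_mem hz hz'

theorem mul_uMinus_mem {x u : Hyp K ℓ} (hx : x ∈ uMinusZero K ℓ) (hu : u ∈ uMinus K ℓ) :
    x * u ∈ uMinusZero K ℓ := by
  refine Submodule.mul_induction_on hx (fun v hv h hh => ?_) fun y z hy hz => ?_
  · rw [mul_assoc]
    exact uMinus_mul_mem hv (uZero_mul_uMinus_mem hu h hh)
  · rw [add_mul]
    exact add_mem hy hz

theorem uMinus_le_uMinusZero {u : Hyp K ℓ} (hu : u ∈ uMinus K ℓ) : u ∈ uMinusZero K ℓ := by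
  rw [← mul_one u]
  exact mul_mem_uMinusZero hu (one_mem _)

theorem toHyp_rootVec (s t : Fin (ℓ + 1)) (h : s ≠ t) (hz : rootVec s t h ∈ kostantForm ℓ) :
    toHyp K ℓ ⟨rootVec s t h, hz⟩ = X K s t h 1 := by
  rw [X_eq]
  congr 1
  exact Subtype.ext (by simp [divPow])

variable (K) in
/-- The commutator of `E_{l,l+1}` with a divided power of a negative root vector lies in `𝒰^{-,0}`. -/
theorem commutator_X_mem (l : Fin ℓ) {s t : Fin (ℓ + 1)} (hst : s < t) (m : ℕ) :
    X K l.castSucc l.succ l.castSucc_lt_succ.ne 1 * X K t s hst.ne' m -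
      X K t s hst.ne' m * X K l.castSucc l.succ l.castSucc_lt_succ.ne 1 ∈ uMinusZero K ℓ := by
  have hX : ∀ {s t : Fin (ℓ + 1)} (h : s < t) (m : ℕ), X K t s h.ne' m ∈ uMinus K ℓ :=
    fun h m => Algebra.subset_adjoin ⟨_, _, h, m, rfl⟩
  have hR : ∀ (s t : Fin (ℓ + 1)) (h : s ≠ t), rootVec s t h ∈ kostantForm ℓ := fun s t h => by
    have := divPow_mem s t h 1
    rwa [divPow, Nat.factorial_one, Nat.cast_one, inv_one, one_smul, pow_one] at this
  have hl := l.castSucc_lt_succ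
  cases m with
  | zero =>
    rw [X_zero, mul_one, one_mul, sub_self]
    exact zero_mem _
  | succ m =>
    by_cases h1 : t = l.succ
    · subst h1
      by_cases h2 : s = l.castSucc
      · subst h2
        rw [X_one_mul_X_neg, add_sub_cancel_left]
        exact mul_mem_uMinusZero (hX hl m) (HBinom_mem K _ _ _)
      · have hlt : s < l.castSucc := by
          refine lt_of_le_of_ne ?_ h2
          rw [Fin.lt_def, Fin.val_succ] at hst
          rw [Fin.le_def, Fin.val_castSucc]
          omega
        have hz := rootVec_mul_rootVec hl.ne hst.ne' hlt.ne'
        rw [X_one_mul_X K hst.ne' (z := ⟨rootVec l.castSucc s hlt.ne', hR _ _ _⟩) hz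
          (commute_rootVec _ _ hst.ne hlt.ne) m, add_sub_cancel_left, toHyp_rootVec]
        exact uMinus_le_uMinusZero (mul_mem (hX hst m) (hX hlt 1))
    · by_cases h2 : s = l.castSucc
      · subst h2
        have hlt : l.succ < t := by
          refine lt_of_le_of_ne ?_ (Ne.symm h1)
          rw [Fin.lt_def, Fin.val_castSucc] at hst
          rw [Fin.le_def, Fin.val_succ]
          omega
        have hz := rootVec_mul_rootVec_neg t hl.ne hst.ne' hlt.ne'
        rw [X_one_mul_X K hst.ne' (z := -⟨rootVec t l.succ hlt.ne', hR _ _ _⟩) hz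
          (Commute.neg_left (commute_rootVec _ _ hlt.ne hst.ne)) m, add_sub_cancel_left, map_neg,
          toHyp_rootVec]
        exact uMinus_le_uMinusZero (mul_mem (hX hst m) (neg_mem (hX hlt 1)))
      · have hc := X_commute K hl.ne hst.ne' (Ne.symm h1) h2 1 (m + 1)
        rw [hc.eq, sub_self]
        exact zero_mem _

theorem commutator_uMinus_mem (l : Fin ℓ) {u : Hyp K ℓ} (hu : u ∈ uMinus K ℓ) :
    X K l.castSucc l.succ l.castSucc_lt_succ.ne 1 * u -
      u * X K l.castSucc l.succ l.castSucc_lt_succ.ne 1 ∈ uMinusZero K ℓ := by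
  generalize hE : X K l.castSucc l.succ l.castSucc_lt_succ.ne 1 = E
  induction hu using Algebra.adjoin_induction with
  | mem x hx =>
    obtain ⟨s, t, hst, m, rfl⟩ := hx
    rw [← hE]
    exact commutator_X_mem K l hst m
  | algebraMap r =>
    rw [Algebra.commutes, sub_self]
    exact zero_mem _
  | add x y _ _ hx hy =>
    rw [mul_add, add_mul, add_sub_add_comm]
    exact add_mem hx hy
  | mul x y hx' hy' hx hy =>
    have : E * (x * y) - x * y * E = (E * x - x * E) * y + x * (E * y - y * E) := by
      rw [sub_mul, mul_sub, mul_assoc, mul_assoc, mul_assoc]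
      abel
    rw [this]
    exact add_mem (mul_uMinus_mem hx hy') (uMinus_mul_mem hx' hy)

/-- For `x = u h`, a remainder is `[E_{l,l+1}, u] h`, since `u E_{l,l+1} h = u h' E_{l,l+1}` for some
`h' ∈ 𝒰⁰`. -/
theorem exists_sub_mem_posLeftIdeal (l : Fin ℓ) {x : Hyp K ℓ} (hx : x ∈ uMinusZero K ℓ) :
    ∃ Q : uMinusZero K ℓ, X K l.castSucc l.succ l.castSucc_lt_succ.ne 1 * x - (Q : Hyp K ℓ) ∈
      posLeftIdeal K ℓ := by
  refine Submodule.mul_induction_on hx (fun u hu h hh => ?_) fun y z hy hz => ?_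
  · refine ⟨⟨_, mul_uZero_mem (commutator_uMinus_mem l hu) hh⟩, ?_⟩
    obtain ⟨h', -, he⟩ := exists_X_mul_eq K hh l.castSucc_lt_succ.ne 1
    change X K l.castSucc l.succ l.castSucc_lt_succ.ne 1 * (u * h) -
      (X K l.castSucc l.succ l.castSucc_lt_succ.ne 1 * u -
        u * X K l.castSucc l.succ l.castSucc_lt_succ.ne 1) * h ∈ posLeftIdeal K ℓ
    rw [sub_mul, mul_assoc, sub_sub_cancel, mul_assoc, he, ← mul_assoc]
    exact Ideal.mul_mem_left _ _ (Ideal.subset_span ⟨_, _, l.castSucc_lt_succ, 1, one_pos, rfl⟩)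
  · obtain ⟨Q, hQ⟩ := hy
    obtain ⟨Q', hQ'⟩ := hz
    refine ⟨Q + Q', ?_⟩
    have := add_mem hQ hQ'
    rw [← add_sub_add_comm, ← mul_add] at this
    exact this

theorem pairing_eq_of_sub_mem (l : Fin ℓ) {f : MatPoly ℓ ℤ} (hf : IsInv f) {x y : Hyp K ℓ}
    (h : X K l.castSucc l.succ l.castSucc_lt_succ.ne 1 * x - y ∈ posLeftIdeal K ℓ) :
    pairing K f y = pairing K (colDer l f) x := by
  have h1 := pairing_posLeftIdeal K hf h
  rw [map_sub, pairing_X_mul] at h1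
  exact (sub_eq_zero.1 h1).symm

variable (K) in
theorem exists_eta (l : Fin ℓ) : ∃ f : Module.End K (uMinusZero K ℓ), ∀ P : uMinusZero K ℓ,
    X K l.castSucc l.succ l.castSucc_lt_succ.ne 1 * (P : Hyp K ℓ) - (f P : Hyp K ℓ) ∈
      posLeftIdeal K ℓ := by
  choose Q hQ using fun P : uMinusZero K ℓ => exists_sub_mem_posLeftIdeal l P.2
  refine ⟨⟨⟨Q, fun P P' => ?_⟩, fun c P => ?_⟩, hQ⟩
  · refine uMinusZero_ext K fun μ f hf _ => ?_
    refine Eq.trans ?_ (map_add (pairing K f) (Q P : Hyp K ℓ) (Q P')).symm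
    rw [pairing_eq_of_sub_mem l hf (hQ _), pairing_eq_of_sub_mem l hf (hQ P),
      pairing_eq_of_sub_mem l hf (hQ P')]
    exact map_add (pairing K _) (P : Hyp K ℓ) P'
  · refine uMinusZero_ext K fun μ f hf _ => ?_
    refine Eq.trans ?_ (map_smul (pairing K f) c (Q P : Hyp K ℓ)).symm
    rw [pairing_eq_of_sub_mem l hf (hQ _), pairing_eq_of_sub_mem l hf (hQ P)]
    exact map_smul (pairing K _) c (P : Hyp K ℓ)

/-- The transpose of `η_{α_l}` is the column derivation. -/
theorem pairing_etaSimple (l : Fin ℓ) {f : MatPoly ℓ ℤ} (hf : IsInv f) (P : uMinusZero K ℓ) :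
    pairing K f (etaSimple K l P : Hyp K ℓ) = pairing K (colDer l f) (P : Hyp K ℓ) :=
  pairing_eq_of_sub_mem l hf (Classical.epsilon_spec (exists_eta K l) P)

/-- The function by which the transpose of `⟦i_1, …, i_k⟧_i` multiplies. -/
def bracketFun (i : Fin ℓ) : List (Fin ℓ) → MatPoly ℓ ℤ
  | [] => minor i.castSucc id
  | l :: w => -colDer l (bracketFun i w)

theorem bracketFun_isInv (i : Fin ℓ) (w : List (Fin ℓ)) : IsInv (bracketFun i w) := by
  induction w with
  | nil => exact minor_isInv _ _
  | cons l w ih =>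
    rw [bracketFun, ← neg_one_zsmul]
    exact (ih.colDer l).smul _

theorem bracketFun_isWeight (i : Fin ℓ) (w : List (Fin ℓ)) :
    IsWeight (fundWeight i) (bracketFun i w) := by
  induction w with
  | nil => exact minor_isWeight _ _
  | cons l w ih =>
    rw [bracketFun, ← neg_one_zsmul]
    exact (ih.colDer l).smul _

/-- The transpose of a commutator with `η_{α_l}` is a multiplication by the Leibniz rule. -/
theorem pairing_bracket (i : Fin ℓ) (w : List (Fin ℓ)) {μ : Fin ℓ → ℤ} {f : MatPoly ℓ ℤ}
    (hf : IsInv f) (hf' : IsWeight μ f) (P : uMinusZero K ℓ) :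
    pairing K f (bracket K i w P : Hyp K ℓ) =
      pairing K (bracketFun i w * f) (P : Hyp K ℓ) := by
  induction w generalizing μ f P with
  | nil => exact pairing_theta K i hf' P
  | cons l w ih =>
    have h1 : pairing K f (bracket K i (l :: w) P : Hyp K ℓ) =
        pairing K f (etaSimple K l (bracket K i w P) : Hyp K ℓ) -
          pairing K f (bracket K i w (etaSimple K l P) : Hyp K ℓ) :=
      map_sub (pairing K f) _ _
    rw [h1, pairing_etaSimple l hf, ih (hf.colDer l) (hf'.colDer l), ih hf hf',
      pairing_etaSimple l ((bracketFun_isInv i w).mul hf), Derivation.leibniz, bracketFun,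
      smul_eq_mul, smul_eq_mul, pairing_add, sub_add_cancel_left, neg_mul, mul_comm f,
      ← neg_one_zsmul (colDer l (bracketFun i w) * f), pairing_smul, Int.cast_neg, Int.cast_one,
      neg_one_mul]

theorem bracket_eq_of_bracketFun_eq {i : Fin ℓ} {w w' : List (Fin ℓ)}
    (h : bracketFun i w = bracketFun i w') : bracket K i w = bracket K i w' :=
  LinearMap.ext fun P => uMinusZero_ext K fun μ f hf hf' => by
    rw [pairing_bracket i w hf hf', pairing_bracket i w' hf hf', h]

end Transpose

/-! ### The column derivations of a word acting on the principal minor -/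

section Words

variable {ℓ : ℕ}

theorem bracketFun_cons_minor {i l : Fin ℓ} {w : List (Fin ℓ)} {z : ℤ}
    {c : Fin (ℓ + 1) → Fin (ℓ + 1)} {r₀ : Fin (ℓ + 1)}
    (hw : bracketFun i w = z • minor i.castSucc c) (h₀ : r₀ ≤ i.castSucc)
    (hc : ∀ r ≤ i.castSucc, c r = l.castSucc ↔ r = r₀) :
    bracketFun i (l :: w) = (-z) • minor i.castSucc (Function.update c r₀ l.succ) := by
  rw [bracketFun, hw, map_zsmul, colDer_minor h₀ l hc, neg_smul]

/-- The letters `a, …, i - 1` move the hole in the set of columns, which is `i` after the first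
letter, down to `a`, and the letters `b - 1, …, i + 1` move the additional column up to `b`. -/
theorem bracketFun_shuffle {i : Fin ℓ} {rest : List (Fin ℓ)} {z : ℤ}
    {d : Fin (ℓ + 1) → Fin (ℓ + 1)} (hrest : bracketFun i rest = z • minor i.castSucc d)
    (w : List (Fin ℓ)) (h t : Fin (ℓ + 1)) (hi : h ≤ i.castSucc) (hit : i.castSucc < t)
    (hw : SatisfiesO h i ((t : ℕ) - 1) (w.map Fin.val))
    (hd : ∀ r ≤ i.castSucc, (h ≤ r → d r = r) ∧ (r < h → d r < h ∨ t < d r)) :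
    bracketFun i (w ++ i :: rest) =
      ((-1) ^ ((t : ℕ) - i) * z) • minor i.castSucc (Function.update d h t) := by
  induction w generalizing h t with
  | nil =>
    rw [List.map_nil, SatisfiesO] at hw
    generalize hu : List.range' (h : ℕ) (i - h) = u at hw
    generalize hv : (List.range' ((i : ℕ) + 1) ((t : ℕ) - 1 - i)).reverse = v at hw
    cases hw
    rw [List.range'_eq_nil_iff] at hu
    rw [List.reverse_eq_nil_iff, List.range'_eq_nil_iff] at hv
    have hi' : (h : ℕ) ≤ i := hi
    have hit' : (i : ℕ) < t := hit
    obtain rfl : h = i.castSucc := Fin.ext (by rw [Fin.val_castSucc]; omega)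
    obtain rfl : t = i.succ := Fin.ext (by rw [Fin.val_succ]; omega)
    rw [List.nil_append, bracketFun_cons_minor hrest le_rfl, Fin.val_succ, Nat.add_sub_cancel_left,
      pow_one, neg_one_mul]
    intro r hr
    refine ⟨fun hr' => ?_, fun hr' => by rw [hr', (hd _ le_rfl).1 le_rfl]⟩
    rcases lt_or_ge r i.castSucc with hlt | hge
    · rcases (hd r hr).2 hlt with h' | h'
      · exact absurd hr' h'.ne
      · exact absurd hr' (hit.trans h').ne'
    · exact le_antisymm hr hge
  | cons l w ih =>
    rw [List.map_cons, SatisfiesO] at hw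
    generalize hu : List.range' (h : ℕ) (i - h) = u at hw
    generalize hv : (List.range' ((i : ℕ) + 1) ((t : ℕ) - 1 - i)).reverse = v at hw
    have hi' : (h : ℕ) ≤ i := hi
    have hit' : (i : ℕ) < t := hit
    cases hw with
    | @left u _ _ _ hw =>
      have hlt : (h : ℕ) < i := by
        by_contra hlt
        rw [Nat.sub_eq_zero_of_le (not_lt.1 hlt), List.range'_zero] at hu
        exact List.cons_ne_nil _ _ hu.symm
      rw [show (i : ℕ) - h = (i - (h + 1)) + 1 by omega, List.range'_succ, List.cons.injEq] at hu
      obtain rfl : h = l.castSucc := Fin.ext hu.1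
      have hle : l.succ ≤ i.castSucc := Fin.le_def.2 hlt
      have hll : l.castSucc < l.succ := l.castSucc_lt_succ
      have ih := ih l.succ t hle hit (by
        rw [SatisfiesO, hv, Fin.val_succ]
        have := hu.2
        rw [Fin.val_castSucc] at this
        rw [this]
        exact hw) fun r hr => ⟨fun h' => (hd r hr).1 (hll.le.trans h'), fun h' => by
          rcases lt_or_ge r l.castSucc with h1 | h1
          · exact ((hd r hr).2 h1).imp_left fun h2 => h2.trans hll
          · rw [(hd r hr).1 h1]
            exact Or.inl h'⟩
      have htl : t ≠ l.castSucc := (hi.trans_lt hit).ne'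
      rw [List.cons_append, bracketFun_cons_minor ih hi]
      · rw [minor_exchange (c := Function.update d l.castSucc t) hi hle hll.ne, neg_smul_neg]
        · rw [Function.update_self, Function.update_of_ne hll.ne', (hd _ hle).1 hll.le]
        · rw [Function.update_of_ne hll.ne', Function.update_self, Function.update_self]
        · intro r h1 h2
          rw [Function.update_of_ne h1, Function.update_of_ne h2, Function.update_of_ne h1]
      · intro r hr
        by_cases h2 : r = l.succ
        · subst h2
          rw [Function.update_self]
          exact ⟨fun h' => absurd h' htl, fun h' => absurd h' hll.ne'⟩
        · rw [Function.update_of_ne h2]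
          rcases lt_or_ge r l.castSucc with h1 | h1
          · refine ⟨fun h' => ?_, fun h' => absurd h' h1.ne⟩
            rcases (hd r hr).2 h1 with h3 | h3
            · exact absurd h' h3.ne
            · exact absurd h' ((hi.trans_lt hit).trans h3).ne'
          · rw [(hd r hr).1 h1]
    | @right _ v _ _ hw =>
      have hlt : (i : ℕ) + 1 < t := by
        by_contra hlt
        rw [show (t : ℕ) - 1 - i = 0 by omega, List.range'_zero, List.reverse_nil] at hv
        exact List.cons_ne_nil _ _ hv.symm
      rw [show (t : ℕ) - 1 - i = (t - 1 - 1 - i) + 1 by omega, List.range'_concat,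
        List.reverse_concat', List.cons.injEq] at hv
      obtain rfl : t = l.succ := Fin.ext (by rw [Fin.val_succ]; have := hv.1; omega)
      have hll : l.castSucc < l.succ := l.castSucc_lt_succ
      have hil : i.castSucc < l.castSucc := by
        rw [Fin.lt_def, Fin.val_castSucc, Fin.val_castSucc]
        rw [Fin.val_succ] at hlt
        omega
      have ih := ih h l.castSucc hi hil (by
        rw [SatisfiesO, hu, Fin.val_castSucc]
        have := hv.2
        rw [Fin.val_succ, Nat.add_sub_cancel] at this
        rw [this]
        exact hw) fun r hr => ⟨(hd r hr).1, fun h' => ((hd r hr).2 h').imp_right fun h2 => hll.trans h2⟩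
      rw [List.cons_append, bracketFun_cons_minor ih hi]
      · rw [Function.update_idem, Fin.val_succ, Fin.val_castSucc]
        rw [Fin.lt_def, Fin.val_castSucc, Fin.val_castSucc] at hil
        rw [show (l : ℕ) + 1 - i = (l - i) + 1 by omega, pow_succ, mul_neg_one, neg_mul]
      · intro r hr
        by_cases h2 : r = h
        · subst h2
          rw [Function.update_self]
          exact ⟨fun _ => rfl, fun _ => rfl⟩
        · rw [Function.update_of_ne h2]
          refine ⟨fun h' => ?_, fun h' => absurd h' h2⟩
          rcases lt_or_ge r h with h1 | h1
          · rcases (hd r hr).2 h1 with h3 | h3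
            · exact absurd h' (h3.trans (hi.trans_lt hil)).ne
            · exact absurd h' (hll.trans h3).ne'
          · rw [(hd r hr).1 h1] at h'
            exact absurd h' (hr.trans_lt hil).ne

theorem extend_eq_update {V : Type*} [DecidableEq V] {q : ℕ} {a b : Fin (q + 1) → V}
    (ha : Function.Injective a) : Function.extend a b id = Function.update
      (Function.extend (fun j : Fin q => a j.castSucc) (fun j => b j.castSucc) id)
      (a (Fin.last q)) (b (Fin.last q)) := by
  have ha' : Function.Injective fun j : Fin q => a j.castSucc :=
    ha.comp (Fin.castSucc_injective q)
  ext1 r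
  by_cases hr : ∃ j, a j = r
  · obtain ⟨j, rfl⟩ := hr
    rw [ha.extend_apply]
    induction j using Fin.lastCases with
    | last => rw [Function.update_self]
    | cast j =>
      rw [Function.update_of_ne fun h => (Fin.castSucc_lt_last j).ne (ha h)]
      exact (ha'.extend_apply (fun j => b j.castSucc) id j).symm
  · rw [Function.extend_apply' _ _ _ hr, Function.update_of_ne fun h => hr ⟨_, h.symm⟩,
      Function.extend_apply']
    rintro ⟨j, hj⟩
    exact hr ⟨_, hj⟩

theorem word_succ {q : ℕ} (i : Fin ℓ) (s : Fin (q + 1) → List (Fin ℓ)) :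
    word i s = s (Fin.last q) ++ i :: word i fun j => s j.castSucc := by
  rw [word, List.ofFn_succ, List.flatten_cons, Fin.rev_zero, List.append_assoc, List.singleton_append,
    word]
  simp only [Fin.rev_succ]

/-- The transpose of the commutator of the word multiplies by a signed minor in which the columns
`a_j` are replaced by the columns `b_j`. -/
theorem bracketFun_word {q : ℕ} (i : Fin ℓ) (a b : Fin q → Fin (ℓ + 1)) (ha : StrictMono a)
    (hb : StrictAnti b) (hai : ∀ j, a j ≤ i.castSucc) (hib : ∀ j, i.castSucc < b j)
    (s : Fin q → List (Fin ℓ))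
    (hs : ∀ j, SatisfiesO (a j) i ((b j : ℕ) - 1) ((s j).map Fin.val)) :
    bracketFun i (word i s) =
      ((-1 : ℤ) ^ (∑ j, ((b j : ℕ) - i))) • minor i.castSucc (Function.extend a b id) := by
  induction q with
  | zero =>
    rw [Finset.univ_eq_empty, Finset.sum_empty, pow_zero, one_smul, word, List.ofFn_zero,
      List.flatten_nil, bracketFun]
    congr 1
    ext1 r
    rw [Function.extend_apply' _ _ _ fun h => h.choose.elim0]
  | succ q ih =>
    have ha' : StrictMono fun j : Fin q => a j.castSucc := ha.comp Fin.strictMono_castSucc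
    have ih := ih (fun j => a j.castSucc) (fun j => b j.castSucc) ha'
      (hb.comp_strictMono Fin.strictMono_castSucc) (fun j => hai _) (fun j => hib _)
      (fun j => s j.castSucc) fun j => hs _
    rw [word_succ, bracketFun_shuffle ih _ _ _ (hai _) (hib _) (hs (Fin.last q)),
      extend_eq_update ha.injective, Fin.sum_univ_castSucc, pow_add, mul_comm]
    intro r hr
    by_cases hra : ∃ j : Fin q, a j.castSucc = r
    · obtain ⟨j, rfl⟩ := hra
      have hj := ha (Fin.castSucc_lt_last j)
      refine ⟨fun h => absurd hj h.not_gt, fun _ => Or.inr ?_⟩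
      rw [ha'.injective.extend_apply (fun j => b j.castSucc) id j]
      exact hb (Fin.castSucc_lt_last j)
    · rw [Function.extend_apply' _ _ _ hra]
      exact ⟨fun _ => rfl, Or.inl⟩

end Words

/-! ### The sign of a permutation and of its first return map -/

/-- A permutation `π` that takes every point to a greater or equal point or into the range of `a`
has the sign of its first return map on the range of `a`, up to one sign for every point outside the
range of `a` that is moved. A relation `L s j` that is inherited backwards along the orbits from the
point `a j` holds for the points `a j` and their first returns. -/
theorem exists_firstReturn {R : Type*} [Fintype R] [LinearOrder R] {q : ℕ} {a : Fin q → R}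
    (ha : Function.Injective a) (L : R → Fin q → Prop) (n : ℕ) :
    ∀ π : Equiv.Perm R, (∀ s, π s ∉ Set.range a → s ≤ π s) →
      (∀ s j, π s = a j → L s j) → (∀ s j, π s ∉ Set.range a → L (π s) j → L s j) →
      ({s | s ∉ Set.range a ∧ π s ≠ s} : Set R).ncard = n →
      ∃ σ : Equiv.Perm (Fin q), Equiv.Perm.sign π = Equiv.Perm.sign σ * (-1) ^ n ∧
        ∀ j, L (a j) (σ j) := by
  induction n with
  | zero =>
    intro π hπ hL hL' hn
    rw [Set.ncard_eq_zero] at hn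
    have hfix : ∀ s, s ∉ Set.range a → π s = s := fun s hs => by
      by_contra h
      exact Set.notMem_empty s (hn ▸ ⟨hs, h⟩)
    have hmem : ∀ j, ∃ j', π (a j) = a j' := fun j => by
      by_contra h
      have h1 : π (a j) ∉ Set.range a := fun ⟨j', hj'⟩ => h ⟨j', hj'.symm⟩
      exact h1 ⟨j, (π.injective (hfix _ h1)).symm⟩
    choose σ hσ using hmem
    have hσi : Function.Injective σ := fun j j' h => ha (π.injective (by rw [hσ, hσ, h]))
    refine ⟨Equiv.ofBijective σ (Finite.injective_iff_bijective.1 hσi), ?_, fun j => hL _ _ (hσ j)⟩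
    rw [pow_zero, mul_one]
    have : π = Equiv.Perm.viaFintypeEmbedding
        (Equiv.ofBijective σ (Finite.injective_iff_bijective.1 hσi)) ⟨a, ha⟩ := by
      ext1 s
      by_cases hs : s ∈ Set.range a
      · obtain ⟨j, rfl⟩ := hs
        rw [hσ]
        exact (Equiv.Perm.viaFintypeEmbedding_apply_image
          (Equiv.ofBijective σ (Finite.injective_iff_bijective.1 hσi)) ⟨a, ha⟩ j).symm
      · rw [hfix s hs]
        exact (Equiv.Perm.viaFintypeEmbedding_apply_notMem_range _ ⟨a, ha⟩ hs).symm
    rw [this, Equiv.Perm.viaFintypeEmbedding_sign]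
  | succ n ih =>
    intro π hπ hL hL' hn
    obtain ⟨x, hx, hπx⟩ : ({s | s ∉ Set.range a ∧ π s ≠ s} : Set R).Nonempty :=
      Set.nonempty_of_ncard_ne_zero (by omega)
    -- The permutation `π'` follows `π`, but bypasses the point `x`.
    set π' : Equiv.Perm R := Equiv.swap x (π x) * π with hπ'
    obtain ⟨y, rfl⟩ := π.surjective x
    have hy : π y ≠ y := fun h => hπx (by rw [h, h])
    have h1 : π' (π y) = π y := by
      rw [hπ', Equiv.Perm.mul_apply, Equiv.swap_apply_right]
    have h2 : π' y = π (π y) := by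
      rw [hπ', Equiv.Perm.mul_apply, Equiv.swap_apply_left]
    have h3 : ∀ s, s ≠ y → s ≠ π y → π' s = π s := fun s hs hs' => by
      rw [hπ', Equiv.Perm.mul_apply, Equiv.swap_apply_of_ne_of_ne (fun h => hs (π.injective h))
        fun h => hs' (π.injective h)]
    have hind : ∃ σ : Equiv.Perm (Fin q), Equiv.Perm.sign π' = Equiv.Perm.sign σ * (-1) ^ n ∧
        ∀ j, L (a j) (σ j) := by
      refine ih π' ?_ ?_ ?_ ?_
      · intro s hs
        by_cases hsx : s = π y
        · rw [hsx, h1]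
        by_cases hsy : s = y
        · subst hsy
          rw [h2] at hs ⊢
          exact (hπ s hx).trans (hπ _ hs)
        rw [h3 s hsy hsx] at hs ⊢
        exact hπ s hs
      · intro s j hs
        by_cases hsx : s = π y
        · rw [hsx, h1] at hs
          exact absurd ⟨j, hs.symm⟩ hx
        by_cases hsy : s = y
        · subst hsy
          rw [h2] at hs
          exact hL' _ _ hx (hL _ _ hs)
        rw [h3 s hsy hsx] at hs
        exact hL s j hs
      · intro s j hs hLs
        by_cases hsx : s = π y
        · subst hsx
          rwa [h1] at hLs
        by_cases hsy : s = y
        · subst hsy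
          rw [h2] at hs hLs
          exact hL' _ _ hx (hL' _ _ hs hLs)
        rw [h3 s hsy hsx] at hs hLs
        exact hL' s j hs hLs
      · have h4 : ({s | s ∉ Set.range a ∧ π' s ≠ s} : Set R) =
            {s | s ∉ Set.range a ∧ π s ≠ s} \ {π y} := by
          ext s
          simp only [Set.mem_ofPred_eq, Set.mem_sdiff, Set.mem_singleton_iff]
          by_cases hsx : s = π y
          · subst hsx
            simp [h1]
          by_cases hsy : s = y
          · subst hsy
            rw [h2]
            refine ⟨fun h => ⟨⟨h.1, hy⟩, hsx⟩, fun h => ⟨h.1.1, fun h' => ?_⟩⟩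
            -- A cycle outside the range of `a` would be increasing.
            have h5 := hπ (π s) (by rw [h']; exact h.1.1)
            rw [h'] at h5
            exact hy (le_antisymm h5 (hπ s hx))
          rw [h3 s hsy hsx]
          exact ⟨fun h => ⟨h, hsx⟩, fun h => h.1⟩
        rw [h4, Set.ncard_sdiff_singleton_of_mem (by exact ⟨hx, hπx⟩), hn, Nat.add_sub_cancel]
    obtain ⟨σ, hσ, hσL⟩ := hind
    refine ⟨σ, ?_, hσL⟩
    rw [hπ', Equiv.Perm.sign_mul, Equiv.Perm.sign_swap hπx.symm] at hσ
    rw [pow_succ, ← mul_assoc, ← hσ, neg_one_mul, mul_neg_one, neg_neg]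

/-! ### Permutations and flows -/

section Flows

variable {V : Type*} [LinearOrder V] {q : ℕ} {a b : Fin q → V}

/-- No other edge begins at the origin of a given edge; so a sink that is reached from the origin is
reached from the end. -/
theorem IsFlow.reach_iff {Γ : Finset (V × V)} (h : IsFlow a b Γ) {s t : V} (hst : (s, t) ∈ Γ)
    (j : Fin q) : Relation.ReflTransGen (fun s t => (s, t) ∈ Γ) s (b j) ↔
      Relation.ReflTransGen (fun s t => (s, t) ∈ Γ) t (b j) := by
  refine ⟨fun hs => ?_, fun ht => Relation.ReflTransGen.head hst ht⟩
  rcases hs.cases_head with hs | ⟨t', hst', ht'⟩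
  · exact absurd hst (hs ▸ (h.sink j).2 t)
  · suffices t = t' by rwa [this]
    by_cases hsa : ∃ j, s = a j
    · obtain ⟨j, rfl⟩ := hsa
      exact (h.source j).1.unique hst hst'
    by_cases hsb : ∃ j, s = b j
    · obtain ⟨j, rfl⟩ := hsb
      exact absurd hst ((h.sink j).2 t)
    push Not at hsa hsb
    rcases h.transit s hsa hsb with h1 | h1
    · exact absurd hst (h1.2 t)
    · exact h1.2.unique hst hst'

theorem IsFlow.linked_reach_iff {Γ : Finset (V × V)} (h : IsFlow a b Γ) {s t : V}
    (hst : Linked Γ s t) (j : Fin q) : Relation.ReflTransGen (fun s t => (s, t) ∈ Γ) s (b j) ↔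
      Relation.ReflTransGen (fun s t => (s, t) ∈ Γ) t (b j) := by
  induction hst with
  | rel s t hst => exact h.reach_iff hst j
  | refl => rfl
  | symm s t _ ih => exact ih.symm
  | trans s t u _ _ ih ih' => exact ih.trans ih'

theorem IsFlow.eq_of_linked_sinks {Γ : Finset (V × V)} (h : IsFlow a b Γ)
    (hb : Function.Injective b) {j j' : Fin q} (hj : Linked Γ (b j) (b j')) : j = j' := by
  rcases ((h.linked_reach_iff hj j').2 .refl).cases_head with h1 | ⟨t, ht, -⟩
  · exact hb h1
  · exact absurd ht ((h.sink j).2 t)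

theorem IsFlow.linkPerm_eq {Γ : Finset (V × V)} (h : IsFlow a b Γ) (hb : Function.Injective b)
    {σ : Equiv.Perm (Fin q)} (hσ : ∀ j, Linked Γ (a j) (b (σ j))) : linkPerm a b Γ = σ := by
  have h1 : ∀ j, Linked Γ (a j) (b (linkPerm a b Γ j)) :=
    Classical.epsilon_spec (p := fun σ : Equiv.Perm (Fin q) => ∀ j, Linked Γ (a j) (b (σ j))) ⟨σ, hσ⟩
  ext1 j
  exact h.eq_of_linked_sinks hb (.trans _ _ _ (.symm _ _ (h1 j)) (hσ j))

end Flows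

section Flows

theorem perm_apply_inv {R : Type*} (τ : Equiv.Perm R) (r : R) : τ (τ⁻¹ r) = r :=
  τ.apply_symm_apply r

theorem perm_inv_apply {R : Type*} (τ : Equiv.Perm R) (r : R) : τ⁻¹ (τ r) = r :=
  τ.symm_apply_apply r

variable {V : Type*} [LinearOrder V] {q : ℕ} {a b : Fin q → V} {k : V}

theorem extend_of_le (hbk : ∀ j, k < b j) (ha : Function.Injective a) {r : V}
    (hr : Function.extend a b id r ≤ k) : r ∉ Set.range a ∧ Function.extend a b id r = r := by
  have h : r ∉ Set.range a := by
    rintro ⟨j, rfl⟩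
    rw [ha.extend_apply] at hr
    exact (hbk j).not_ge hr
  exact ⟨h, Function.extend_apply' _ _ _ h⟩

theorem extend_ne_source (hak : ∀ j, a j ≤ k) (hbk : ∀ j, k < b j) (ha : Function.Injective a)
    (r : V) (j : Fin q) : Function.extend a b id r ≠ a j := fun h => by
  obtain ⟨h1, h2⟩ := extend_of_le hbk ha (h.trans_le (hak j))
  exact h1 ⟨j, h.symm.trans h2⟩

theorem extend_injOn (hbk : ∀ j, k < b j) (ha : Function.Injective a) (hb : Function.Injective b)
    {r r' : V} (hr : r ≤ k) (hr' : r' ≤ k)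
    (h : Function.extend a b id r = Function.extend a b id r') : r = r' := by
  by_cases h1 : r ∈ Set.range a
  · obtain ⟨j, rfl⟩ := h1
    rw [ha.extend_apply] at h
    by_cases h2 : r' ∈ Set.range a
    · obtain ⟨j', rfl⟩ := h2
      rw [ha.extend_apply] at h
      rw [hb h]
    · rw [Function.extend_apply' _ _ _ h2] at h
      exact absurd (h.trans_le hr') (hbk j).not_ge
  · rw [Function.extend_apply' _ _ _ h1] at h
    rw [(extend_of_le hbk ha (h.symm.trans_le hr)).2] at h
    exact h

variable [Fintype V]

/-- The graph of a permutation `τ` of the rows `r ≤ k`: its edges lead from the row `τ r` to the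
`r`-th column, which is `b_j` for `r = a_j` and `r` otherwise; loops are omitted. -/
def permGraph (a b : Fin q → V) (τ : Equiv.Perm {r : V // r ≤ k}) : Finset (V × V) :=
  ({r | (τ r : V) ≠ Function.extend a b id r.1} : Finset {r : V // r ≤ k}).image
    fun r => ((τ r : V), Function.extend a b id r.1)

theorem mem_permGraph {τ : Equiv.Perm {r : V // r ≤ k}} {s t : V} :
    (s, t) ∈ permGraph a b τ ↔
      ∃ r : {r : V // r ≤ k}, (τ r : V) = s ∧ Function.extend a b id r.1 = t ∧ s ≠ t := by
  simp only [permGraph, Finset.mem_image, Finset.mem_filter, Finset.mem_univ, true_and,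
    Prod.mk.injEq]
  refine exists_congr fun r => ⟨?_, ?_⟩
  · rintro ⟨h, rfl, rfl⟩
    exact ⟨rfl, rfl, h⟩
  · rintro ⟨rfl, rfl, h⟩
    exact ⟨h, rfl, rfl⟩

theorem out_unique_permGraph {τ : Equiv.Perm {r : V // r ≤ k}} {s t t' : V}
    (h : (s, t) ∈ permGraph a b τ) (h' : (s, t') ∈ permGraph a b τ) : t = t' := by
  obtain ⟨r, h1, h2, -⟩ := mem_permGraph.1 h
  obtain ⟨r', h1', h2', -⟩ := mem_permGraph.1 h'
  rw [← h2, ← h2', τ.injective (Subtype.ext (h1.trans h1'.symm))]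

theorem in_unique_permGraph (hbk : ∀ j, k < b j) (ha : Function.Injective a)
    (hb : Function.Injective b) {τ : Equiv.Perm {r : V // r ≤ k}} {s s' t : V}
    (h : (s, t) ∈ permGraph a b τ) (h' : (s', t) ∈ permGraph a b τ) : s = s' := by
  obtain ⟨r, h1, h2, -⟩ := mem_permGraph.1 h
  obtain ⟨r', h1', h2', -⟩ := mem_permGraph.1 h'
  have := extend_injOn hbk ha hb r.2 r'.2 (h2.trans h2'.symm)
  rw [← h1, ← h1', Subtype.ext this]

/-- The transit points are the rows outside the sources that are moved by `τ`. -/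
theorem permGraph_isTransit_iff (hbk : ∀ j, k < b j) (ha : Function.Injective a)
    {τ : Equiv.Perm {r : V // r ≤ k}} (r : V) :
    IsTransit a b (permGraph a b τ) r ↔
      ∃ h : r ≤ k, r ∉ Set.range a ∧ τ⁻¹ ⟨r, h⟩ ≠ ⟨r, h⟩ := by
  constructor
  · rintro ⟨h1, h2, ⟨s, hs⟩, ⟨t, ht⟩⟩
    obtain ⟨x, rfl, rfl, hx⟩ := mem_permGraph.1 ht
    refine ⟨(τ x).2, fun ⟨j, hj⟩ => h1 j hj.symm, fun h => ?_⟩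
    rw [Subtype.coe_eta, perm_inv_apply] at h
    refine hx ?_
    rw [← h, Function.extend_apply' _ _ _ fun ⟨j, hj⟩ => h1 j (by rw [← h, hj]), id]
  · rintro ⟨h, hr, hne⟩
    have hc : Function.extend a b id r = r := Function.extend_apply' _ _ _ hr
    refine ⟨fun j hj => hr ⟨j, hj.symm⟩, fun j hj => (hbk j).not_ge (hj ▸ h), ⟨τ ⟨r, h⟩, ?_⟩,
      ⟨Function.extend a b id (τ⁻¹ ⟨r, h⟩).1, ?_⟩⟩
    · refine mem_permGraph.2 ⟨⟨r, h⟩, rfl, hc, fun h' => hne ?_⟩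
      rw [Equiv.Perm.inv_eq_iff_eq]
      exact (Subtype.ext h').symm
    · refine mem_permGraph.2 ⟨τ⁻¹ ⟨r, h⟩, by rw [perm_apply_inv], rfl, fun h' => hne ?_⟩
      have h2 := (extend_of_le hbk ha (h'.symm.trans_le h)).2
      exact Subtype.ext (h2.symm.trans h'.symm)

theorem permGraph_isFlow (hak : ∀ j, a j ≤ k) (hbk : ∀ j, k < b j) (ha : Function.Injective a)
    (hb : Function.Injective b) {τ : Equiv.Perm {r : V // r ≤ k}}
    (hτ : ∀ r, (τ r : V) ≤ Function.extend a b id r.1) : IsFlow a b (permGraph a b τ) where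
  lt s t h := by
    obtain ⟨r, rfl, rfl, hne⟩ := mem_permGraph.1 h
    exact lt_of_le_of_ne (hτ r) hne
  source j := by
    refine ⟨⟨Function.extend a b id (τ⁻¹ ⟨a j, hak j⟩).1, mem_permGraph.2 ⟨τ⁻¹ ⟨a j, hak j⟩,
      by rw [perm_apply_inv], rfl, (extend_ne_source hak hbk ha _ j).symm⟩,
      fun t ht => ?_⟩, fun s hs => ?_⟩
    · obtain ⟨r, h1, rfl, -⟩ := mem_permGraph.1 ht
      rw [show τ⁻¹ ⟨a j, hak j⟩ = r by rw [Equiv.Perm.inv_eq_iff_eq]; exact (Subtype.ext h1).symm]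
    · obtain ⟨r, -, h2, -⟩ := mem_permGraph.1 hs
      exact extend_ne_source hak hbk ha _ j h2
  sink j := by
    refine ⟨⟨τ ⟨a j, hak j⟩, mem_permGraph.2 ⟨⟨a j, hak j⟩, rfl, ha.extend_apply _ _ _,
      ((τ _).2.trans_lt (hbk j)).ne⟩, fun s hs => ?_⟩, fun t ht => ?_⟩
    · exact in_unique_permGraph hbk ha hb hs (mem_permGraph.2 ⟨⟨a j, hak j⟩, rfl,
        ha.extend_apply _ _ _, ((τ _).2.trans_lt (hbk j)).ne⟩)
    · obtain ⟨r, h1, -, -⟩ := mem_permGraph.1 ht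
      exact (hbk j).not_ge (h1 ▸ (τ r).2)
  transit r hra hrb := by
    have hra' : r ∉ Set.range a := fun ⟨j, hj⟩ => hra j hj.symm
    by_cases ht : IsTransit a b (permGraph a b τ) r
    · obtain ⟨-, -, ⟨s, hs⟩, ⟨t, ht⟩⟩ := ht
      exact Or.inr ⟨⟨s, hs, fun s' hs' => in_unique_permGraph hbk ha hb hs' hs⟩,
        ⟨t, ht, fun t' ht' => out_unique_permGraph ht' ht⟩⟩
    · rw [permGraph_isTransit_iff hbk ha] at ht
      push Not at ht
      refine Or.inl ⟨fun s hs => ?_, fun t hs => ?_⟩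
      · obtain ⟨x, rfl, h2, hne⟩ := mem_permGraph.1 hs
        by_cases hx : x.1 ∈ Set.range a
        · obtain ⟨j, hj⟩ := hx
          rw [← hj, ha.extend_apply] at h2
          exact hrb j h2.symm
        · rw [Function.extend_apply' _ _ _ hx, id] at h2
          subst h2
          have h3 := ht x.2 hx
          rw [Subtype.coe_eta, Equiv.Perm.inv_eq_iff_eq] at h3
          exact hne (congrArg Subtype.val h3).symm
      · obtain ⟨x, rfl, rfl, hne⟩ := mem_permGraph.1 hs
        have h3 := ht (τ x).2 hra'
        rw [Subtype.coe_eta, perm_inv_apply] at h3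
        rw [← h3] at hra' hne
        exact hne (Function.extend_apply' (f := a) b id x.1 hra').symm

theorem permGraph_injective (hbk : ∀ j, k < b j) (ha : Function.Injective a)
    (hb : Function.Injective b) :
    Function.Injective (permGraph a b : Equiv.Perm {r : V // r ≤ k} → Finset (V × V)) := by
  have key : ∀ (τ τ' : Equiv.Perm {r : V // r ≤ k}), permGraph a b τ = permGraph a b τ' →
      ∀ r, (τ r : V) ≠ Function.extend a b id r.1 → τ r = τ' r := by
    intro τ τ' h r hr
    have h1 : ((τ r : V), Function.extend a b id r.1) ∈ permGraph a b τ' := by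
      rw [← h]
      exact mem_permGraph.2 ⟨r, rfl, rfl, hr⟩
    obtain ⟨r', h2, h3, -⟩ := mem_permGraph.1 h1
    rw [Subtype.ext (extend_injOn hbk ha hb r'.2 r.2 h3)] at h2
    exact (Subtype.ext h2).symm
  intro τ τ' h
  ext1 r
  by_cases h1 : (τ r : V) = Function.extend a b id r.1
  · by_cases h2 : (τ' r : V) = Function.extend a b id r.1
    · exact Subtype.ext (h1.trans h2.symm)
    · exact (key τ' τ h.symm r h2).symm
  · exact key τ τ' h r h1

/-- Every flow without transit points greater than `k` is the graph of a permutation. -/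
theorem exists_permGraph_eq (hak : ∀ j, a j ≤ k) (hbk : ∀ j, k < b j) (ha : Function.Injective a)
    (hb : Function.Injective b) {Γ : Finset (V × V)} (hΓ : IsFlow a b Γ)
    (hk : ∀ r, IsTransit a b Γ r → r ≤ k) : ∃ τ : Equiv.Perm {r : V // r ≤ k},
      (∀ r, (τ r : V) ≤ Function.extend a b id r.1) ∧ permGraph a b τ = Γ := by
  have hout : ∀ {s t : V}, (s, t) ∈ Γ → s ≤ k := by
    intro s t h
    by_cases hsa : ∃ j, s = a j
    · obtain ⟨j, rfl⟩ := hsa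
      exact hak j
    by_cases hsb : ∃ j, s = b j
    · obtain ⟨j, rfl⟩ := hsb
      exact absurd h ((hΓ.sink j).2 t)
    push Not at hsa hsb
    rcases hΓ.transit s hsa hsb with h1 | h1
    · exact absurd h (h1.2 t)
    · exact hk s ⟨hsa, hsb, h1.1.exists, t, h⟩
  have hout_unique : ∀ {s t t' : V}, (s, t) ∈ Γ → (s, t') ∈ Γ → t = t' := by
    intro s t t' h h'
    by_cases hsa : ∃ j, s = a j
    · obtain ⟨j, rfl⟩ := hsa
      exact (hΓ.source j).1.unique h h'
    by_cases hsb : ∃ j, s = b j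
    · obtain ⟨j, rfl⟩ := hsb
      exact absurd h ((hΓ.sink j).2 t)
    push Not at hsa hsb
    rcases hΓ.transit s hsa hsb with h1 | h1
    · exact absurd h (h1.2 t)
    · exact h1.2.unique h h'
  have hin_unique : ∀ {s s' t : V}, (s, t) ∈ Γ → (s', t) ∈ Γ → s = s' := by
    intro s s' t h h'
    by_cases hsa : ∃ j, t = a j
    · obtain ⟨j, rfl⟩ := hsa
      exact absurd h ((hΓ.source j).2 s)
    by_cases hsb : ∃ j, t = b j
    · obtain ⟨j, rfl⟩ := hsb
      exact (hΓ.sink j).1.unique h h'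
    push Not at hsa hsb
    rcases hΓ.transit t hsa hsb with h1 | h1
    · exact absurd h (h1.1 s)
    · exact h1.1.unique h h'
  have hcol : ∀ {s t : V}, (s, t) ∈ Γ → ∃ r ≤ k, Function.extend a b id r = t := by
    intro s t h
    by_cases hsa : ∃ j, t = a j
    · obtain ⟨j, rfl⟩ := hsa
      exact absurd h ((hΓ.source j).2 s)
    by_cases hsb : ∃ j, t = b j
    · obtain ⟨j, rfl⟩ := hsb
      exact ⟨a j, hak j, ha.extend_apply _ _ _⟩
    push Not at hsa hsb
    rcases hΓ.transit t hsa hsb with h1 | h1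
    · exact absurd h (h1.1 s)
    · exact ⟨t, hk t ⟨hsa, hsb, h1.1.exists, h1.2.exists⟩,
        Function.extend_apply' _ _ _ fun ⟨j, hj⟩ => hsa j hj.symm⟩
  -- The row of the `r`-th column: the origin of its edge, or `r` if there is no edge.
  have hrow : ∀ r : {r : V // r ≤ k}, ∃ s : {r : V // r ≤ k},
      ((s : V), Function.extend a b id r.1) ∈ Γ ∨ ((s : V) = Function.extend a b id r.1 ∧
        ∀ t, ((s : V), t) ∉ Γ) := by
    intro r
    by_cases hra : r.1 ∈ Set.range a
    · obtain ⟨j, hj⟩ := hra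
      obtain ⟨s, hs⟩ := (hΓ.sink j).1.exists
      refine ⟨⟨s, hout hs⟩, Or.inl ?_⟩
      rwa [← hj, ha.extend_apply]
    · have hc : Function.extend a b id r.1 = r.1 := Function.extend_apply' _ _ _ hra
      rw [hc]
      rcases hΓ.transit r.1 (fun j hj => hra ⟨j, hj.symm⟩) (fun j hj => (hbk j).not_ge (hj ▸ r.2))
        with h1 | h1
      · exact ⟨r, Or.inr ⟨rfl, h1.2⟩⟩
      · obtain ⟨s, hs⟩ := h1.1.exists
        exact ⟨⟨s, hout hs⟩, Or.inl hs⟩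
  choose τ hτ using hrow
  have hinj : Function.Injective τ := by
    intro r r' h
    refine Subtype.ext (extend_injOn hbk ha hb r.2 r'.2 ?_)
    have h1 := hτ r
    rw [h] at h1
    rcases h1 with h1 | ⟨h1, h1'⟩ <;> rcases hτ r' with h2 | ⟨h2, h2'⟩
    · exact hout_unique h1 h2
    · exact absurd h1 (h2' _)
    · exact absurd h2 (h1' _)
    · exact h1.symm.trans h2
  refine ⟨Equiv.ofBijective τ (Finite.injective_iff_bijective.1 hinj), fun r => ?_, ?_⟩
  · rcases hτ r with h | h
    · exact (hΓ.lt _ _ h).le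
    · exact h.1.le
  · ext ⟨s, t⟩
    rw [mem_permGraph]
    constructor
    · rintro ⟨r, rfl, rfl, hne⟩
      exact (hτ r).resolve_right fun h => hne h.1
    · intro h
      obtain ⟨r, hr, rfl⟩ := hcol h
      refine ⟨⟨r, hr⟩, ?_, rfl, (hΓ.lt _ _ h).ne⟩
      rcases hτ ⟨r, hr⟩ with h1 | ⟨h1, h1'⟩
      · exact hin_unique h1 h
      · -- A column without an edge is not the end of an edge.
        by_cases hra : r ∈ Set.range a
        · obtain ⟨j, rfl⟩ := hra
          rw [ha.extend_apply] at h1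
          exact absurd (h1 ▸ (τ _).2) (hbk j).not_ge
        · rw [Function.extend_apply' _ _ _ hra, id] at h1 h
          rcases hΓ.transit r (fun j hj => hra ⟨j, hj.symm⟩) (fun j hj => (hbk j).not_ge (hj ▸ hr))
            with h3 | h3
          · exact absurd h (h3.1 _)
          · obtain ⟨t, ht⟩ := h3.2.exists
            rw [h1] at h1'
            exact absurd ht (h1' t)

/-- The inverse of `τ` follows the edges of the graph and returns from the sink `b_j` to the source `a_j`.
So its first return map on the sources is the linking permutation. -/
theorem sign_permGraph (hak : ∀ j, a j ≤ k) (hbk : ∀ j, k < b j) (ha : Function.Injective a)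
    (hb : Function.Injective b) {τ : Equiv.Perm {r : V // r ≤ k}}
    [DecidablePred (IsTransit a b (permGraph a b τ))]
    (hτ : ∀ r, (τ r : V) ≤ Function.extend a b id r.1) :
    Equiv.Perm.sign τ = Equiv.Perm.sign (linkPerm a b (permGraph a b τ)) *
      (-1) ^ ({r | IsTransit a b (permGraph a b τ) r} : Finset V).card := by
  have hmem : ∀ r : {r : V // r ≤ k},
      r ∈ Set.range (fun j => (⟨a j, hak j⟩ : {r : V // r ≤ k})) ↔ r.1 ∈ Set.range a := fun r =>
    ⟨fun ⟨j, hj⟩ => ⟨j, congrArg Subtype.val hj⟩, fun ⟨j, hj⟩ => ⟨j, Subtype.ext hj⟩⟩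
  have hedge : ∀ s : {r : V // r ≤ k}, (s : V) = Function.extend a b id (τ⁻¹ s).1 ∨
      ((s : V), Function.extend a b id (τ⁻¹ s).1) ∈ permGraph a b τ := fun s =>
    or_iff_not_imp_left.2 fun h => mem_permGraph.2
      ⟨τ⁻¹ s, by rw [perm_apply_inv], rfl, h⟩
  have hlink : ∀ s : {r : V // r ≤ k},
      Linked (permGraph a b τ) s (Function.extend a b id (τ⁻¹ s).1) := fun s => by
    rcases hedge s with h | h
    · rw [← h]
      exact .refl _
    · exact .rel _ _ h
  have hπ : ∀ s, τ⁻¹ s ∉ Set.range (fun j => (⟨a j, hak j⟩ : {r : V // r ≤ k})) → s ≤ τ⁻¹ s := by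
    intro s hs
    rw [hmem] at hs
    have h := hτ (τ⁻¹ s)
    rwa [perm_apply_inv, Function.extend_apply' _ _ _ hs] at h
  have hL : ∀ s j, τ⁻¹ s = ⟨a j, hak j⟩ → Linked (permGraph a b τ) s.1 (b j) := by
    intro s j hs
    have h := hlink s
    rwa [hs, ha.extend_apply] at h
  have hL' : ∀ s j, τ⁻¹ s ∉ Set.range (fun j => (⟨a j, hak j⟩ : {r : V // r ≤ k})) →
      Linked (permGraph a b τ) (τ⁻¹ s).1 (b j) → Linked (permGraph a b τ) s.1 (b j) := by
    intro s j hs h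
    rw [hmem] at hs
    have h' := hlink s
    rw [Function.extend_apply' _ _ _ hs] at h'
    exact .trans _ _ _ h' h
  have hn : ({s | s ∉ Set.range (fun j => (⟨a j, hak j⟩ : {r : V // r ≤ k})) ∧ τ⁻¹ s ≠ s} :
      Set {r : V // r ≤ k}).ncard = ({r | IsTransit a b (permGraph a b τ) r} : Finset V).card := by
    rw [← Set.ncard_coe_finset, ← Set.ncard_image_of_injective _ Subtype.val_injective]
    congr 1
    ext r
    rw [Finset.coe_filter_univ, Set.mem_ofPred_eq, permGraph_isTransit_iff hbk ha]
    constructor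
    · rintro ⟨s, ⟨h1, h2⟩, rfl⟩
      rw [hmem] at h1
      exact ⟨s.2, h1, h2⟩
    · rintro ⟨h, h1, h2⟩
      exact ⟨⟨r, h⟩, ⟨fun h' => h1 ((hmem _).1 h'), h2⟩, rfl⟩
  have hret := exists_firstReturn (a := fun j => (⟨a j, hak j⟩ : {r : V // r ≤ k}))
    (fun j j' h => ha (congrArg Subtype.val h))
    (fun s j => Linked (permGraph a b τ) s (b j))
    ({r | IsTransit a b (permGraph a b τ) r} : Finset V).card τ⁻¹ hπ hL hL' hn
  obtain ⟨σ, hσ, hσL⟩ := hret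
  rw [(permGraph_isFlow hak hbk ha hb hτ).linkPerm_eq hb hσL, ← Equiv.Perm.sign_inv]
  convert hσ

end Flows

/-! ### The expansion of a minor of the unipotent matrix over flows -/

section Expansion

variable {ℓ q : ℕ} {i : Fin ℓ} {a b : Fin q → Fin (ℓ + 1)}

theorem prod_unipotent_eq (hbk : ∀ j, i.castSucc < b j) (ha : Function.Injective a)
    (hb : Function.Injective b) {τ : Equiv.Perm {r : Fin (ℓ + 1) // r ≤ i.castSucc}}
    (hτ : ∀ r, (τ r : Fin (ℓ + 1)) ≤ Function.extend a b id r.1) :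
    ∏ r : {r : Fin (ℓ + 1) // r ≤ i.castSucc},
        unipotent ℓ (MvPolynomial.X ((τ r : Fin (ℓ + 1)), Function.extend a b id r.1)) =
      ∏ e ∈ permGraph a b τ, (MvPolynomial.X e : MatPoly ℓ ℤ) := by
  rw [permGraph, Finset.prod_image, Finset.prod_filter]
  · refine Finset.prod_congr rfl fun r _ => ?_
    rw [unipotent_X]
    by_cases h : (τ r : Fin (ℓ + 1)) = Function.extend a b id r.1
    · rw [if_pos h, if_neg (not_not.2 h)]
    · rw [if_neg h, if_pos h, if_pos (lt_of_le_of_ne (hτ r) h)]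
  · intro r _ r' _ h
    exact Subtype.ext (extend_injOn hbk ha hb r.2 r'.2 (Prod.ext_iff.1 h).2)

theorem mem_flows (hai : ∀ j, a j ≤ i.castSucc) (hib : ∀ j, i.castSucc < b j)
    {Γ : Finset (Fin (ℓ + 1) × Fin (ℓ + 1))} : Γ ∈ flows i a b ↔ IsFlow a b Γ ∧
      ∀ r, IsTransit a b Γ r → r ≤ i.castSucc := by
  classical
  rw [flows, Finset.mem_filter]
  simp only [Finset.mem_univ, true_and]
  exact ⟨fun h => ⟨h.1, h.2.2.2⟩, fun h => ⟨h.1, hai, hib, h.2⟩⟩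

/-- The Leibniz expansion: the nonzero terms are those of the permutations `τ` that take no row to the
right of its column, and these permutations correspond to the flows. -/
theorem unipotent_minor_extend (ha : Function.Injective a) (hb : Function.Injective b)
    (hai : ∀ j, a j ≤ i.castSucc) (hib : ∀ j, i.castSucc < b j) :
    unipotent ℓ (((-1 : ℤ) ^ (∑ j, ((b j : ℕ) - i))) •
      minor i.castSucc (Function.extend a b id)) =
      ∑ Γ ∈ flows i a b, sgn i a b Γ • ∏ e ∈ Γ, (MvPolynomial.X e : MatPoly ℓ ℤ) := by
  classical
  rw [map_zsmul, minor, RingHom.map_det, Matrix.det_apply, Finset.smul_sum]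
  have hterm : ∀ τ : Equiv.Perm {r : Fin (ℓ + 1) // r ≤ i.castSucc},
      ∏ r, (unipotent ℓ).mapMatrix (Matrix.of fun r r' : {r : Fin (ℓ + 1) // r ≤ i.castSucc} =>
        (MvPolynomial.X (r.1, Function.extend a b id r'.1) : MatPoly ℓ ℤ)) (τ r) r =
      ∏ r : {r : Fin (ℓ + 1) // r ≤ i.castSucc},
        unipotent ℓ (MvPolynomial.X ((τ r : Fin (ℓ + 1)), Function.extend a b id r.1)) :=
    fun τ => rfl
  rw [← Finset.sum_filter_add_sum_filter_not _ (fun τ : Equiv.Perm {r // r ≤ i.castSucc} =>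
    ∀ r, (τ r : Fin (ℓ + 1)) ≤ Function.extend a b id r.1)]
  rw [Finset.sum_eq_zero (s := Finset.filter (fun τ => ¬_) _), add_zero]
  · refine Finset.sum_bij (fun τ _ => permGraph a b τ) ?_ ?_ ?_ ?_
    · intro τ hτ
      have hτ := (Finset.mem_filter.1 hτ).2
      refine (mem_flows hai hib).2 ⟨permGraph_isFlow hai hib ha hb hτ, fun r hr => ?_⟩
      exact ((permGraph_isTransit_iff hib ha r).1 hr).1
    · intro τ _ τ' _ h
      exact permGraph_injective hib ha hb h
    · intro Γ hΓ
      rw [mem_flows hai hib] at hΓ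
      obtain ⟨τ, hτ, h⟩ := exists_permGraph_eq hai hib ha hb hΓ.1 hΓ.2
      exact ⟨τ, Finset.mem_filter.2 ⟨Finset.mem_univ _, hτ⟩, h⟩
    · intro τ hτ
      have hτ := (Finset.mem_filter.1 hτ).2
      rw [hterm, prod_unipotent_eq hib ha hb hτ, sgn, Units.smul_def, smul_smul]
      congr 1
      have h := congrArg (Units.val) (sign_permGraph hai hib ha hb hτ)
      rw [Units.val_mul, Units.val_pow_eq_pow_val, Units.val_neg, Units.val_one] at h
      rw [pow_add, mul_left_comm]
      congr 1
  · intro τ hτ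
    have hτ := (Finset.mem_filter.1 hτ).2
    push Not at hτ
    obtain ⟨r, hr⟩ := hτ
    rw [hterm, Finset.prod_eq_zero (Finset.mem_univ r), smul_zero, smul_zero]
    rw [unipotent_X, if_neg hr.ne', if_neg hr.not_gt]

theorem prod_X_eq_monomial (Γ : Finset (Fin (ℓ + 1) × Fin (ℓ + 1))) :
    ∏ e ∈ Γ, (MvPolynomial.X e : MatPoly ℓ ℤ) =
      MvPolynomial.monomial (∑ e ∈ Γ, Finsupp.single e 1) 1 := by
  rw [MvPolynomial.monomial_sum_one]
  rfl

theorem sum_single_apply (Γ : Finset (Fin (ℓ + 1) × Fin (ℓ + 1)))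
    (p : Fin (ℓ + 1) × Fin (ℓ + 1)) :
    (∑ e ∈ Γ, Finsupp.single e 1 : Fin (ℓ + 1) × Fin (ℓ + 1) →₀ ℕ) p = if p ∈ Γ then 1 else 0 := by
  rw [Finsupp.finsetSum_apply]
  simp [Finsupp.single_apply]

theorem toUT_apply {Γ : Finset (Fin (ℓ + 1) × Fin (ℓ + 1))} (hΓ : ∀ s t, (s, t) ∈ Γ → s < t)
    (s t : Fin (ℓ + 1)) : (toUT Γ).1 s t = if (s, t) ∈ Γ then 1 else 0 := by
  change (if s < t ∧ (s, t) ∈ Γ then (1 : ℤ) else 0) = _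
  congr 1
  exact propext ⟨fun h => h.2, fun h => ⟨hΓ _ _ h, h⟩⟩

/-- The transpose of the multiplication by the monomial of a graph subtracts the graph from `N`;
if an entry becomes negative, the coefficient and `F^{(N - Γ)}` vanish. -/
theorem coeff_prod_X_mul (K : Type*) [Field K] {Γ : Finset (Fin (ℓ + 1) × Fin (ℓ + 1))}
    (hΓ : ∀ s t, (s, t) ∈ Γ → s < t) {N : UT (ℓ + 1)} (hN : ∀ s t, 0 ≤ N.1 s t)
    (f : MatPoly ℓ ℤ) :
    ((((∏ e ∈ Γ, (MvPolynomial.X e : MatPoly ℓ ℤ)) * unipotent ℓ f).coeff (expo N) : ℤ) : K) =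
      pairing K f (F K (N - toUT Γ)) := by
  have hsub : ∀ s t, (N - toUT Γ).1 s t = N.1 s t - if (s, t) ∈ Γ then 1 else 0 := fun s t => by
    rw [← toUT_apply hΓ]
    rfl
  rw [prod_X_eq_monomial, MvPolynomial.coeff_monomial_mul', one_mul]
  split_ifs with h
  · have h1 : ∀ s t, (if (s, t) ∈ Γ then 1 else 0 : ℤ) ≤ N.1 s t := fun s t => by
      have h2 := h (s, t)
      rw [sum_single_apply, expo_apply] at h2
      have := hN s t
      dsimp only at h2
      split_ifs at h2 ⊢ <;> omega
    rw [pairing_F K (N := N - toUT Γ) fun s t => by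
      rw [hsub]
      exact sub_nonneg.2 (h1 s t)]
    congr 2
    ext ⟨s, t⟩
    rw [Finsupp.tsub_apply, sum_single_apply, expo_apply, expo_apply, hsub]
    have := h1 s t
    dsimp only
    split_ifs <;> omega
  · rw [Int.cast_zero]
    obtain ⟨⟨s, t⟩, hst⟩ : ∃ p, expo N p < (∑ e ∈ Γ, Finsupp.single e 1 :
        Fin (ℓ + 1) × Fin (ℓ + 1) →₀ ℕ) p := by
      by_contra h'
      push Not at h'
      exact h h'
    rw [F_eq_zero K (a := s) (b := t), map_zero]
    rw [hsub]
    rw [sum_single_apply, expo_apply] at hst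
    have := hN s t
    dsimp only at hst
    split_ifs at hst ⊢ <;> omega

end Expansion

/-! ### The commutators of words on `𝒰^{-,0}` -/

section Main

variable {K : Type*} [Field K] {ℓ q : ℕ} {i : Fin ℓ} {a b : Fin q → Fin (ℓ + 1)}

theorem pairing_bracketFun_mul_F (ha : StrictMono a) (hb : StrictAnti b)
    (hai : ∀ j, a j ≤ i.castSucc) (hib : ∀ j, i.castSucc < b j) {s : Fin q → List (Fin ℓ)}
    (hs : ∀ j, SatisfiesO (a j) i ((b j : ℕ) - 1) ((s j).map Fin.val)) (f : MatPoly ℓ ℤ)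
    (N : UT (ℓ + 1)) : pairing K (bracketFun i (word i s) * f) (F K N) =
      ∑ Γ ∈ flows i a b, (sgn i a b Γ : K) * pairing K f (F K (N - toUT Γ)) := by
  have hlt : ∀ Γ ∈ flows i a b, ∀ s t, (s, t) ∈ Γ → s < t := fun Γ hΓ =>
    ((mem_flows hai hib).1 hΓ).1.lt
  by_cases hN : ∀ s t, 0 ≤ N.1 s t
  · rw [pairing_F K hN, map_mul, bracketFun_word i a b ha hb hai hib s hs,
      unipotent_minor_extend ha.injective hb.injective hai hib, Finset.sum_mul,
      MvPolynomial.coeff_sum, Int.cast_sum]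
    refine Finset.sum_congr rfl fun Γ hΓ => ?_
    rw [smul_mul_assoc, MvPolynomial.coeff_smul, smul_eq_mul, Int.cast_mul,
      coeff_prod_X_mul K (hlt Γ hΓ) hN]
  · push Not at hN
    obtain ⟨s, t, hst⟩ := hN
    rw [F_eq_zero K hst, map_zero]
    refine (Finset.sum_eq_zero fun Γ hΓ => ?_).symm
    rw [F_eq_zero K (a := s) (b := t), map_zero, mul_zero]
    change N.1 s t - (toUT Γ).1 s t < 0
    rw [toUT_apply (hlt Γ hΓ)]
    split_ifs <;> omega

/-- The assertion for a single summand `F^{(N)} h`. -/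
theorem bracket_word_FMul (ha : StrictMono a) (hb : StrictAnti b)
    (hai : ∀ j, a j ≤ i.castSucc) (hib : ∀ j, i.castSucc < b j) {s : Fin q → List (Fin ℓ)}
    (hs : ∀ j, SatisfiesO (a j) i ((b j : ℕ) - 1) ((s j).map Fin.val)) (N : UT (ℓ + 1))
    (h : uZero K ℓ) : (bracket K i (word i s) (FMul K N h) : Hyp K ℓ) =
      ∑ Γ ∈ flows i a b, sgn i a b Γ •
        (F K (N - toUT Γ) * (shift K (fundWeight i) h : Hyp K ℓ)) := by
  have key : bracket K i (word i s) (FMul K N h) = ∑ Γ ∈ flows i a b,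
      (sgn i a b Γ : K) • FMulLin K (N - toUT Γ) (shift K (fundWeight i) h) := by
    refine uMinusZero_ext K fun μ f hf hf' => ?_
    rw [pairing_bracket i _ hf hf']
    refine (pairing_mul_shift K hf' (bracketFun_isWeight i _) _ _ _
      (pairing_bracketFun_mul_F ha hb hai hib hs f N) h).trans ?_
    rw [AddSubmonoidClass.coe_finsetSum, map_sum]
    exact Finset.sum_congr rfl fun Γ _ => (map_smul (pairing K f) (sgn i a b Γ : K) _).symm
  rw [key, AddSubmonoidClass.coe_finsetSum]
  exact Finset.sum_congr rfl fun Γ _ => Int.cast_smul_eq_zsmul K _ _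

end Main

end Hyperalgebra

end

theorem lemma27 {K : Type*} [Field K] [IsAlgClosed K] {ℓ q : ℕ} (i : Fin ℓ)
    (a b : Fin q → Fin (ℓ + 1)) (ha : StrictMono a) (hb : StrictAnti b)
    (hai : ∀ j, a j ≤ i.castSucc) (hib : ∀ j, i.castSucc < b j)
    (s : Fin q → List (Fin ℓ))
    (hs : ∀ j, Hyperalgebra.SatisfiesO (a j) i ((b j : ℕ) - 1) ((s j).map Fin.val)) :
    (∀ H : Hyperalgebra.UT (ℓ + 1) → Hyperalgebra.uZero K ℓ, (Function.support H).Finite →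
      (Hyperalgebra.bracket K i (Hyperalgebra.word i s)
          (∑ᶠ N, Hyperalgebra.FMul K N (H N)) : Hyperalgebra.Hyp K ℓ) =
        ∑ᶠ N, Hyperalgebra.F K N * ∑ Γ ∈ Hyperalgebra.flows i a b,
          Hyperalgebra.sgn i a b Γ •
            (Hyperalgebra.theta K (Hyperalgebra.fundWeight i)
              (Hyperalgebra.zeroIncl K (H (N + Hyperalgebra.toUT Γ))) : Hyperalgebra.Hyp K ℓ)) ∧
    (∀ s' : Fin q → List (Fin ℓ),
      (∀ j, Hyperalgebra.SatisfiesO (a j) i ((b j : ℕ) - 1) ((s' j).map Fin.val)) →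
      Hyperalgebra.bracket K i (Hyperalgebra.word i s') =
        Hyperalgebra.bracket K i (Hyperalgebra.word i s)) := by
  open Hyperalgebra in
  refine ⟨fun H hH => ?_, fun s' hs' => bracket_eq_of_bracketFun_eq ?_⟩
  · have hsupp : ∀ (T : UT (ℓ + 1) → uZero K ℓ → Hyp K ℓ), (∀ N, T N 0 = 0) →
        (Function.support fun N => T N (H N)) ⊆ hH.toFinset := fun T hT N hN => by
      rw [hH.coe_toFinset]
      exact fun h => hN (by
        change T N (H N) = 0
        rw [h, hT])
    have h1 : ∑ᶠ N, FMul K N (H N) = ∑ N ∈ hH.toFinset, FMul K N (H N) := by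
      refine finsum_eq_sum_of_support_subset _ fun N hN => ?_
      rw [hH.coe_toFinset]
      exact fun h => hN (by
        change FMul K N (H N) = 0
        rw [h]
        exact map_zero (FMulLin K N))
    let G : UT (ℓ + 1) → Finset (Fin (ℓ + 1) × Fin (ℓ + 1)) → Hyp K ℓ := fun N Γ =>
      sgn i a b Γ • (F K (N - toUT Γ) * (shift K (fundWeight i) (H N) : Hyp K ℓ))
    have hG : ∀ Γ, Function.support (fun N => G N Γ) ⊆ hH.toFinset := fun Γ =>
      hsupp (fun N h => sgn i a b Γ • (F K (N - toUT Γ) * (shift K (fundWeight i) h : Hyp K ℓ)))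
        fun N => by rw [map_zero, ZeroMemClass.coe_zero, mul_zero, smul_zero]
    have h2 : ∀ N, F K N * ∑ Γ ∈ flows i a b, sgn i a b Γ •
        (theta K (fundWeight i) (zeroIncl K (H (N + toUT Γ))) : Hyp K ℓ) =
        ∑ Γ ∈ flows i a b, G (Equiv.addRight (toUT Γ) N) Γ := fun N => by
      rw [Finset.mul_sum]
      refine Finset.sum_congr rfl fun Γ _ => ?_
      change _ = sgn i a b Γ • (F K (N + toUT Γ - toUT Γ) *
        (shift K (fundWeight i) (H (N + toUT Γ)) : Hyp K ℓ))
      rw [coe_theta_zeroIncl, add_sub_cancel_right, mul_smul_comm]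
    rw [h1, map_sum, AddSubmonoidClass.coe_finsetSum, finsum_congr h2, finsum_sum_comm]
    · have h3 : ∀ Γ, ∑ᶠ N, G (Equiv.addRight (toUT Γ) N) Γ = ∑ N ∈ hH.toFinset, G N Γ := fun Γ =>
        (finsum_comp_equiv (Equiv.addRight (toUT Γ)) (f := fun N => G N Γ)).trans
          (finsum_eq_sum_of_support_subset _ (hG Γ))
      rw [Finset.sum_congr rfl fun Γ _ => h3 Γ, Finset.sum_comm]
      exact Finset.sum_congr rfl fun N _ => bracket_word_FMul ha hb hai hib hs N (H N)
    · intro Γ _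
      exact (hH.toFinset.finite_toSet.subset (hG Γ)).preimage
        (Equiv.addRight (toUT Γ)).injective.injOn
  · rw [bracketFun_word i a b ha hb hai hib s' hs', bracketFun_word i a b ha hb hai hib s hs]
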